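/- Let $H$ be the Hilbert transform on $\mathbb R$, $Hf(x)=\frac1\pi\,\mathrm{p.v.}\!\int\frac{f(y)}{x-y}\,dy$, let $\chi=\chi_{[0,1]}$, and consider $$\partial_t f=H(\chi f)\quad(t\ge 0),\qquad f(0)=f_0 .\tag{E}$$ For $1<p<\infty$, an $L^p$ solution of (E) is a map $f\colon[0,\infty)\to L^p(\mathbb R)$ (real-valued functions) with $f(0)=f_0$ that is differentiable in $L^p$ at every $t\ge0$ (one-sidedly at $t=0$) and satisfies $\partial_t f(t)=H(\chi f(t))$. **Theorem 1.1.** 1. There is a universal constant $c>0$ such that for all $1<p<\infty$ and $f_0\in L^p(\mathbb R)$ there is an $L^p$ solution, and every $L^p$ solution satisfies for all $t\ge0$ $$\|f(t)\|_{L^p}\le e^{c\,\max\{p,\,p/(p-1)\}\,t}\,\|f_0\|_{L^p};$$ in particular $\|f(t)\|_{L^p}\le e^{cpt}\|f_0\|_{L^p}$ for $p\ge2$. The solution is unique and does not depend on the exponent: an $L^p$ and an $L^q$ solution with the same datum agree a.e. for every $t\ge 0$. 2. The growth is sharp. Let $f_0=\chi\in L^1\cap L^\infty$, with solution $f$. For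 every $p_0>2$ there are $c,C,K>0$ such that for all $p\ge p_0$ and $t\ge0$ $$\|f(t)\|_{L^p}\ge C\,e^{cpt}\,\|f_0\|_{L^p},\qquad\text{and}\qquad \|f(t)\|_{L^p}\ge e^{cpt}\,\|f_0\|_{L^p}\ \text{ if } pt\ge K .$$ Moreover, for every $T>0$ there are $c,C>0$ such that $\|f(t)\|_{L^p}\ge C e^{cpt}\|f_0\|_{L^p}$ for all $1<p<\infty$ and $0\le t\le T$. 3. Consequently (E) is ill-posed in every space at the scaling of $L^\infty$. Here such a space is a seminormed space $X$ of locally integrable functions on $\mathbb R$ that contains $C_c^\infty(\mathbb R)$, is invariant under the maps $g\mapsto g(r\,\cdot+b)$, $r>0$, $b\in\mathbb R$, with $\|g(r\,\cdot+b)\|_X\le K\|g\|_X$ for a constant $K$ depending only on $X$, and satisfies $|\int g\varphi|\le C_\varphi\|g\|_X$ for all $g\in X$ and each $\varphi\in C_c^\infty(\mathbb R)$ with $\int\varphi=0$. Ill-posed means that there is $f_0\in X\cap L^1\cap L^\infty$ whose solution satisfies $f(t)\notin X$ for every $t>0$. This in fact happens for every $f_0\in X\cap L^1\cap L^\infty$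 with $f_0=1$ a.e. on $[0,1]$. The space $BMO(\mathbb R)$ is included; there $f_0=\chi\in BMO$, and $f(t)\notin BMO$ for every $t>0$. -/

import Mathlib

open MeasureTheory Set Filter Topology

noncomputable section

/-- The coefficient `χ_{[0,1]}`. -/
def chi : ℝ → ℝ := Set.indicator (Set.Icc (0 : ℝ) 1) (fun _ => (1 : ℝ))

/-- Test functions on the line: smooth with compact support. -/
def IsTest (φ : ℝ → ℝ) : Prop := ContDiff ℝ (⊤ : ℕ∞) φ ∧ HasCompactSupport φ

/-- The Hilbert transform `(1/π) p.v. ∫ φ(y)/(x-y) dy` of a test function. The two sides of the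
principal value are folded together, `y = x - u` and `y = x + u`, which makes the integral
absolutely convergent. -/
def hilbertTest (φ : ℝ → ℝ) (x : ℝ) : ℝ :=
  Real.pi⁻¹ * ∫ u in Set.Ioi (0 : ℝ), (φ (x - u) - φ (x + u)) / u

/-- `v` is the Hilbert transform of `u`, where `u ∈ L^p(ℝ)` for some `1 ≤ p < ∞`. The Hilbert
transform is antisymmetric, and it is extended from test functions by duality: `⟨Hu, φ⟩ = -⟨u, Hφ⟩`.
(For a test function `φ`, `Hφ` is bounded and `O(1/|x|)` at infinity, so `u * Hφ` is integrable.)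
This determines `v` almost everywhere. -/
def IsHilbertTransform (u v : ℝ → ℝ) : Prop :=
  LocallyIntegrable v volume ∧
    ∀ φ : ℝ → ℝ, IsTest φ → ∫ x, v x * φ x = -∫ x, u x * hilbertTest φ x

/-- `f` is an `L^p` solution on `[0,∞)` of `∂_t f = H(χ_{[0,1]} f)`, `f(0) = f₀`: each `f t` is in
`L^p`, and `t ↦ f t` is differentiable as an `L^p`-valued map (one-sidedly at `t = 0`), with
derivative `g t = H(χ_{[0,1]} f t)`. -/
def IsSolution (p : ℝ) (f₀ : ℝ → ℝ) (f : ℝ → ℝ → ℝ) : Prop :=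
  f 0 =ᵐ[volume] f₀ ∧
  (∀ t : ℝ, 0 ≤ t → MemLp (f t) (ENNReal.ofReal p) volume) ∧
  ∃ g : ℝ → ℝ → ℝ, ∀ t : ℝ, 0 ≤ t →
    MemLp (g t) (ENNReal.ofReal p) volume ∧
    IsHilbertTransform (fun x => chi x * f t x) (g t) ∧
    Tendsto (fun s : ℝ => eLpNorm (fun x => (f s x - f t x) / (s - t) - g t x)
        (ENNReal.ofReal p) volume)
      (𝓝[Set.Ici 0 \ {t}] t) (𝓝 0)

/-- A space of functions on the line at the scaling of `L^∞`: a seminormed space of locally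
integrable functions that contains the test functions, whose seminorm is invariant up to a constant
under translations and under the dilations `f ↦ f(r ·)`, and in which convergence implies
convergence in the sense of distributions modulo constants (homogeneous spaces such as `BMO` do not
see constants). -/
structure CriticalSpace where
  carrier : Submodule ℝ (ℝ → ℝ)
  seminorm : Seminorm ℝ carrier
  integrable : ∀ f ∈ carrier, ∀ a b : ℝ, IntervalIntegrable f volume a b
  test_mem : ∀ φ : ℝ → ℝ, IsTest φ → φ ∈ carrier
  affine_mem : ∀ f ∈ carrier, ∀ r b : ℝ, 0 < r → (fun x => f (r * x + b)) ∈ carrier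
  affine_le : ∃ K : ℝ, ∀ (f g : carrier) (r b : ℝ), 0 < r →
    (∀ x, (g : ℝ → ℝ) x = (f : ℝ → ℝ) (r * x + b)) → seminorm g ≤ K * seminorm f
  pairing_le : ∀ φ : ℝ → ℝ, IsTest φ → ∫ x, φ x = 0 →
    ∃ C : ℝ, ∀ f : carrier, |∫ x, (f : ℝ → ℝ) x * φ x| ≤ C * seminorm f

/-- The solution with datum `f₀` leaves `X` at once: for every `t > 0`, no representative of `f t`
is in `X`. -/
def LeavesAtOnce (X : CriticalSpace) (f₀ : ℝ → ℝ) : Prop :=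
  ∀ p : ℝ, 1 < p → ∀ f : ℝ → ℝ → ℝ, IsSolution p f₀ f →
    ∀ t : ℝ, 0 < t → ∀ h : ℝ → ℝ, h =ᵐ[volume] f t → h ∉ X.carrier

/-- Ill-posedness of the equation in `X`, by failure of local existence: some datum in `X`, which is
also in `L^1 ∩ L^∞`, has a solution that is not in `X` at any positive time. -/
def IllPosedIn (X : CriticalSpace) : Prop :=
  ∃ f₀ ∈ X.carrier, MemLp f₀ 1 volume ∧ MemLp f₀ ⊤ volume ∧ LeavesAtOnce X f₀

/-- Mean of `f` over `[a,b]`. -/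
def mean (f : ℝ → ℝ) (a b : ℝ) : ℝ := (b - a)⁻¹ * ∫ x in a..b, f x

/-- Mean oscillation of `f` over `[a,b]`. -/
def osc (f : ℝ → ℝ) (a b : ℝ) : ℝ := mean (fun x => |f x - mean f a b|) a b

/-- Bounded mean oscillation. -/
def MemBMO (f : ℝ → ℝ) : Prop :=
  (∀ a b : ℝ, IntervalIntegrable f volume a b) ∧ ∃ M : ℝ, ∀ a b : ℝ, a < b → osc f a b ≤ M

/-- The `BMO` seminorm, the supremum of the mean oscillations. -/
def bmoNorm (f : ℝ → ℝ) : ℝ := ⨆ I : {I : ℝ × ℝ // I.1 < I.2}, osc f I.1.1 I.1.2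

theorem mean_le_mean {f g : ℝ → ℝ} {a b : ℝ} (hab : a < b) (hf : IntervalIntegrable f volume a b)
    (hg : IntervalIntegrable g volume a b) (h : ∀ x, f x ≤ g x) : mean f a b ≤ mean g a b := by
  unfold mean
  have : 0 < b - a := sub_pos.2 hab
  gcongr
  exact intervalIntegral.integral_mono_on hab.le hf hg (fun x _ => h x)

theorem mean_add {f g : ℝ → ℝ} {a b : ℝ} (hf : IntervalIntegrable f volume a b)
    (hg : IntervalIntegrable g volume a b) :
    mean (fun x => f x + g x) a b = mean f a b + mean g a b := by
  unfold mean
  rw [intervalIntegral.integral_add hf hg, mul_add]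

theorem mean_smul (c : ℝ) (f : ℝ → ℝ) (a b : ℝ) :
    mean (fun x => c * f x) a b = c * mean f a b := by
  unfold mean
  rw [intervalIntegral.integral_const_mul]; ring

theorem osc_integrable {f : ℝ → ℝ} {a b : ℝ} (hf : IntervalIntegrable f volume a b) :
    IntervalIntegrable (fun x => |f x - mean f a b|) volume a b :=
  (hf.sub intervalIntegrable_const).abs

theorem osc_add {f g : ℝ → ℝ} {a b : ℝ} (hab : a < b) (hf : IntervalIntegrable f volume a b)
    (hg : IntervalIntegrable g volume a b) :
    osc (f + g) a b ≤ osc f a b + osc g a b := by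
  unfold osc
  have hm : mean (f + g) a b = mean f a b + mean g a b := mean_add hf hg
  rw [← mean_add (osc_integrable hf) (osc_integrable hg)]
  refine mean_le_mean hab (osc_integrable (hf.add hg))
    ((osc_integrable hf).add (osc_integrable hg)) (fun x => ?_)
  rw [hm, Pi.add_apply]
  calc |f x + g x - (mean f a b + mean g a b)|
      = |(f x - mean f a b) + (g x - mean g a b)| := by congr 1; ring
    _ ≤ _ := abs_add_le _ _

theorem osc_smul (c : ℝ) (f : ℝ → ℝ) (a b : ℝ) : osc (c • f) a b = |c| * osc f a b := by
  unfold osc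
  have hm : mean (c • f) a b = c * mean f a b := mean_smul c f a b
  rw [← mean_smul]
  congr 1
  funext x
  rw [hm, Pi.smul_apply, smul_eq_mul, ← mul_sub, abs_mul]

theorem osc_nonneg {f : ℝ → ℝ} {a b : ℝ} (hab : a < b) : 0 ≤ osc f a b :=
  mul_nonneg (inv_nonneg.2 (sub_pos.2 hab).le)
    (intervalIntegral.integral_nonneg hab.le (fun _ _ => abs_nonneg _))

theorem mean_affine (f : ℝ → ℝ) {r : ℝ} (hr : 0 < r) (d a b : ℝ) :
    mean (fun x => f (r * x + d)) a b = mean f (r * a + d) (r * b + d) := by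
  unfold mean
  rw [intervalIntegral.integral_comp_mul_add f hr.ne' d, smul_eq_mul, ← mul_assoc, ← mul_inv]
  congr 2
  ring

theorem osc_affine (f : ℝ → ℝ) {r : ℝ} (hr : 0 < r) (d a b : ℝ) :
    osc (fun x => f (r * x + d)) a b = osc f (r * a + d) (r * b + d) := by
  unfold osc
  rw [mean_affine f hr]
  exact mean_affine (fun y => |f y - mean f (r * a + d) (r * b + d)|) hr d a b

theorem integrable_affine {f : ℝ → ℝ} (hf : ∀ a b : ℝ, IntervalIntegrable f volume a b) {r : ℝ}
    (hr : 0 < r) (d a b : ℝ) : IntervalIntegrable (fun x => f (r * x + d)) volume a b := by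
  have h1 := (hf (r * a + d) (r * b + d)).comp_add_right d
  have h2 := h1.comp_mul_left (c := r)
  convert h2 using 1 <;> field_simp <;> ring

theorem MemBMO.osc_le {f : ℝ → ℝ} (hf : MemBMO f) {a b : ℝ} (hab : a < b) :
    osc f a b ≤ bmoNorm f := by
  obtain ⟨M, hM⟩ := hf.2
  exact le_ciSup (f := fun I : {I : ℝ × ℝ // I.1 < I.2} => osc f I.1.1 I.1.2)
    ⟨M, by rintro _ ⟨I, rfl⟩; exact hM _ _ I.2⟩ ⟨(a, b), hab⟩

instance : Nonempty {I : ℝ × ℝ // I.1 < I.2} := ⟨⟨(0, 1), zero_lt_one⟩⟩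

theorem bmoNorm_le {f : ℝ → ℝ} {M : ℝ} (h : ∀ a b : ℝ, a < b → osc f a b ≤ M) : bmoNorm f ≤ M :=
  ciSup_le fun I => h _ _ I.2

theorem memBMO_of_bounded {f : ℝ → ℝ} (hf : ∀ a b : ℝ, IntervalIntegrable f volume a b) {B : ℝ}
    (hB : ∀ x, |f x| ≤ B) : MemBMO f := by
  have key : ∀ (g : ℝ → ℝ) (D a b : ℝ), a < b → IntervalIntegrable g volume a b →
      (∀ x, |g x| ≤ D) → |mean g a b| ≤ D := by
    intro g D a b hab hg hD
    have h0 : (b - a)⁻¹ * (b - a) = 1 := inv_mul_cancel₀ (sub_pos.2 hab).ne'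
    have hc : ∀ e : ℝ, mean (fun _ => e) a b = e := by
      intro e
      unfold mean
      rw [intervalIntegral.integral_const, smul_eq_mul, ← mul_assoc, h0, one_mul]
    rw [abs_le]
    constructor
    · rw [← hc (-D)]
      exact mean_le_mean hab intervalIntegrable_const hg (fun x => (abs_le.1 (hD x)).1)
    · rw [← hc D]
      exact mean_le_mean hab hg intervalIntegrable_const (fun x => (abs_le.1 (hD x)).2)
  refine ⟨hf, B + B, fun a b hab => ?_⟩
  refine (le_abs_self _).trans (key _ _ a b hab (osc_integrable (hf a b)) (fun x => ?_))
  rw [abs_abs]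
  exact (abs_sub _ _).trans (add_le_add (hB x) (key f B a b hab (hf a b) hB))

/-- `BMO(ℝ)`. -/
def bmo : CriticalSpace where
  carrier :=
    { carrier := {f | MemBMO f}
      add_mem' := by
        intro f g hf hg
        exact ⟨fun a b => (hf.1 a b).add (hg.1 a b), bmoNorm f + bmoNorm g, fun a b hab =>
          (osc_add hab (hf.1 a b) (hg.1 a b)).trans (add_le_add (hf.osc_le hab) (hg.osc_le hab))⟩
      zero_mem' := memBMO_of_bounded (B := 0) (fun a b => intervalIntegrable_const) (by simp)
      smul_mem' := by
        intro c f hf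
        refine ⟨fun a b => (hf.1 a b).smul c, |c| * bmoNorm f, fun a b hab => ?_⟩
        rw [osc_smul]
        exact mul_le_mul_of_nonneg_left (hf.osc_le hab) (abs_nonneg c) }
  seminorm := Seminorm.of (fun f => bmoNorm f.1)
    (by
      intro f g
      exact bmoNorm_le fun a b hab => (osc_add hab (f.2.1 a b) (g.2.1 a b)).trans
        (add_le_add (f.2.osc_le hab) (g.2.osc_le hab)))
    (by
      intro c f
      have : ∀ I : {I : ℝ × ℝ // I.1 < I.2}, osc (c • f.1) I.1.1 I.1.2
          = |c| * osc f.1 I.1.1 I.1.2 := fun I => osc_smul _ _ _ _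
      change (⨆ I : {I : ℝ × ℝ // I.1 < I.2}, osc (c • f.1) I.1.1 I.1.2) = _
      simp_rw [this, Real.norm_eq_abs]
      exact (Real.mul_iSup_of_nonneg (abs_nonneg c) _).symm)
  integrable := fun f hf => hf.1
  test_mem := by
    intro φ hφ
    obtain ⟨B, hB⟩ := hφ.2.exists_bound_of_continuous hφ.1.continuous
    exact memBMO_of_bounded (fun a b => hφ.1.continuous.intervalIntegrable a b) hB
  affine_mem := by
    intro f hf r d hr
    refine ⟨fun a b => integrable_affine hf.1 hr d a b, bmoNorm f, fun a b hab => ?_⟩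
    rw [osc_affine f hr]
    exact hf.osc_le (by nlinarith)
  affine_le := by
    refine ⟨1, fun f g r d hr hg => ?_⟩
    rw [one_mul]
    refine bmoNorm_le fun a b hab => ?_
    have : (g : ℝ → ℝ) = fun x => f.1 (r * x + d) := funext hg
    rw [this, osc_affine f.1 hr]
    exact f.2.osc_le (by nlinarith)
  pairing_le := by
    intro φ hφ h0
    obtain ⟨B, hB⟩ := hφ.2.exists_bound_of_continuous hφ.1.continuous
    obtain ⟨R, hR⟩ := hφ.2.isBounded.subset_closedBall (0 : ℝ)
    set S : ℝ := max R 1 with hS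
    have hS0 : (-S) < S := by have : (1 : ℝ) ≤ S := le_max_right _ _; linarith
    have hz : ∀ x, x ∉ Set.Ioc (-S) S → x ≠ -S → φ x = 0 := by
      intro x hx hx'
      by_contra hne
      have h1 := hR (subset_tsupport φ hne)
      rw [Metric.mem_closedBall, Real.dist_eq, sub_zero] at h1
      have h2 := abs_le.1 (h1.trans (le_max_left R 1))
      exact hx ⟨lt_of_le_of_ne h2.1 (Ne.symm hx'), h2.2⟩
    have hint : ∀ u : ℝ → ℝ, ∫ x, u x * φ x = ∫ x in (-S)..S, u x * φ x := by
      intro u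
      rw [intervalIntegral.integral_of_le hS0.le, ← integral_Icc_eq_integral_Ioc]
      refine (setIntegral_eq_integral_of_forall_compl_eq_zero fun x hx => ?_).symm
      rw [hz x (fun h => hx ⟨h.1.le, h.2⟩) (fun h => hx ⟨h.ge, by linarith⟩), mul_zero]
    refine ⟨(S - -S) * B, fun f => ?_⟩
    set m := mean f.1 (-S) S
    have hfi := f.2.1 (-S) S
    have hφi : IntervalIntegrable φ volume (-S) S := hφ.1.continuous.intervalIntegrable _ _
    have e1 : ∫ x, f.1 x * φ x = ∫ x in (-S)..S, (f.1 x - m) * φ x := by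
      have h2 : ∫ x in (-S)..S, m * φ x = 0 := by
        rw [← hint (fun _ => m), integral_const_mul, h0, mul_zero]
      rw [hint]
      simp_rw [sub_mul]
      rw [intervalIntegral.integral_sub (hfi.mul_continuousOn hφ.1.continuous.continuousOn)
        (hφi.const_mul m), h2, sub_zero]
    rw [e1]
    have e2 : |∫ x in (-S)..S, (f.1 x - m) * φ x| ≤ ∫ x in (-S)..S, |f.1 x - m| * B := by
      refine (intervalIntegral.abs_integral_le_integral_abs hS0.le).trans ?_
      refine intervalIntegral.integral_mono_on hS0.le
        (((hfi.sub intervalIntegrable_const).mul_continuousOn hφ.1.continuous.continuousOn).abs)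
        ((osc_integrable hfi).mul_const B) (fun x _ => ?_)
      rw [abs_mul]
      exact mul_le_mul_of_nonneg_left (hB x) (abs_nonneg _)
    have e3 : ∫ x in (-S)..S, |f.1 x - m| * B = (S - -S) * B * osc f.1 (-S) S := by
      have h3 : osc f.1 (-S) S = (S - -S)⁻¹ * ∫ x in (-S)..S, |f.1 x - m| := rfl
      have h4 : S - -S ≠ 0 := by linarith
      rw [intervalIntegral.integral_mul_const, h3, mul_comm (S - -S) B, mul_assoc,
        mul_inv_cancel_left₀ h4, mul_comm]
    have hB0 : 0 ≤ B := (norm_nonneg _).trans (hB 0)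
    rw [e3] at e2
    exact e2.trans (mul_le_mul_of_nonneg_left (f.2.osc_le hS0)
      (mul_nonneg (by linarith) hB0))

end

/-! Everything rests on one fact about the upper half-plane: a dominated holomorphic function
decaying faster than 1/|z| has boundary values of integral zero (`integral_boundary_eq_zero`).
Applied to products with Cauchy integrals ψ + iHψ, it shows that boundary values of functions of
decay 1/|z| have the form u + iHu (`isHilbertTransform_boundary`); in particular H is antisymmetric.

Well-posedness. For φ ≥ 0 the Cauchy integral of φ takes values in the right half-plane, so its p-th
power is holomorphic and has boundary integral zero. Combined with a pointwise inequality between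
|z|^p, (Re z)^p and Re z^p, this is M. Riesz's theorem for 1 < p ≤ 2, with constant O(1/(p-1));
duality gives O(p) for p ≥ 2. Hence A f = H(χf) is bounded on L^p with norm at most 12 max(p,
p/(p-1)), the solution is exp(tA)f₀, and Grönwall gives the upper bound. The exponent does not
matter because the powers of A agree on different L^p spaces.

Growth. For 0 < δ < 1 let k_δ(x) = x^{-δ}(1-x)^{δ-1} on (0,1). The function
(-iz)^{-δ}(-i(z-1))^{δ-1} has boundary real part sin(πδ) k_δ, which shows Hk_δ = -cot(πδ) k_δ on
(0,1). By antisymmetry k_δ is an eigenvector of the adjoint of A, so ∫ f(t) k_δ = e^{cot(πδ)t} ∫ f₀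
k_δ. It lies in the dual of L^p when 1/p < δ < 1 - 1/p. Taking δ = l/p with a fixed l > 1 makes the
rate of order p, and Hölder turns this into a lower bound for the norm (`exists_lower_bound`). For
the remaining p, on bounded times, the conserved pairing with k_{1/2} suffices
(`exists_lower_bound_of_le`).

Ill-posedness. If f₀ = 1 on [0,1], then ∫ f(t) k_δ is at least e^{at/δ} for all small δ, with a
fixed a > 0. If f(t) were in X, scale invariance would bound its averages against a mean-zero bump
at every scale around the point 1. Integrating over scales against r^{δ-1} (`abs_mellin_mul_le`)
bounds δ|∫ f(t) k_δ| by O(1/δ), the factor δ being the size of the Mellin moment of the bump. So ∫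
f(t) k_δ = O(δ^{-2}), a contradiction as δ tends to 0. -/

/-! ### The pointwise inequality behind M. Riesz's theorem. -/

/-- If y = 4 cos θ/(p-1) is at least 1, then y^p ≥ y while the subtracted term is at most y/2,
because cos(pθ) ≤ cos θ. Otherwise θ is so near π/2 that pθ exceeds π/2 by at least π(p-1)/4;
Jordan's inequality then makes -cos(pθ) at least (p-1)/2, and the second term alone suffices. -/
theorem one_le_cos_rpow_sub_cos_mul {p θ : ℝ} (h1 : 1 < p) (h2 : p ≤ 2) (h0 : 0 ≤ θ)
    (hθ : θ ≤ Real.pi / 2) :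
    1 ≤ 3 / 2 * (4 / (p - 1)) ^ p * Real.cos θ ^ p - 2 / (p - 1) * Real.cos (θ * p) := by
  have hδ : 0 < p - 1 := by linarith
  have hπ := Real.pi_pos
  have hcos : 0 ≤ Real.cos θ := Real.cos_nonneg_of_mem_Icc ⟨by linarith, hθ⟩
  rcases le_or_gt ((p - 1) / 4) (Real.cos θ) with hc | hc
  · have e : (4 / (p - 1)) ^ p * Real.cos θ ^ p = (4 * Real.cos θ / (p - 1)) ^ p := by
      rw [← Real.mul_rpow (by positivity) hcos]; congr 1; ring
    have c1 : 1 ≤ 4 * Real.cos θ / (p - 1) := by rw [le_div_iff₀ hδ]; linarith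
    have c2 : 4 * Real.cos θ / (p - 1) ≤ (4 * Real.cos θ / (p - 1)) ^ p := by
      simpa using Real.rpow_le_rpow_of_exponent_le c1 h1.le
    have c3 : Real.cos (θ * p) ≤ Real.cos θ := by
      apply Real.cos_le_cos_of_nonneg_of_le_pi h0 <;> nlinarith
    have c4 : 2 / (p - 1) * Real.cos (θ * p) ≤ 2 / (p - 1) * Real.cos θ :=
      mul_le_mul_of_nonneg_left c3 (by positivity)
    have c5 : 2 / (p - 1) * Real.cos θ = (4 * Real.cos θ / (p - 1)) / 2 := by ring
    rw [mul_assoc, e]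
    linarith
  · have hs : Real.sin (Real.pi / 2 - θ) = Real.cos θ := Real.sin_pi_div_two_sub θ
    have h3 := Real.mul_le_sin (x := Real.pi / 2 - θ) (by linarith) (by linarith)
    rw [hs] at h3
    have h4 : Real.pi / 2 - θ < Real.pi * (p - 1) / 8 := by
      have : 2 / Real.pi * (Real.pi / 2 - θ) < (p - 1) / 4 := h3.trans_lt hc
      rw [div_mul_eq_mul_div, div_lt_iff₀ hπ] at this
      linarith
    have h5 : Real.pi * (p - 1) / 4 ≤ θ * p - Real.pi / 2 := by nlinarith
    have h6 := Real.mul_le_sin (x := θ * p - Real.pi / 2)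
      (by have := mul_pos hπ hδ; linarith) (by nlinarith)
    rw [Real.sin_sub_pi_div_two] at h6
    have h7 : (p - 1) / 2 ≤ - Real.cos (θ * p) := by
      refine le_trans ?_ h6
      rw [div_mul_eq_mul_div, le_div_iff₀ hπ]
      linarith
    have h8 : 1 ≤ 2 / (p - 1) * (- Real.cos (θ * p)) := by
      rw [div_mul_eq_mul_div, le_div_iff₀ hδ]; linarith
    have h9 : 0 ≤ 3 / 2 * (4 / (p - 1)) ^ p * Real.cos θ ^ p := by positivity
    linarith

theorem norm_rpow_le_re_rpow_sub_re_cpow {p : ℝ} (h1 : 1 < p) (h2 : p ≤ 2) {z : ℂ}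
    (hz : 0 ≤ z.re) :
    ‖z‖ ^ p ≤ 3 / 2 * (4 / (p - 1)) ^ p * z.re ^ p - 2 / (p - 1) * (z ^ (p : ℂ)).re := by
  have h := one_le_cos_rpow_sub_cos_mul h1 h2 (abs_nonneg z.arg)
    (Complex.abs_arg_le_pi_div_two_iff.2 hz)
  have e : Real.cos (|z.arg| * p) = Real.cos (z.arg * p) := by
    rw [← abs_of_pos (show 0 < p by linarith), ← abs_mul, Real.cos_abs, abs_of_pos (by linarith)]
  rw [Real.cos_abs, e] at h
  have hc : 0 ≤ Real.cos z.arg :=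
    Real.cos_nonneg_of_mem_Icc (abs_le.1 (Complex.abs_arg_le_pi_div_two_iff.2 hz))
  have hr : z.re ^ p = ‖z‖ ^ p * Real.cos z.arg ^ p := by
    rw [← Real.mul_rpow (norm_nonneg z) hc, Complex.norm_mul_cos_arg]
  rw [Complex.cpow_ofReal_re, hr]
  have := mul_le_mul_of_nonneg_left h (show 0 ≤ ‖z‖ ^ p by positivity)
  linarith

/-! ### Contour integrals in the upper half-plane. -/

/-- The integral of a holomorphic function on the upper half-plane with decay `|z|^{-s}`, `s > 1`,
over a horizontal line vanishes. -/
theorem integral_horizontal_eq_zero {G : ℂ → ℂ} (hG : DifferentiableOn ℂ G {z | 0 < z.im})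
    {C R s : ℝ} (hs : 1 < s) (hC : ∀ z : ℂ, 0 < z.im → R ≤ ‖z‖ → ‖G z‖ ≤ C * ‖z‖ ^ (-s))
    {t : ℝ} (ht : 0 < t) : ∫ x : ℝ, G (x + t * Complex.I) = 0 := by
  -- The integral of a non-integrable function is 0 by convention, so only the integrable case is at
  -- stake.
  by_cases hi : Integrable (fun x : ℝ => G (x + t * Complex.I))
  swap
  · exact integral_undef hi
  have l1 := intervalIntegral_tendsto_integral hi tendsto_neg_atTop_atBot tendsto_id
  refine tendsto_nhds_unique l1 ?_
  rw [tendsto_zero_iff_norm_tendsto_zero]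
  have l2 : Tendsto (fun r : ℝ => 4 * |C| * r ^ (-(s - 1))) atTop (𝓝 0) := by
    simpa using (tendsto_rpow_neg_atTop (show 0 < s - 1 by linarith)).const_mul (4 * |C|)
  refine squeeze_zero' (Eventually.of_forall fun _ => norm_nonneg _) ?_ l2
  filter_upwards [eventually_ge_atTop R, eventually_gt_atTop t, eventually_gt_atTop 0]
    with r hr1 hr2 hr3
  -- Rectangle with corners -r + it and r + ir. Apart from the bottom edge its boundary lies in |z|
  -- ≥ r and has length at most 4r, whence the bound 4|C| r^{1-s}.
  have key := Complex.integral_boundary_rect_eq_zero_of_differentiableOn G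
    (⟨-r, t⟩ : ℂ) (⟨r, r⟩ : ℂ) (hG.mono (by
      rintro z ⟨_, hz⟩
      simp only [Set.mem_preimage, uIcc_of_le hr2.le] at hz
      exact lt_of_lt_of_le ht hz.1))
  simp only at key
  have hb : ∀ z : ℂ, 0 < z.im → r ≤ ‖z‖ → ‖G z‖ ≤ |C| * r ^ (-s) := fun z hz hz' => by
    refine (hC z hz (hr1.trans hz')).trans ?_
    refine mul_le_mul (le_abs_self C) ?_ (by positivity) (abs_nonneg C)
    exact Real.rpow_le_rpow_of_nonpos hr3 hz' (by linarith)
  have b1 : ‖∫ x : ℝ in (-r)..r, G (x + r * Complex.I)‖ ≤ |C| * r ^ (-s) * |r - -r| := by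
    refine intervalIntegral.norm_integral_le_of_norm_le_const fun x _ => hb _ (by simpa) ?_
    refine le_trans ?_ (Complex.abs_im_le_norm _)
    simp [abs_of_pos hr3]
  have b2 : ∀ a : ℝ, |a| = r →
      ‖∫ y : ℝ in t..r, G (a + y * Complex.I)‖ ≤ |C| * r ^ (-s) * |r - t| := by
    intro a ha
    refine intervalIntegral.norm_integral_le_of_norm_le_const fun y hy => hb _ ?_ ?_
    · rw [uIoc_of_le hr2.le] at hy
      simpa using ht.trans hy.1
    · refine le_trans ?_ (Complex.abs_re_le_norm _)
      simp [ha]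
  have b3 := b2 r (abs_of_pos hr3)
  have b4 := b2 (-r) (by rw [abs_neg, abs_of_pos hr3])
  have e : (∫ x : ℝ in (-r)..r, G (x + t * Complex.I)) =
      (∫ x : ℝ in (-r)..r, G (x + r * Complex.I))
        - Complex.I * (∫ y : ℝ in t..r, G ((r : ℝ) + y * Complex.I))
        + Complex.I * (∫ y : ℝ in t..r, G ((-r : ℝ) + y * Complex.I)) := by
    simp only [smul_eq_mul] at key
    linear_combination key
  simp only [id]
  rw [e]
  have hp : |C| * r ^ (-s) * r = |C| * r ^ (-(s - 1)) := by
    rw [show -(s - 1) = -s + 1 by ring, Real.rpow_add_one hr3.ne']; ring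
  have n1 : |r - -r| = 2 * r := by rw [abs_of_pos] <;> linarith
  have n2 : |r - t| ≤ r := by rw [abs_of_pos] <;> linarith
  have n3 : |C| * r ^ (-s) * |r - t| ≤ |C| * r ^ (-s) * r :=
    mul_le_mul_of_nonneg_left n2 (by positivity)
  rw [n1] at b1
  refine (norm_add_le _ _).trans ?_
  refine (add_le_add_left (norm_sub_le _ _) _).trans ?_
  rw [norm_mul, norm_mul, Complex.norm_I, one_mul, one_mul]
  linarith

/-! ### The Cauchy integral of a Lipschitz function and its boundary values. -/

/-- Compactly supported Lipschitz functions on the line. -/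
def IsLipschitzCompact (φ : ℝ → ℝ) : Prop := (∃ L, LipschitzWith L φ) ∧ HasCompactSupport φ

theorem IsTest.isLipschitzCompact {φ : ℝ → ℝ} (h : IsTest φ) : IsLipschitzCompact φ :=
  ⟨ContDiff.lipschitzWith_of_hasCompactSupport h.2 h.1 (by simp), h.2⟩

namespace IsLipschitzCompact

variable {φ : ℝ → ℝ}

theorem continuous (h : IsLipschitzCompact φ) : Continuous φ := by
  obtain ⟨L, hL⟩ := h.1
  exact hL.continuous

theorem exists_bounds (h : IsLipschitzCompact φ) : ∃ S B L : ℝ, 0 < S ∧ 0 ≤ B ∧ 0 ≤ L ∧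
    (∀ y, S < |y| → φ y = 0) ∧ (∀ y, |φ y| ≤ B) ∧ ∀ x y, |φ x - φ y| ≤ L * |x - y| := by
  obtain ⟨L, hL⟩ := h.1
  obtain ⟨B, hB⟩ := h.2.exists_bound_of_continuous h.continuous
  obtain ⟨R, hR⟩ := h.2.isBounded.subset_closedBall (0 : ℝ)
  refine ⟨max R 1, B, L, by positivity, (norm_nonneg _).trans (hB 0), L.2, fun y hy => ?_, hB,
    fun x y => by simpa [Real.dist_eq] using hL.dist_le_mul x y⟩
  by_contra hne
  have h1 := hR (subset_tsupport φ hne)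
  rw [Metric.mem_closedBall, Real.dist_eq, sub_zero] at h1
  exact absurd (h1.trans (le_max_left R 1)) (not_le.2 hy)

theorem neg (h : IsLipschitzCompact φ) : IsLipschitzCompact (fun x => -φ x) := by
  obtain ⟨L, hL⟩ := h.1
  exact ⟨⟨L, hL.neg⟩, h.2.neg⟩

/-- Positive parts stay Lipschitz but lose smoothness. The splitting into positive and negative
parts in M. Riesz's theorem is the reason for working with Lipschitz functions rather than test
functions. -/
theorem posPart (h : IsLipschitzCompact φ) : IsLipschitzCompact (fun x => max (φ x) 0) := by
  obtain ⟨L, hL⟩ := h.1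
  exact ⟨⟨L, hL.max_const 0⟩, h.2.comp_left (g := fun y : ℝ => max y 0) (by simp)⟩

end IsLipschitzCompact

/-- The Cauchy integral of `φ`, whose real and imaginary parts are the Poisson extension of `φ` and
its harmonic conjugate. -/
noncomputable def cauchyTransform (φ : ℝ → ℝ) (z : ℂ) : ℂ :=
  (Complex.I / Real.pi) * ∫ y : ℝ, (φ y : ℂ) / (z - y)

section

variable {φ : ℝ → ℝ}

theorem differentiableOn_cauchyTransform (h : IsLipschitzCompact φ) :
    DifferentiableOn ℂ (cauchyTransform φ) {z | 0 < z.im} := by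
  intro z₀ hz₀
  have hz₀ : 0 < z₀.im := hz₀
  have him : ∀ z ∈ Metric.ball z₀ (z₀.im / 2), ∀ y : ℝ, z₀.im / 2 ≤ ‖z - y‖ := by
    intro z hz y
    have h1 : |(z - z₀).im| < z₀.im / 2 :=
      (Complex.abs_im_le_norm _).trans_lt (by simpa [dist_eq_norm] using hz)
    have h2 := Complex.abs_im_le_norm (z - y)
    rw [Complex.sub_im] at h1
    simp only [Complex.sub_im, Complex.ofReal_im, sub_zero] at h2
    have h3 := (abs_lt.1 h1).1
    have h4 := le_abs_self z.im
    linarith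
  have hne : ∀ z ∈ Metric.ball z₀ (z₀.im / 2), ∀ y : ℝ, z - (y : ℂ) ≠ 0 := by
    intro z hz y h0
    have := him z hz y
    rw [h0, norm_zero] at this
    linarith
  have hc : ∀ z ∈ Metric.ball z₀ (z₀.im / 2), Continuous (fun y : ℝ => (φ y : ℂ) / (z - y)) :=
    fun z hz => (Complex.continuous_ofReal.comp h.continuous).div
      (by fun_prop) (hne z hz)
  have hs : HasCompactSupport (fun y => |φ y| / (z₀.im / 2) ^ 2) := by
    have := h.2.comp_left (g := fun y : ℝ => |y| / (z₀.im / 2) ^ 2) (by simp)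
    exact this
  have hmem := Metric.ball_mem_nhds z₀ (half_pos hz₀)
  have key := hasDerivAt_integral_of_dominated_loc_of_deriv_le
    (F := fun (z : ℂ) (y : ℝ) => (φ y : ℂ) / (z - y))
    (F' := fun (z : ℂ) (y : ℝ) => -(φ y : ℂ) / (z - y) ^ 2) (x₀ := z₀) (μ := volume)
    (bound := fun y => |φ y| / (z₀.im / 2) ^ 2) hmem
    (by filter_upwards [hmem] with z hz using (hc z hz).aestronglyMeasurable)
    ((hc z₀ (Metric.mem_ball_self (half_pos hz₀))).integrable_of_hasCompactSupport (by
      refine HasCompactSupport.intro h.2 fun y hy => ?_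
      simp [image_eq_zero_of_notMem_tsupport hy]))
    (by
      refine Continuous.aestronglyMeasurable ?_
      exact ((Complex.continuous_ofReal.comp h.continuous).neg).div
        (by fun_prop) (fun y => pow_ne_zero 2 (hne z₀ (Metric.mem_ball_self (half_pos hz₀)) y)))
    (by
      refine Eventually.of_forall fun y z hz => ?_
      rw [norm_div, norm_neg, norm_pow, Complex.norm_real, Real.norm_eq_abs]
      have := him z hz y
      gcongr)
    ((h.continuous.abs.div_const _).integrable_of_hasCompactSupport hs)
    (by
      refine Eventually.of_forall fun y z hz => ?_
      have h1 : HasDerivAt (fun z : ℂ => z - (y : ℂ)) 1 z := (hasDerivAt_id z).sub_const _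
      have := (h1.inv (hne z hz y)).const_mul (φ y : ℂ)
      simpa [div_eq_mul_inv] using this)
  exact (key.2.differentiableAt.const_mul _).differentiableWithinAt

theorem norm_cauchyTransform_le (h : IsLipschitzCompact φ) : ∃ C R : ℝ, 0 < R ∧ 0 ≤ C ∧
    ∀ z : ℂ, R ≤ ‖z‖ → ‖cauchyTransform φ z‖ ≤ C / ‖z‖ := by
  obtain ⟨S, B, L, hS, hB, -, h0, hφB, -⟩ := h.exists_bounds
  have hi : Integrable (fun y => |φ y|) :=
    h.continuous.abs.integrable_of_hasCompactSupport (h.2.comp_left (g := fun y => |y|) abs_zero)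
  refine ⟨2 * ∫ y, |φ y|, 2 * S, by positivity, by positivity, fun z hz => ?_⟩
  have hz0 : 0 < ‖z‖ := by linarith
  have h1 : ‖∫ y : ℝ, (φ y : ℂ) / (z - y)‖ ≤ ∫ y, |φ y| * (2 / ‖z‖) := by
    refine norm_integral_le_of_norm_le (hi.mul_const _) (Eventually.of_forall fun y => ?_)
    rcases lt_or_ge S |y| with hy | hy
    · simp [h0 y hy]
    · rw [norm_div, Complex.norm_real, Real.norm_eq_abs, div_eq_mul_inv]
      have h2 : ‖z‖ / 2 ≤ ‖z - y‖ := by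
        have := norm_sub_norm_le z (y : ℂ)
        rw [Complex.norm_real, Real.norm_eq_abs] at this
        linarith
      have h3 : ‖z - y‖⁻¹ ≤ (‖z‖ / 2)⁻¹ := inv_anti₀ (by positivity) h2
      rw [inv_div] at h3
      exact mul_le_mul_of_nonneg_left h3 (abs_nonneg _)
  rw [integral_mul_const] at h1
  have hπ : Real.pi⁻¹ ≤ 1 := inv_le_one_of_one_le₀ (by linarith [Real.pi_gt_three])
  rw [cauchyTransform, norm_mul, norm_div, Complex.norm_I, Complex.norm_real,
    Real.norm_of_nonneg Real.pi_pos.le, one_div]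
  calc Real.pi⁻¹ * _ ≤ 1 * ((∫ y, |φ y|) * (2 / ‖z‖)) :=
        mul_le_mul hπ h1 (norm_nonneg _) zero_le_one
    _ = _ := by ring

/-- The Poisson integral and the conjugate Poisson integral, at height `t`. -/
noncomputable def poisson (φ : ℝ → ℝ) (t x : ℝ) : ℝ :=
  Real.pi⁻¹ * ∫ u, φ (x - u) * (t / (u ^ 2 + t ^ 2))

noncomputable def conjPoisson (φ : ℝ → ℝ) (t x : ℝ) : ℝ :=
  Real.pi⁻¹ * ∫ u in Ioi (0 : ℝ), (φ (x - u) - φ (x + u)) * (u / (u ^ 2 + t ^ 2))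

theorem integral_eq_integral_Ioi_add {f : ℝ → ℝ} (hf : Integrable f) :
    ∫ u, f u = ∫ u in Ioi (0 : ℝ), (f u + f (-u)) := by
  rw [integral_add hf.integrableOn hf.comp_neg.integrableOn, integral_comp_neg_Ioi, neg_zero,
    add_comm, intervalIntegral.integral_Iic_add_Ioi hf.integrableOn hf.integrableOn]

/-- With y = x - u the kernel becomes i/(u + it) = (t + iu)/(u² + t²). The odd part is folded onto
the half-line, so that it tends to the folded principal value of `hilbertTest`. -/
theorem cauchyTransform_eq (h : IsLipschitzCompact φ) {t : ℝ} (ht : 0 < t) (x : ℝ) :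
    cauchyTransform φ (x + t * Complex.I) = poisson φ t x + conjPoisson φ t x * Complex.I := by
  have hpos : ∀ u : ℝ, 0 < u ^ 2 + t ^ 2 := fun u => by positivity
  have hint : ∀ k : ℝ → ℝ, Continuous k → Integrable (fun u => φ (x - u) * k u) := fun k hk => by
    refine ((h.continuous.comp (continuous_const.sub continuous_id)).mul
      hk).integrable_of_hasCompactSupport ?_
    exact HasCompactSupport.mul_right
      (h.2.comp_isClosedEmbedding (Homeomorph.subLeft x).isClosedEmbedding)
  have i1 := hint (fun u => t / (u ^ 2 + t ^ 2))
    (continuous_const.div (by fun_prop) fun u => (hpos u).ne')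
  have i2 := hint (fun u => u / (u ^ 2 + t ^ 2))
    (continuous_id.div (by fun_prop) fun u => (hpos u).ne')
  have e1 : conjPoisson φ t x = Real.pi⁻¹ * ∫ u, φ (x - u) * (u / (u ^ 2 + t ^ 2)) := by
    rw [integral_eq_integral_Ioi_add i2, conjPoisson]
    congr 2
    funext u
    rw [neg_sq, sub_neg_eq_add]
    ring
  rw [cauchyTransform, e1, poisson,
    ← integral_sub_left_eq_self (fun y : ℝ => (φ y : ℂ) / ((x : ℂ) + t * Complex.I - y)) _ x]
  have e2 : ∀ u : ℝ, (φ (x - u) : ℂ) / ((x : ℂ) + t * Complex.I - ((x - u : ℝ) : ℂ)) =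
      ((φ (x - u) * (u / (u ^ 2 + t ^ 2)) : ℝ) : ℂ)
        - Complex.I * ((φ (x - u) * (t / (u ^ 2 + t ^ 2)) : ℝ) : ℂ) := by
    intro u
    have h1 : ((u : ℂ) ^ 2 + (t : ℂ) ^ 2) ≠ 0 := by
      exact_mod_cast (hpos u).ne'
    have h2 : (u : ℂ) + t * Complex.I ≠ 0 := by
      intro h0
      apply h1
      have : (u : ℂ) ^ 2 + (t : ℂ) ^ 2 = (u + t * Complex.I) * (u - t * Complex.I) := by
        ring_nf; simp
      rw [this, h0, zero_mul]
    have h3 : (x : ℂ) + t * Complex.I - ((x - u : ℝ) : ℂ) = u + t * Complex.I := by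
      push_cast; ring
    rw [h3]
    push_cast
    field_simp
    ring_nf
    simp
  simp_rw [e2]
  rw [integral_sub i2.ofReal (i1.ofReal.const_mul _), integral_const_mul, integral_complex_ofReal,
    integral_complex_ofReal]
  push_cast
  have hI := Complex.I_mul_I
  linear_combination (-(Real.pi : ℂ)⁻¹ * ((∫ u, φ (x - u) * (t / (u ^ 2 + t ^ 2)) : ℝ) : ℂ)) * hI

/-- Scaling to a kernel independent of t, of mass π, makes both the maximum bound and the limit at t
= 0 immediate. -/
theorem poisson_eq {t : ℝ} (ht : 0 < t) (x : ℝ) :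
    poisson φ t x = Real.pi⁻¹ * ∫ v, φ (x - t * v) * (1 + v ^ 2)⁻¹ := by
  have := Measure.integral_comp_mul_left (fun u => φ (x - u) * (t / (u ^ 2 + t ^ 2))) t
  rw [abs_of_pos (inv_pos.2 ht), smul_eq_mul] at this
  rw [poisson, eq_comm]
  congr 1
  rw [eq_inv_mul_iff_mul_eq₀ ht.ne'] at this
  rw [← this, ← integral_const_mul]
  congr 1
  funext v
  have : (1 + v ^ 2) ≠ 0 := by positivity
  field_simp
  ring

theorem abs_poisson_le {B : ℝ} (hB : ∀ y, |φ y| ≤ B) {t : ℝ} (ht : 0 < t) (x : ℝ) :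
    |poisson φ t x| ≤ B := by
  have h1 : ‖∫ v, φ (x - t * v) * (1 + v ^ 2)⁻¹‖ ≤ ∫ v : ℝ, B * (1 + v ^ 2)⁻¹ := by
    refine norm_integral_le_of_norm_le (integrable_inv_one_add_sq.const_mul B)
      (Eventually.of_forall fun v => ?_)
    rw [norm_mul, Real.norm_of_nonneg (show 0 ≤ (1 + v ^ 2)⁻¹ by positivity)]
    exact mul_le_mul_of_nonneg_right (hB _) (by positivity)
  rw [integral_const_mul, integral_univ_inv_one_add_sq] at h1
  rw [poisson_eq ht, abs_mul, abs_of_pos (inv_pos.2 Real.pi_pos), inv_mul_le_iff₀ Real.pi_pos,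
    mul_comm]
  exact h1

theorem tendsto_poisson (h : IsLipschitzCompact φ) (x : ℝ) :
    Tendsto (fun t => poisson φ t x) (𝓝[>] 0) (𝓝 (φ x)) := by
  obtain ⟨S, B, L, hS, hB, -, h0, hφB, -⟩ := h.exists_bounds
  have h1 : Tendsto (fun t => Real.pi⁻¹ * ∫ v, φ (x - t * v) * (1 + v ^ 2)⁻¹) (𝓝[>] (0 : ℝ))
      (𝓝 (Real.pi⁻¹ * ∫ v, φ x * (1 + v ^ 2)⁻¹)) := by
    refine Tendsto.const_mul _ (tendsto_integral_filter_of_dominated_convergence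
      (fun v => B * (1 + v ^ 2)⁻¹) ?_ ?_ (integrable_inv_one_add_sq.const_mul B) ?_)
    · refine Eventually.of_forall fun t => Continuous.aestronglyMeasurable ?_
      have := h.continuous
      have h2 : ∀ v : ℝ, 1 + v ^ 2 ≠ 0 := fun v => by positivity
      fun_prop (disch := assumption)
    · refine Eventually.of_forall fun t => Eventually.of_forall fun v => ?_
      rw [norm_mul, Real.norm_of_nonneg (show 0 ≤ (1 + v ^ 2)⁻¹ by positivity)]
      exact mul_le_mul_of_nonneg_right (hφB _) (by positivity)
    · refine Eventually.of_forall fun v => Tendsto.mul_const _ ?_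
      have h3 : Tendsto (fun t : ℝ => φ (x - t * v)) (𝓝 0) (𝓝 (φ (x - 0 * v))) :=
        (h.continuous.comp (by fun_prop : Continuous fun t : ℝ => x - t * v)).tendsto 0
      simpa using h3.mono_left nhdsWithin_le_nhds
  rw [integral_const_mul, integral_univ_inv_one_add_sq, mul_comm (φ x), ← mul_assoc,
    inv_mul_cancel₀ Real.pi_ne_zero, one_mul] at h1
  exact h1.congr' (by filter_upwards [self_mem_nhdsWithin] with t ht using (poisson_eq ht x).symm)

/-- The Lipschitz bound 2Lu on the difference cancels the singularity, since u/(u² + t²) ≤ 1/u, and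
both values vanish for u > S + |x|. The bound does not depend on t, so it dominates the limit t → 0;
t = 0 is allowed. -/
theorem norm_conj_integrand_le {S L : ℝ} (h0 : ∀ y, S < |y| → φ y = 0)
    (hL : ∀ x y, |φ x - φ y| ≤ L * |x - y|) (t x : ℝ) :
    ∀ u ∈ Ioi (0 : ℝ), ‖(φ (x - u) - φ (x + u)) * (u / (u ^ 2 + t ^ 2))‖ ≤
      (Ioc 0 (S + |x|)).indicator (fun _ => 2 * L) u := by
  intro u hu
  have hu : 0 < u := hu
  by_cases hS : u ≤ S + |x|
  · rw [indicator_of_mem (show u ∈ Ioc 0 (S + |x|) from ⟨hu, hS⟩), norm_mul, Real.norm_eq_abs,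
      Real.norm_of_nonneg (show 0 ≤ u / (u ^ 2 + t ^ 2) by positivity)]
    have h1 := hL (x - u) (x + u)
    rw [show x - u - (x + u) = -(2 * u) by ring, abs_neg,
      abs_of_pos (show 0 < 2 * u by positivity)] at h1
    have hL0 : 0 ≤ L := by
      by_contra hL0
      have := (abs_nonneg _).trans h1
      nlinarith
    have h2 : u / (u ^ 2 + t ^ 2) ≤ 1 / u := by
      rw [div_le_div_iff₀ (by positivity) hu]
      nlinarith [sq_nonneg t]
    calc _ ≤ L * (2 * u) * (1 / u) := mul_le_mul h1 h2 (by positivity) (by positivity)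
      _ = _ := by field_simp
  · push Not at hS
    have a1 : φ (x - u) = 0 := h0 _ (by
      have := abs_sub_abs_le_abs_sub u x
      rw [abs_sub_comm, abs_of_pos hu] at this
      linarith)
    have a2 : φ (x + u) = 0 := h0 _ (by
      have := abs_sub_abs_le_abs_sub u (-x)
      rw [abs_neg, sub_neg_eq_add, add_comm u, abs_of_pos hu] at this
      linarith)
    rw [a1, a2, sub_zero, zero_mul, norm_zero, indicator_of_notMem (fun h => absurd h.2 hS.not_ge)]

theorem integrable_indicator_Ioc (a c : ℝ) (s : Set ℝ) :
    IntegrableOn ((Ioc 0 a).indicator (fun _ => c)) s :=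
  ((integrable_indicator_iff measurableSet_Ioc).2
    (integrableOn_const (by simp))).integrableOn

theorem abs_conjPoisson_le {S L : ℝ} (hS : 0 < S) (h0 : ∀ y, S < |y| → φ y = 0)
    (hL : ∀ x y, |φ x - φ y| ≤ L * |x - y|) (t x : ℝ) :
    |conjPoisson φ t x| ≤ 2 * L * (S + |x|) := by
  have h1 : ‖∫ u in Ioi (0 : ℝ), (φ (x - u) - φ (x + u)) * (u / (u ^ 2 + t ^ 2))‖ ≤
      ∫ u in Ioi (0 : ℝ), (Ioc 0 (S + |x|)).indicator (fun _ => 2 * L) u :=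
    norm_integral_le_of_norm_le (integrable_indicator_Ioc _ _ _)
      (ae_restrict_of_forall_mem measurableSet_Ioi (norm_conj_integrand_le h0 hL t x))
  rw [setIntegral_indicator measurableSet_Ioc, inter_eq_right.2 Ioc_subset_Ioi_self,
    setIntegral_const, smul_eq_mul] at h1
  have h2 : volume.real (Ioc 0 (S + |x|)) = S + |x| := by
    rw [Real.volume_real_Ioc_of_le (by positivity), sub_zero]
  rw [h2, mul_comm] at h1
  rw [conjPoisson, abs_mul, abs_of_pos (inv_pos.2 Real.pi_pos)]
  have hπ : Real.pi⁻¹ ≤ 1 := inv_le_one_of_one_le₀ (by linarith [Real.pi_gt_three])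
  calc Real.pi⁻¹ * _ ≤ 1 * (2 * L * (S + |x|)) := mul_le_mul hπ h1 (norm_nonneg _) zero_le_one
    _ = _ := one_mul _

theorem tendsto_conjPoisson (h : IsLipschitzCompact φ) (x : ℝ) :
    Tendsto (fun t => conjPoisson φ t x) (𝓝[>] 0) (𝓝 (hilbertTest φ x)) := by
  obtain ⟨S, B, L, hS, hB, -, h0, -, hL⟩ := h.exists_bounds
  refine Tendsto.const_mul _ (tendsto_integral_filter_of_dominated_convergence
    ((Ioc 0 (S + |x|)).indicator (fun _ => 2 * L)) ?_ ?_ (integrable_indicator_Ioc _ _ _) ?_)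
  · filter_upwards [self_mem_nhdsWithin] with t ht
    have ht : 0 < t := ht
    refine Continuous.aestronglyMeasurable ?_
    have := h.continuous
    have h2 : ∀ u : ℝ, u ^ 2 + t ^ 2 ≠ 0 := fun u => by positivity
    fun_prop (disch := assumption)
  · exact Eventually.of_forall fun t =>
      ae_restrict_of_forall_mem measurableSet_Ioi (norm_conj_integrand_le h0 hL t x)
  · refine ae_restrict_of_forall_mem measurableSet_Ioi fun u hu => ?_
    have hu : 0 < u := hu
    have h3 : Tendsto (fun t : ℝ => (φ (x - u) - φ (x + u)) * (u / (u ^ 2 + t ^ 2))) (𝓝 0)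
        (𝓝 ((φ (x - u) - φ (x + u)) * (u / (u ^ 2 + 0 ^ 2)))) := by
      refine Tendsto.const_mul _ (tendsto_const_nhds.div ?_ (by positivity))
      exact (by fun_prop : Continuous fun t : ℝ => u ^ 2 + t ^ 2).tendsto 0
    have e : (φ (x - u) - φ (x + u)) * (u / (u ^ 2 + 0 ^ 2)) = (φ (x - u) - φ (x + u)) / u := by
      field_simp; ring
    rw [e] at h3
    exact h3.mono_left nhdsWithin_le_nhds

/-- The boundary value `φ + i Hφ` of the Cauchy integral. -/
noncomputable def cauchyBoundary (φ : ℝ → ℝ) (x : ℝ) : ℂ := φ x + hilbertTest φ x * Complex.I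

theorem tendsto_cauchyTransform (h : IsLipschitzCompact φ) (x : ℝ) :
    Tendsto (fun t : ℝ => cauchyTransform φ (x + t * Complex.I)) (𝓝[>] 0)
      (𝓝 (cauchyBoundary φ x)) := by
  have h1 := ((Complex.continuous_ofReal.tendsto _).comp (tendsto_poisson h x)).add
    (((Complex.continuous_ofReal.tendsto _).comp (tendsto_conjPoisson h x)).mul_const Complex.I)
  exact h1.congr' (by
    filter_upwards [self_mem_nhdsWithin] with t ht using (cauchyTransform_eq h ht x).symm)

/-- Uniformity in the height t is the point: this is the dominating function for boundary limits.
Far out it comes from the decay 1/|z|, near the origin from the bounds on the two Poisson integrals.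
-/
theorem norm_cauchyTransform_horizontal_le (h : IsLipschitzCompact φ) :
    ∃ C : ℝ, 0 ≤ C ∧ ∀ x t : ℝ, 0 < t → ‖cauchyTransform φ (x + t * Complex.I)‖ ≤ C / (1 + |x|) := by
  obtain ⟨S, B, L, hS, hB, hL0, h0, hφB, hL⟩ := h.exists_bounds
  obtain ⟨C, R, hR, hC0, hC⟩ := norm_cauchyTransform_le h
  set R' := max R 1
  have hR1 : 1 ≤ R' := le_max_right _ _
  set D := B + 2 * L * (S + R')
  have hD : 0 ≤ D := by positivity
  refine ⟨2 * C + D * (1 + R'), by positivity, fun x t ht => ?_⟩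
  rw [le_div_iff₀ (by positivity)]
  rcases le_or_gt R' |x| with hx | hx
  · have h1 : |x| ≤ ‖(x : ℂ) + t * Complex.I‖ := by
      refine le_trans ?_ (Complex.abs_re_le_norm _); simp
    have hx0 : 0 < |x| := by linarith
    have h2 := (hC _ (((le_max_left R 1).trans hx).trans h1)).trans
      (div_le_div_of_nonneg_left hC0 hx0 h1)
    calc _ ≤ C / |x| * (2 * |x|) := mul_le_mul h2 (by linarith) (by positivity) (by positivity)
      _ = 2 * C := by field_simp
      _ ≤ _ := by nlinarith
  · have h1 : ‖cauchyTransform φ (x + t * Complex.I)‖ ≤ D := by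
      rw [cauchyTransform_eq h ht]
      refine (norm_add_le _ _).trans ?_
      rw [norm_mul, Complex.norm_I, mul_one, Complex.norm_real, Complex.norm_real]
      refine add_le_add (abs_poisson_le hφB ht x) ((abs_conjPoisson_le hS h0 hL t x).trans ?_)
      gcongr
    calc _ ≤ D * (1 + R') := mul_le_mul h1 (by linarith) (by positivity) (by positivity)
      _ ≤ _ := by linarith

theorem norm_cauchyBoundary_le (h : IsLipschitzCompact φ) :
    ∃ C : ℝ, 0 ≤ C ∧ ∀ x : ℝ, ‖cauchyBoundary φ x‖ ≤ C / (1 + |x|) := by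
  obtain ⟨C, hC0, hC⟩ := norm_cauchyTransform_horizontal_le h
  exact ⟨C, hC0, fun x => le_of_tendsto (tendsto_cauchyTransform h x).norm
    (by filter_upwards [self_mem_nhdsWithin] with t ht using hC x t ht)⟩

theorem re_cauchyBoundary (φ : ℝ → ℝ) (x : ℝ) : (cauchyBoundary φ x).re = φ x := by
  simp [cauchyBoundary]

theorem im_cauchyBoundary (φ : ℝ → ℝ) (x : ℝ) : (cauchyBoundary φ x).im = hilbertTest φ x := by
  simp [cauchyBoundary]

theorem continuous_cauchyTransform_horizontal (h : IsLipschitzCompact φ) {t : ℝ} (ht : 0 < t) :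
    Continuous fun x : ℝ => cauchyTransform φ (x + t * Complex.I) :=
  (differentiableOn_cauchyTransform h).continuousOn.comp_continuous (by fun_prop)
    (fun x => by simpa using ht)

theorem aestronglyMeasurable_cauchyBoundary (h : IsLipschitzCompact φ) :
    AEStronglyMeasurable (cauchyBoundary φ) volume := by
  -- The height |t| + 1_{t=0} equals t for t > 0 and is positive for every real t, so that all
  -- members of the family are measurable.
  refine aestronglyMeasurable_of_tendsto_ae (𝓝[>] (0 : ℝ))
    (f := fun (t x : ℝ) => cauchyTransform φ (x + (|t| + if t = 0 then 1 else 0 : ℝ) * Complex.I))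
    (fun t => (continuous_cauchyTransform_horizontal h ?_).aestronglyMeasurable)
    (Eventually.of_forall fun x => ?_)
  · split_ifs with h0
    · simp [h0]
    · simpa using h0
  · refine (tendsto_cauchyTransform h x).congr' ?_
    filter_upwards [self_mem_nhdsWithin] with t ht
    have ht : 0 < t := ht
    simp [ht.ne', abs_of_pos ht]

theorem aestronglyMeasurable_hilbertTest (h : IsLipschitzCompact φ) :
    AEStronglyMeasurable (hilbertTest φ) volume := by
  have := Complex.continuous_im.comp_aestronglyMeasurable (aestronglyMeasurable_cauchyBoundary h)
  exact this.congr (Eventually.of_forall fun x => im_cauchyBoundary φ x)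

theorem abs_hilbertTest_le (h : IsLipschitzCompact φ) :
    ∃ C : ℝ, 0 ≤ C ∧ ∀ x : ℝ, |hilbertTest φ x| ≤ C / (1 + |x|) := by
  obtain ⟨C, h0, hC⟩ := norm_cauchyBoundary_le h
  refine ⟨C, h0, fun x => ?_⟩
  rw [← im_cauchyBoundary]
  exact (Complex.abs_im_le_norm _).trans (hC x)

theorem memLp_inv_one_add_abs {p : ℝ} (hp : 1 < p) (C : ℝ) :
    MemLp (fun x : ℝ => C / (1 + |x|)) (ENNReal.ofReal p) := by
  have hp0 : 0 < p := by linarith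
  have hc : Continuous fun x : ℝ => C / (1 + |x|) :=
    continuous_const.div (by fun_prop) fun x => by positivity
  rw [← integrable_norm_rpow_iff hc.aestronglyMeasurable (by simpa using hp0) (by simp),
    ENNReal.toReal_ofReal hp0.le]
  have h1 := (integrable_one_add_norm (E := ℝ) (μ := volume) (r := p) (by simpa using hp)).const_mul
    (|C| ^ p)
  refine h1.congr (Eventually.of_forall fun x => ?_)
  simp only [Real.norm_eq_abs, abs_div]
  rw [abs_of_pos (show 0 < 1 + |x| by positivity), Real.div_rpow (by positivity) (by positivity),
    Real.rpow_neg (by positivity), div_eq_mul_inv]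

theorem memLp_hilbertTest (h : IsLipschitzCompact φ) {p : ℝ} (hp : 1 < p) :
    MemLp (hilbertTest φ) (ENNReal.ofReal p) := by
  obtain ⟨C, h0, hC⟩ := abs_hilbertTest_le h
  refine (memLp_inv_one_add_abs hp C).mono (aestronglyMeasurable_hilbertTest h)
    (Eventually.of_forall fun x => (hC x).trans (le_abs_self _))

end

/-! ### Boundary values of holomorphic functions and the Hilbert transform. -/

theorem mem_upper_half (x : ℝ) {t : ℝ} (ht : 0 < t) :
    (x + t * Complex.I : ℂ) ∈ {z : ℂ | 0 < z.im} := by simpa using ht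

theorem tendsto_horizontal_aestronglyMeasurable {F : ℂ → ℂ} {Fb : ℝ → ℂ}
    (hF : ContinuousOn F {z | 0 < z.im})
    (hlim : ∀ᵐ x : ℝ, Tendsto (fun t : ℝ => F (x + t * Complex.I)) (𝓝[>] 0) (𝓝 (Fb x))) :
    AEStronglyMeasurable Fb volume := by
  have hu : Tendsto (fun n : ℕ => 1 / ((n : ℝ) + 1)) atTop (𝓝[>] 0) :=
    tendsto_nhdsWithin_iff.2 ⟨tendsto_one_div_add_atTop_nhds_zero_nat,
      Eventually.of_forall fun n => by simp only [mem_Ioi]; positivity⟩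
  refine aestronglyMeasurable_of_tendsto_ae atTop
    (f := fun (n : ℕ) (x : ℝ) => F (x + (1 / ((n : ℝ) + 1) : ℝ) * Complex.I))
    (fun n => Continuous.aestronglyMeasurable ?_) ?_
  · exact hF.comp_continuous (by fun_prop) fun x => mem_upper_half x (by positivity)
  · filter_upwards [hlim] with x hx using hx.comp hu

theorem norm_boundary_le {F : ℂ → ℂ} {Fb : ℝ → ℂ} {D : ℝ → ℝ}
    (hlim : ∀ᵐ x : ℝ, Tendsto (fun t : ℝ => F (x + t * Complex.I)) (𝓝[>] 0) (𝓝 (Fb x)))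
    (hD : ∀ᵐ x : ℝ, ∀ t : ℝ, 0 < t → ‖F (x + t * Complex.I)‖ ≤ D x) :
    ∀ᵐ x, ‖Fb x‖ ≤ D x := by
  filter_upwards [hlim, hD] with x h1 h2
  exact le_of_tendsto h1.norm (by filter_upwards [self_mem_nhdsWithin] with t ht using h2 t ht)

/-- The integral of the boundary values of a holomorphic function on the upper half-plane vanishes,
under domination and decay at infinity. -/
theorem integral_boundary_eq_zero {G : ℂ → ℂ} {Gb : ℝ → ℂ} {D : ℝ → ℝ}
    (hG : DifferentiableOn ℂ G {z | 0 < z.im}) {C R s : ℝ} (hs : 1 < s)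
    (hC : ∀ z : ℂ, 0 < z.im → R ≤ ‖z‖ → ‖G z‖ ≤ C * ‖z‖ ^ (-s))
    (hlim : ∀ᵐ x : ℝ, Tendsto (fun t : ℝ => G (x + t * Complex.I)) (𝓝[>] 0) (𝓝 (Gb x)))
    (hD : ∀ᵐ x : ℝ, ∀ t : ℝ, 0 < t → ‖G (x + t * Complex.I)‖ ≤ D x)
    (hDi : Integrable D) : ∫ x, Gb x = 0 := by
  have h1 : Tendsto (fun t : ℝ => ∫ x : ℝ, G (x + t * Complex.I)) (𝓝[>] 0) (𝓝 (∫ x, Gb x)) := by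
    refine tendsto_integral_filter_of_dominated_convergence D ?_ ?_ hDi hlim
    · filter_upwards [self_mem_nhdsWithin] with t ht
      exact (hG.continuousOn.comp_continuous (by fun_prop)
        fun x => mem_upper_half x ht).aestronglyMeasurable
    · filter_upwards [self_mem_nhdsWithin] with t ht
      filter_upwards [hD] with x hx using hx t ht
  refine tendsto_nhds_unique h1 (tendsto_const_nhds.congr' ?_)
  filter_upwards [self_mem_nhdsWithin] with t ht using (integral_horizontal_eq_zero hG hs hC ht).symm

section

variable {F : ℂ → ℂ} {Fb : ℝ → ℂ} {D : ℝ → ℝ} {C R : ℝ} {ψ : ℝ → ℝ}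

/-- Neither factor need have an integrable boundary value, but the product decays like |z|^{-2} and
is dominated by a multiple of D/(1 + |x|), so its boundary integral vanishes. -/
theorem integral_boundary_mul_cauchyBoundary (hF : DifferentiableOn ℂ F {z | 0 < z.im})
    (hC : ∀ z : ℂ, 0 < z.im → R ≤ ‖z‖ → ‖F z‖ ≤ C / ‖z‖)
    (hlim : ∀ᵐ x : ℝ, Tendsto (fun t : ℝ => F (x + t * Complex.I)) (𝓝[>] 0) (𝓝 (Fb x)))
    (hD : ∀ᵐ x : ℝ, ∀ t : ℝ, 0 < t → ‖F (x + t * Complex.I)‖ ≤ D x)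
    (hDi : Integrable fun x => D x / (1 + |x|)) (hψ : IsLipschitzCompact ψ) :
    ∫ x, Fb x * cauchyBoundary ψ x = 0 := by
  obtain ⟨C', R', hR', hC'0, hC'⟩ := norm_cauchyTransform_le hψ
  obtain ⟨K, hK0, hK⟩ := norm_cauchyTransform_horizontal_le hψ
  refine integral_boundary_eq_zero (G := fun z => F z * cauchyTransform ψ z) (s := 2)
    (C := C * C') (R := max R R') (D := fun x => K * (D x / (1 + |x|)))
    (hF.mul (differentiableOn_cauchyTransform hψ)) one_lt_two ?_ ?_ ?_ (hDi.const_mul K)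
  · intro z hz hzR
    have hz0 : 0 < ‖z‖ := hR'.trans_le ((le_max_right _ _).trans hzR)
    have h1 := hC z hz ((le_max_left _ _).trans hzR)
    rw [norm_mul]
    refine (mul_le_mul h1 (hC' z ((le_max_right _ _).trans hzR)) (norm_nonneg _)
      ((norm_nonneg _).trans h1)).trans_eq ?_
    rw [Real.rpow_neg hz0.le, Real.rpow_two]
    field_simp
  · filter_upwards [hlim] with x hx using hx.mul (tendsto_cauchyTransform hψ x)
  · filter_upwards [hD] with x hx t ht
    rw [norm_mul]
    refine (mul_le_mul (hx t ht) (hK x t ht) (norm_nonneg _)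
      ((norm_nonneg _).trans (hx t ht))).trans_eq ?_
    ring

/-- Boundary values of a function of Hardy type are of the form `u + i Hu`. -/
theorem isHilbertTransform_boundary (hF : DifferentiableOn ℂ F {z | 0 < z.im})
    (hC : ∀ z : ℂ, 0 < z.im → R ≤ ‖z‖ → ‖F z‖ ≤ C / ‖z‖)
    (hlim : ∀ᵐ x : ℝ, Tendsto (fun t : ℝ => F (x + t * Complex.I)) (𝓝[>] 0) (𝓝 (Fb x)))
    (hD : ∀ᵐ x : ℝ, ∀ t : ℝ, 0 < t → ‖F (x + t * Complex.I)‖ ≤ D x)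
    (hDi : Integrable fun x => D x / (1 + |x|)) :
    LocallyIntegrable (fun x => (Fb x).im) volume ∧ ∀ ψ, IsLipschitzCompact ψ →
      ∫ x, (Fb x).im * ψ x = -∫ x, (Fb x).re * hilbertTest ψ x := by
  have hm := tendsto_horizontal_aestronglyMeasurable hF.continuousOn hlim
  have hb := norm_boundary_le hlim hD
  have hmre := Complex.continuous_re.comp_aestronglyMeasurable hm
  have hmim := Complex.continuous_im.comp_aestronglyMeasurable hm
  refine ⟨?_, fun ψ hψ => ?_⟩
  · have h1 : LocallyIntegrable D := by
      have h2 := (locallyIntegrableOn_univ.2 hDi.locallyIntegrable).mul_continuousOn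
        (g := fun x : ℝ => 1 + |x|) (by fun_prop) isOpen_univ.isLocallyClosed
      refine (locallyIntegrableOn_univ.1 h2).congr (Eventually.of_forall fun x => ?_)
      have : 1 + |x| ≠ 0 := by positivity
      field_simp
    exact h1.mono hmim (by
      filter_upwards [hb] with x hx
      exact ((Complex.abs_im_le_norm _).trans hx).trans (le_abs_self _))
  · obtain ⟨K, hK0, hK⟩ := norm_cauchyBoundary_le hψ
    have hmH := aestronglyMeasurable_hilbertTest hψ
    have hmψ : AEStronglyMeasurable ψ volume := hψ.continuous.aestronglyMeasurable
    have hint : ∀ a b : ℝ → ℝ, AEStronglyMeasurable a volume → AEStronglyMeasurable b volume →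
        (∀ x, |a x| ≤ ‖Fb x‖) → (∀ x, |b x| ≤ ‖cauchyBoundary ψ x‖) →
        Integrable (fun x => a x * b x) := by
      intro a b ha hb' h1 h2
      refine (hDi.const_mul K).mono' (ha.mul hb') ?_
      filter_upwards [hb] with x hx
      rw [norm_mul]
      refine (mul_le_mul ((h1 x).trans hx) ((h2 x).trans (hK x)) (abs_nonneg _)
        ((norm_nonneg _).trans hx)).trans_eq ?_
      ring
    have hψ1 : ∀ x, |ψ x| ≤ ‖cauchyBoundary ψ x‖ := fun x => by
      simpa [re_cauchyBoundary] using Complex.abs_re_le_norm (cauchyBoundary ψ x)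
    have hψ2 : ∀ x, |hilbertTest ψ x| ≤ ‖cauchyBoundary ψ x‖ := fun x => by
      simpa [im_cauchyBoundary] using Complex.abs_im_le_norm (cauchyBoundary ψ x)
    have i1 := hint (fun x => (Fb x).re) _ hmre hmH (fun x => Complex.abs_re_le_norm _) hψ2
    have i2 := hint (fun x => (Fb x).im) _ hmim hmψ (fun x => Complex.abs_im_le_norm _) hψ1
    have i3 : Integrable (fun x => Fb x * cauchyBoundary ψ x) := by
      refine (hDi.const_mul K).mono' (hm.mul (aestronglyMeasurable_cauchyBoundary hψ)) ?_
      filter_upwards [hb] with x hx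
      rw [norm_mul]
      refine (mul_le_mul hx (hK x) (norm_nonneg _) ((norm_nonneg _).trans hx)).trans_eq ?_
      ring
    have h0 := integral_boundary_mul_cauchyBoundary hF hC hlim hD hDi hψ
    -- The duality relation is the imaginary part of the vanishing integral: Im(F(ψ + iHψ)) = (Im
    -- F)ψ + (Re F)Hψ.
    have h1 : ∫ x, (Fb x * cauchyBoundary ψ x).im = 0 := by
      have := integral_im i3
      simp only [RCLike.im_to_complex] at this
      rw [this, h0, Complex.zero_im]
    simp only [Complex.mul_im, re_cauchyBoundary, im_cauchyBoundary] at h1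
    rw [integral_add i1 i2] at h1
    linarith

end

theorem integrable_one_add_abs_sq (C : ℝ) : Integrable fun x : ℝ => C / (1 + |x|) / (1 + |x|) := by
  refine ((integrable_one_add_norm (E := ℝ) (μ := volume) (r := 2) (by simp)).const_mul C).congr
    (Eventually.of_forall fun x => ?_)
  simp only [Real.norm_eq_abs]
  rw [Real.rpow_neg (by positivity), Real.rpow_two]
  field_simp

theorem integral_hilbertTest_mul {φ ψ : ℝ → ℝ} (hφ : IsLipschitzCompact φ)
    (hψ : IsLipschitzCompact ψ) : ∫ x, hilbertTest φ x * ψ x = -∫ x, φ x * hilbertTest ψ x := by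
  obtain ⟨C, R, hR, hC0, hC⟩ := norm_cauchyTransform_le hφ
  obtain ⟨K, hK0, hK⟩ := norm_cauchyTransform_horizontal_le hφ
  have := (isHilbertTransform_boundary (differentiableOn_cauchyTransform hφ)
    (fun z _ hz => hC z hz) (Eventually.of_forall (tendsto_cauchyTransform hφ))
    (Eventually.of_forall fun x t ht => hK x t ht) (integrable_one_add_abs_sq K)).2 ψ hψ
  simpa only [re_cauchyBoundary, im_cauchyBoundary] using this

/-! ### M. Riesz's theorem and the Hilbert transform on L^p. -/

/-- Strict positivity puts the Cauchy integral in the open right half-plane, where the principal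
branch of z^p is holomorphic. -/
theorem poisson_pos {φ : ℝ → ℝ} (h : IsLipschitzCompact φ) (h0 : ∀ x, 0 ≤ φ x) (hne : φ ≠ 0)
    {t : ℝ} (ht : 0 < t) (x : ℝ) : 0 < poisson φ t x := by
  obtain ⟨y, hy⟩ := Function.ne_iff.1 hne
  refine mul_pos (inv_pos.2 Real.pi_pos)
    (Continuous.integral_pos_of_hasCompactSupport_nonneg_nonzero (x := x - y) ?_ ?_ ?_ ?_)
  · have := h.continuous
    have h2 : ∀ u : ℝ, u ^ 2 + t ^ 2 ≠ 0 := fun u => by positivity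
    fun_prop (disch := assumption)
  · exact HasCompactSupport.mul_right
      (h.2.comp_isClosedEmbedding (Homeomorph.subLeft x).isClosedEmbedding)
  · intro u
    exact mul_nonneg (h0 _) (by positivity)
  · have : t / ((x - y) ^ 2 + t ^ 2) ≠ 0 := by positivity
    refine mul_ne_zero ?_ this
    rw [sub_sub_cancel]
    exact hy

theorem memLp_of_isLipschitzCompact {φ : ℝ → ℝ} (h : IsLipschitzCompact φ) (p : ENNReal) :
    MemLp φ p :=
  h.continuous.memLp_of_hasCompactSupport h.2

/-- Integrate `norm_rpow_le_re_rpow_sub_re_cpow` at z = φ + iHφ. The p-th power of the Cauchy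
integral decays like |z|^{-p} with p > 1, so the term Re z^p integrates to zero; what remains bounds
the integral of |Hφ|^p by that of φ^p. -/
theorem eLpNorm_hilbertTest_le_of_nonneg {p : ℝ} (h1 : 1 < p) (h2 : p ≤ 2) {φ : ℝ → ℝ}
    (h : IsLipschitzCompact φ) (h0 : ∀ x, 0 ≤ φ x) :
    eLpNorm (hilbertTest φ) (ENNReal.ofReal p) ≤
      ENNReal.ofReal (6 / (p - 1)) * eLpNorm φ (ENNReal.ofReal p) := by
  have hp0 : 0 < p := by linarith
  have hδ : 0 < p - 1 := by linarith
  rcases eq_or_ne φ 0 with rfl | hne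
  · have : hilbertTest 0 = 0 := by funext x; simp [hilbertTest]
    simp [this]
  obtain ⟨C, R, hR, hC0, hC⟩ := norm_cauchyTransform_le h
  obtain ⟨K, hK0, hK⟩ := norm_cauchyTransform_horizontal_le h
  have hre : ∀ z : ℂ, 0 < z.im → 0 < (cauchyTransform φ z).re := by
    intro z hz
    have := cauchyTransform_eq h hz z.re
    rw [Complex.re_add_im] at this
    rw [this]
    simpa using poisson_pos h h0 hne hz z.re
  have hKp : Integrable (fun x : ℝ => (K / (1 + |x|)) ^ p) := by
    have := (memLp_inv_one_add_abs h1 K).integrable_norm_rpow (by simpa using hp0) (by simp)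
    rw [ENNReal.toReal_ofReal hp0.le] at this
    refine this.congr (Eventually.of_forall fun x => ?_)
    simp only [Real.norm_eq_abs]
    rw [abs_of_nonneg (by positivity)]
  have hlim : ∀ x : ℝ, Tendsto (fun t : ℝ => cauchyTransform φ (x + t * Complex.I) ^ (p : ℂ))
      -- On the boundary the real part is only nonnegative; z^p is still continuous there, even at
      -- 0, because p > 0.
      (𝓝[>] 0) (𝓝 (cauchyBoundary φ x ^ (p : ℂ))) := fun x =>
    ((Complex.continuousAt_cpow_const_of_re_pos
      (Or.inl (by rw [re_cauchyBoundary]; exact h0 x)) (by simpa)).tendsto).comp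
      (tendsto_cauchyTransform h x)
  have hdom : ∀ x t : ℝ, 0 < t → ‖cauchyTransform φ (x + t * Complex.I) ^ (p : ℂ)‖ ≤
      (K / (1 + |x|)) ^ p := fun x t ht => by
    rw [Complex.norm_cpow_real]
    exact Real.rpow_le_rpow (norm_nonneg _) (hK x t ht) hp0.le
  have hdiff : DifferentiableOn ℂ (fun z => cauchyTransform φ z ^ (p : ℂ)) {z | 0 < z.im} :=
    (differentiableOn_cauchyTransform h).cpow_const fun z hz => Or.inl (hre z hz)
  have hint0 : ∫ x, cauchyBoundary φ x ^ (p : ℂ) = 0 := by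
    refine integral_boundary_eq_zero (s := p) (C := C ^ p) (R := R) hdiff h1 ?_
      (Eventually.of_forall hlim) (Eventually.of_forall hdom) hKp
    intro z hz hzR
    rw [Complex.norm_cpow_real, Real.rpow_neg (norm_nonneg _), ← div_eq_mul_inv,
      ← Real.div_rpow hC0 (norm_nonneg _)]
    exact Real.rpow_le_rpow (norm_nonneg _) (hC z hzR) hp0.le
  have hi : Integrable (fun x => cauchyBoundary φ x ^ (p : ℂ)) :=
    hKp.mono' (tendsto_horizontal_aestronglyMeasurable hdiff.continuousOn
      (Eventually.of_forall hlim)) (norm_boundary_le (F := fun z => cauchyTransform φ z ^ (p : ℂ))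
      (Eventually.of_forall hlim) (Eventually.of_forall hdom))
  have hire : Integrable (fun x => (cauchyBoundary φ x ^ (p : ℂ)).re) := hi.re
  have hre0 : ∫ x, (cauchyBoundary φ x ^ (p : ℂ)).re = 0 := by
    have := integral_re hi
    simp only [RCLike.re_to_complex] at this
    rw [this, hint0, Complex.zero_re]
  have hφp := memLp_of_isLipschitzCompact h (ENNReal.ofReal p)
  have hHp := memLp_hilbertTest h h1
  have iφ := hφp.integrable_norm_rpow (by simpa using hp0) (by simp)
  have iH := hHp.integrable_norm_rpow (by simpa using hp0) (by simp)
  rw [ENNReal.toReal_ofReal hp0.le] at iφ iH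
  have key : ∫ x, ‖hilbertTest φ x‖ ^ p ≤ (6 / (p - 1)) ^ p * ∫ x, ‖φ x‖ ^ p := by
    have e : ∫ x, (3 / 2 * (4 / (p - 1)) ^ p * ‖φ x‖ ^ p
        - 2 / (p - 1) * (cauchyBoundary φ x ^ (p : ℂ)).re) =
        3 / 2 * (4 / (p - 1)) ^ p * ∫ x, ‖φ x‖ ^ p := by
      rw [integral_sub (iφ.const_mul _) (hire.const_mul _), integral_const_mul,
        integral_const_mul, hre0, mul_zero, sub_zero]
    have h3 : ∫ x, ‖hilbertTest φ x‖ ^ p ≤ ∫ x, (3 / 2 * (4 / (p - 1)) ^ p * ‖φ x‖ ^ p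
        - 2 / (p - 1) * (cauchyBoundary φ x ^ (p : ℂ)).re) := by
      refine integral_mono iH ((iφ.const_mul _).sub (hire.const_mul _)) fun x => ?_
      have := norm_rpow_le_re_rpow_sub_re_cpow h1 h2 (z := cauchyBoundary φ x)
        (by rw [re_cauchyBoundary]; exact h0 x)
      rw [re_cauchyBoundary] at this
      simp only [Real.norm_eq_abs]
      rw [abs_of_nonneg (h0 x)]
      refine le_trans (Real.rpow_le_rpow (abs_nonneg _) ?_ hp0.le) this
      rw [← im_cauchyBoundary]
      exact Complex.abs_im_le_norm _
    rw [e] at h3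
    refine h3.trans (mul_le_mul_of_nonneg_right ?_ (integral_nonneg fun x => by positivity))
    -- The factor 3/2 is absorbed into the p-th power, as 3/2 ≤ (3/2)^p.
    rw [show 6 / (p - 1) = 3 / 2 * (4 / (p - 1)) by ring,
      Real.mul_rpow (by norm_num) (by positivity)]
    refine mul_le_mul_of_nonneg_right ?_ (by positivity)
    simpa using Real.rpow_le_rpow_of_exponent_le (show (1 : ℝ) ≤ 3 / 2 by norm_num) h1.le
  rw [hHp.eLpNorm_eq_integral_rpow_norm (by simpa using hp0) (by simp),
    hφp.eLpNorm_eq_integral_rpow_norm (by simpa using hp0) (by simp),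
    ENNReal.toReal_ofReal hp0.le, ← ENNReal.ofReal_mul (by positivity)]
  refine ENNReal.ofReal_le_ofReal ?_
  have hI : 0 ≤ ∫ x, ‖φ x‖ ^ p := integral_nonneg fun x => by positivity
  refine (Real.rpow_le_rpow (integral_nonneg fun x => by positivity) key (by positivity)).trans_eq ?_
  rw [Real.mul_rpow (by positivity) hI, ← Real.rpow_mul (by positivity),
    mul_inv_cancel₀ hp0.ne', Real.rpow_one]

theorem hilbertTest_sub {φ ψ : ℝ → ℝ} (hφ : IsLipschitzCompact φ) (hψ : IsLipschitzCompact ψ) :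
    hilbertTest (fun x => φ x - ψ x) = fun x => hilbertTest φ x - hilbertTest ψ x := by
  have hi : ∀ {φ : ℝ → ℝ}, IsLipschitzCompact φ → ∀ x,
      IntegrableOn (fun u => (φ (x - u) - φ (x + u)) / u) (Ioi 0) := by
    intro φ h x
    obtain ⟨S, B, L, hS, hB, -, h0, -, hL⟩ := h.exists_bounds
    refine (integrable_indicator_Ioc (S + |x|) (2 * L) (Ioi 0)).mono' ?_
      (ae_restrict_of_forall_mem measurableSet_Ioi fun u hu => ?_)
    · have := h.continuous.measurable
      exact Measurable.aestronglyMeasurable (by fun_prop)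
    · have := norm_conj_integrand_le h0 hL 0 x u hu
      have hu0 : u ≠ 0 := ne_of_gt hu
      have e : (φ (x - u) - φ (x + u)) / u = (φ (x - u) - φ (x + u)) * (u / (u ^ 2 + 0 ^ 2)) := by
        field_simp; ring
      rwa [e]
  funext x
  simp only [hilbertTest]
  rw [← mul_sub, ← integral_sub (hi hφ x) (hi hψ x)]
  congr 2
  funext u
  ring

/-- M. Riesz's theorem on Lipschitz functions with compact support, for `1 < p ≤ 2`. -/
theorem eLpNorm_hilbertTest_le {p : ℝ} (h1 : 1 < p) (h2 : p ≤ 2) {φ : ℝ → ℝ}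
    (h : IsLipschitzCompact φ) :
    eLpNorm (hilbertTest φ) (ENNReal.ofReal p) ≤
      ENNReal.ofReal (12 / (p - 1)) * eLpNorm φ (ENNReal.ofReal p) := by
  have hp : (1 : ENNReal) ≤ ENNReal.ofReal p := by simpa using h1.le
  have a1 := h.posPart
  have a2 := h.neg.posPart
  have e : φ = fun x => max (φ x) 0 - max (-φ x) 0 := by
    funext x
    exact (max_zero_sub_max_neg_zero_eq_self (φ x)).symm
  have b1 := eLpNorm_hilbertTest_le_of_nonneg h1 h2 a1 fun x => le_max_right _ _
  have b2 := eLpNorm_hilbertTest_le_of_nonneg h1 h2 a2 fun x => le_max_right _ _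
  have c1 : eLpNorm (fun x => max (φ x) 0) (ENNReal.ofReal p) ≤ eLpNorm φ (ENNReal.ofReal p) :=
    eLpNorm_mono fun x => by
      rw [Real.norm_eq_abs, abs_of_nonneg (le_max_right _ _)]
      exact max_le (le_abs_self _) (abs_nonneg _)
  have c2 : eLpNorm (fun x => max (-φ x) 0) (ENNReal.ofReal p) ≤ eLpNorm φ (ENNReal.ofReal p) :=
    eLpNorm_mono fun x => by
      rw [Real.norm_eq_abs, abs_of_nonneg (le_max_right _ _)]
      exact max_le (neg_le_abs _) (abs_nonneg _)
  have e2 : hilbertTest φ = hilbertTest (fun x => max (φ x) 0)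
      - hilbertTest (fun x => max (-φ x) 0) := by
    conv_lhs => rw [e]
    exact hilbertTest_sub a1 a2
  rw [e2]
  refine (eLpNorm_sub_le (aestronglyMeasurable_hilbertTest a1)
    (aestronglyMeasurable_hilbertTest a2) hp).trans ?_
  refine (add_le_add (b1.trans (mul_le_mul_right c1 _)) (b2.trans (mul_le_mul_right c2 _))).trans_eq
    ?_
  rw [← add_mul, ← ENNReal.ofReal_add (by have : 0 < p - 1 := by linarith
                                          positivity) (by have : 0 < p - 1 := by linarith
                                                          positivity)]
  congr 2
  ring

theorem IsTest.sub {φ ψ : ℝ → ℝ} (hφ : IsTest φ) (hψ : IsTest ψ) :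
    IsTest (fun x => φ x - ψ x) :=
  ⟨hφ.1.sub hψ.1, hφ.2.sub hψ.2⟩

theorem IsHilbertTransform.congr {u u' v v' : ℝ → ℝ} (h : IsHilbertTransform u v)
    (hu : u =ᵐ[volume] u') (hv : v =ᵐ[volume] v') : IsHilbertTransform u' v' := by
  refine ⟨h.1.congr hv, fun φ hφ => ?_⟩
  rw [integral_congr_ae (g := fun x => v x * φ x) (by filter_upwards [hv] with x hx; rw [hx]),
    integral_congr_ae (f := fun x => u' x * hilbertTest φ x) (g := fun x => u x * hilbertTest φ x)
    (by filter_upwards [hu] with x hx; rw [hx])]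
  exact h.2 φ hφ

theorem IsHilbertTransform.ae_unique {u v v' : ℝ → ℝ} (h : IsHilbertTransform u v)
    (h' : IsHilbertTransform u v') : v =ᵐ[volume] v' := by
  refine ae_eq_of_integral_contDiff_smul_eq h.1 h'.1 fun g hg hg' => ?_
  have e := (h.2 g ⟨hg, hg'⟩).trans (h'.2 g ⟨hg, hg'⟩).symm
  simpa only [smul_eq_mul, mul_comm] using e

section

variable {p q : ℝ}

theorem integrable_mul_of_holderConjugate (hpq : p.HolderConjugate q) {f g : ℝ → ℝ}
    (hf : MemLp f (ENNReal.ofReal p)) (hg : MemLp g (ENNReal.ofReal q)) :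
    Integrable (fun x => f x * g x) := by
  have := hpq.ennrealOfReal
  exact hf.integrable_mul hg

theorem toReal_eLpNorm_eq (hp : 0 < p) {f : ℝ → ℝ} (hf : MemLp f (ENNReal.ofReal p)) :
    (eLpNorm f (ENNReal.ofReal p) volume).toReal = (∫ x, ‖f x‖ ^ p) ^ (1 / p) := by
  have h : 0 ≤ ∫ x, ‖f x‖ ^ p := integral_nonneg fun x => by positivity
  rw [hf.eLpNorm_eq_integral_rpow_norm (by simpa using hp) (by simp),
    ENNReal.toReal_ofReal hp.le, ENNReal.toReal_ofReal (by positivity), one_div]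

theorem abs_integral_mul_le (hpq : p.HolderConjugate q) {f g : ℝ → ℝ}
    (hf : MemLp f (ENNReal.ofReal p)) (hg : MemLp g (ENNReal.ofReal q)) :
    |∫ x, f x * g x| ≤ (eLpNorm f (ENNReal.ofReal p) volume).toReal *
      (eLpNorm g (ENNReal.ofReal q) volume).toReal := by
  rw [toReal_eLpNorm_eq hpq.pos hf, toReal_eLpNorm_eq hpq.symm.pos hg]
  refine le_trans ?_ (integral_mul_norm_le_Lp_mul_Lq hpq hf hg)
  refine (norm_integral_le_integral_norm (fun x => f x * g x)).trans_eq ?_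
  simp only [norm_mul]

theorem tendsto_integral_mul [Fact (1 ≤ ENNReal.ofReal p)]
    [Fact (1 ≤ ENNReal.ofReal q)] (hpq : p.HolderConjugate q) {f : ℕ → ℝ → ℝ} {F : ℝ → ℝ}
    {g : ℕ → ℝ → ℝ} {G : ℝ → ℝ} (hf : ∀ n, MemLp (f n) (ENNReal.ofReal p))
    (hF : MemLp F (ENNReal.ofReal p)) (hg : ∀ n, MemLp (g n) (ENNReal.ofReal q))
    (hG : MemLp G (ENNReal.ofReal q))
    (hfF : Tendsto (fun n => (hf n).toLp) atTop (𝓝 hF.toLp))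
    (hgG : Tendsto (fun n => (hg n).toLp) atTop (𝓝 hG.toLp)) :
    Tendsto (fun n => ∫ x, f n x * g n x) atTop (𝓝 (∫ x, F x * G x)) := by
  have := hpq.ennrealOfReal
  set L := (ContinuousLinearMap.mul ℝ ℝ).lpPairing (volume : Measure ℝ) (ENNReal.ofReal p)
    (ENNReal.ofReal q)
  have hL : ∀ {a b : ℝ → ℝ} (ha : MemLp a (ENNReal.ofReal p)) (hb : MemLp b (ENNReal.ofReal q)),
      L ha.toLp hb.toLp = ∫ x, a x * b x := by
    intro a b ha hb
    rw [ContinuousLinearMap.lpPairing_eq_integral]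
    refine integral_congr_ae ?_
    filter_upwards [ha.coeFn_toLp, hb.coeFn_toLp] with x h1 h2
    rw [h1, h2]
    rfl
  have := (L.continuous₂.tendsto (hF.toLp, hG.toLp)).comp (hfF.prodMk_nhds hgG)
  simpa only [Function.comp_def, Function.uncurry, hL] using this

theorem exists_test_tendsto [Fact (1 ≤ ENNReal.ofReal p)] (hp : 1 ≤ p) {u : ℝ → ℝ} (hu : MemLp u (ENNReal.ofReal p)) :
    ∃ (φ : ℕ → ℝ → ℝ) (hφ : ∀ n, MemLp (φ n) (ENNReal.ofReal p)), (∀ n, IsTest (φ n)) ∧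
      Tendsto (fun n => (hφ n).toLp) atTop (𝓝 hu.toLp) := by
  have h := fun n : ℕ => hu.exist_eLpNorm_sub_le (by simp) (by simpa using hp)
    (Nat.one_div_pos_of_nat (n := n) (α := ℝ))
  choose φ h1 h2 h3 using h
  have ht : ∀ n, IsTest (φ n) := fun n => ⟨h2 n, h1 n⟩
  have hm : ∀ n, MemLp (φ n) (ENNReal.ofReal p) := fun n =>
    memLp_of_isLipschitzCompact (ht n).isLipschitzCompact _
  refine ⟨φ, hm, ht, ?_⟩
  rw [Lp.tendsto_Lp_iff_tendsto_eLpNorm'' (fun n => φ n) hm u hu]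
  refine tendsto_of_tendsto_of_tendsto_of_le_of_le tendsto_const_nhds
    (h := fun n : ℕ => ENNReal.ofReal (1 / (n + 1))) ?_ (fun _ => zero_le) fun n => ?_
  · simpa using ENNReal.tendsto_ofReal tendsto_one_div_add_atTop_nhds_zero_nat
  · simp only
    rw [eLpNorm_sub_comm]
    exact h3 n

/-- Extension of the Hilbert transform from test functions to `L^p`. -/
theorem exists_isHilbertTransform_of_bound (hpq : p.HolderConjugate q) {N : ℝ} (hN0 : 0 ≤ N)
    (hN : ∀ φ, IsTest φ → eLpNorm (hilbertTest φ) (ENNReal.ofReal p) ≤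
      ENNReal.ofReal N * eLpNorm φ (ENNReal.ofReal p)) {u : ℝ → ℝ}
    (hu : MemLp u (ENNReal.ofReal p)) :
    ∃ v, MemLp v (ENNReal.ofReal p) ∧ IsHilbertTransform u v ∧
      eLpNorm v (ENNReal.ofReal p) ≤ ENNReal.ofReal N * eLpNorm u (ENNReal.ofReal p) := by
  have : Fact (1 ≤ ENNReal.ofReal p) := ⟨by simpa using hpq.lt.le⟩
  have : Fact (1 ≤ ENNReal.ofReal q) := ⟨by simpa using hpq.symm.lt.le⟩
  obtain ⟨φ, hφ, ht, hlim⟩ := exists_test_tendsto hpq.lt.le hu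
  have hH : ∀ n, MemLp (hilbertTest (φ n)) (ENNReal.ofReal p) := fun n =>
    memLp_hilbertTest (ht n).isLipschitzCompact hpq.lt
  have hnorm : ∀ {a b : ℝ → ℝ} (ha : MemLp a (ENNReal.ofReal p)) (hb : MemLp b (ENNReal.ofReal p)),
      eLpNorm a (ENNReal.ofReal p) ≤ ENNReal.ofReal N * eLpNorm b (ENNReal.ofReal p) →
      ‖ha.toLp‖ ≤ N * ‖hb.toLp‖ := by
    intro a b ha hb h
    rw [Lp.norm_toLp, Lp.norm_toLp]
    have := ENNReal.toReal_mono (ENNReal.mul_ne_top ENNReal.ofReal_ne_top hb.eLpNorm_ne_top) h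
    rwa [ENNReal.toReal_mul, ENNReal.toReal_ofReal hN0] at this
  have hd : ∀ m n, dist (hH m).toLp (hH n).toLp ≤ N * dist (hφ m).toLp (hφ n).toLp := by
    intro m n
    rw [dist_eq_norm, dist_eq_norm, ← MemLp.toLp_sub, ← MemLp.toLp_sub]
    refine hnorm _ _ ?_
    have h1 := hN _ ((ht m).sub (ht n))
    rwa [hilbertTest_sub (ht m).isLipschitzCompact (ht n).isLipschitzCompact] at h1
  have hc : CauchySeq fun n => (hH n).toLp := by
    rw [cauchySeq_iff_tendsto_dist_atTop_0]
    have h1 := (cauchySeq_iff_tendsto_dist_atTop_0.1 hlim.cauchySeq).const_mul N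
    rw [mul_zero] at h1
    exact squeeze_zero (fun _ => dist_nonneg) (fun n => hd n.1 n.2) h1
  obtain ⟨V, hV⟩ := cauchySeq_tendsto_of_complete hc
  have hVm := Lp.memLp V
  have hV' : Tendsto (fun n => (hH n).toLp) atTop (𝓝 hVm.toLp) := by rwa [Lp.toLp_coeFn]
  refine ⟨V, hVm, ⟨hVm.locallyIntegrable (by simpa using hpq.lt.le), fun ψ hψ => ?_⟩, ?_⟩
  · have hψq := memLp_of_isLipschitzCompact hψ.isLipschitzCompact (ENNReal.ofReal q)
    have hHq := memLp_hilbertTest hψ.isLipschitzCompact hpq.symm.lt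
    have l1 := tendsto_integral_mul hpq hH hVm (fun _ => hψq) hψq hV' tendsto_const_nhds
    have l2 := (tendsto_integral_mul hpq hφ hu (fun _ => hHq) hHq hlim tendsto_const_nhds).neg
    refine tendsto_nhds_unique l1 (l2.congr fun n => ?_)
    exact (integral_hilbertTest_mul (ht n).isLipschitzCompact hψ.isLipschitzCompact).symm
  · have h1 : ‖hVm.toLp‖ ≤ N * ‖hu.toLp‖ :=
      le_of_tendsto_of_tendsto' hV'.norm (hlim.norm.const_mul N) fun n =>
        hnorm (hH n) (hφ n) (hN _ (ht n))
    rw [Lp.norm_toLp, Lp.norm_toLp] at h1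
    rw [← ENNReal.ofReal_toReal hVm.eLpNorm_ne_top, ← ENNReal.ofReal_toReal hu.eLpNorm_ne_top,
      ← ENNReal.ofReal_mul hN0]
    exact ENNReal.ofReal_le_ofReal h1

/-- Duality with q ≤ 2. For h = Hφ and w = h|h|^{p-2}, antisymmetry turns ∫|h|^p = ∫ wh into -∫
(Hw)φ, and the bound on L^q together with Hölder gives I ≤ 12/(q-1) · I^{1/q} ‖φ‖_p for I = ∫|h|^p.
As I is finite by the decay of Hφ, one may divide by I^{1/q}; finally 1/(q-1) = p-1. -/
theorem eLpNorm_hilbertTest_le_of_two_le (hpq : p.HolderConjugate q) (hp : 2 ≤ p) {φ : ℝ → ℝ}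
    (hφ : IsTest φ) : eLpNorm (hilbertTest φ) (ENNReal.ofReal p) ≤
      ENNReal.ofReal (12 * (p - 1)) * eLpNorm φ (ENNReal.ofReal p) := by
  have hp0 := hpq.pos
  have hq0 := hpq.symm.pos
  have hq2 : q ≤ 2 := by
    have h1 := hpq.sub_one_mul_conj
    nlinarith [hpq.symm.pos]
  have hq1 : 0 < q - 1 := by linarith [hpq.symm.lt]
  have hconst : 12 / (q - 1) = 12 * (p - 1) := by
    have : (p - 1) * (q - 1) = 1 := by linarith [hpq.mul_eq_add]
    field_simp
    linarith
  set h := hilbertTest φ with hh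
  have hm : MemLp h (ENNReal.ofReal p) := memLp_hilbertTest hφ.isLipschitzCompact hpq.lt
  set w : ℝ → ℝ := fun x => h x * |h x| ^ (p - 2) with hw
  have hwabs : ∀ x, |w x| ^ q = ‖h x‖ ^ p := by
    intro x
    rw [hw, abs_mul, abs_of_nonneg (show 0 ≤ |h x| ^ (p - 2) by positivity), Real.norm_eq_abs]
    rcases (abs_nonneg (h x)).eq_or_lt with h0 | h0
    · rw [← h0, zero_mul, Real.zero_rpow hq0.ne', Real.zero_rpow hp0.ne']
    · rw [← Real.rpow_one_add' h0.le (by linarith), ← Real.rpow_mul h0.le]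
      congr 1
      have := hpq.sub_one_mul_conj
      linarith
  have hwm : AEStronglyMeasurable w volume :=
    hm.1.mul ((hm.1.norm.aemeasurable.pow_const (p - 2)).aestronglyMeasurable)
  have hwq : MemLp w (ENNReal.ofReal q) := by
    rw [← integrable_norm_rpow_iff hwm (by simpa using hq0) (by simp),
      ENNReal.toReal_ofReal hq0.le]
    have := hm.integrable_norm_rpow (by simpa using hp0) (by simp)
    rw [ENNReal.toReal_ofReal hp0.le] at this
    exact this.congr (Eventually.of_forall fun x => (hwabs x).symm)
  obtain ⟨v, hv, hwv, hvN⟩ := exists_isHilbertTransform_of_bound hpq.symm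
    (N := 12 / (q - 1)) (by positivity)
    (fun φ hφ => eLpNorm_hilbertTest_le hpq.symm.lt hq2 hφ.isLipschitzCompact) hwq
  have hφp := memLp_of_isLipschitzCompact hφ.isLipschitzCompact (ENNReal.ofReal p)
  have e1 : ∫ x, w x * h x = ∫ x, ‖h x‖ ^ p := by
    congr 1
    funext x
    simp only [hw, Real.norm_eq_abs]
    rcases (abs_nonneg (h x)).eq_or_lt with h0 | h0
    · rw [← h0, abs_eq_zero.1 h0.symm, Real.zero_rpow hp0.ne']
      simp
    · rw [show p = 2 + (p - 2) by ring, Real.rpow_add h0, Real.rpow_two, sq_abs]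
      ring_nf
  have e2 : ∫ x, ‖h x‖ ^ p ≤ (eLpNorm v (ENNReal.ofReal q) volume).toReal *
      (eLpNorm φ (ENNReal.ofReal p) volume).toReal := by
    refine le_trans ?_ (abs_integral_mul_le hpq.symm hv hφp)
    rw [hwv.2 φ hφ, abs_neg, e1]
    exact le_abs_self _
  have e3 := ENNReal.toReal_mono
    (ENNReal.mul_ne_top ENNReal.ofReal_ne_top hwq.eLpNorm_ne_top) hvN
  rw [ENNReal.toReal_mul, ENNReal.toReal_ofReal (by positivity)] at e3
  have hI : 0 ≤ ∫ x, ‖h x‖ ^ p := integral_nonneg fun x => by positivity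
  set I := ∫ x, ‖h x‖ ^ p with hIdef
  have e4 : (eLpNorm w (ENNReal.ofReal q) volume).toReal = I ^ (1 / q) := by
    rw [toReal_eLpNorm_eq hq0 hwq]
    congr 2
    funext x
    exact hwabs x
  have e5 : (eLpNorm h (ENNReal.ofReal p) volume).toReal = I ^ (1 / p) :=
    toReal_eLpNorm_eq hp0 hm
  rw [← ENNReal.ofReal_toReal hm.eLpNorm_ne_top, ← ENNReal.ofReal_toReal hφp.eLpNorm_ne_top,
    ← ENNReal.ofReal_mul (by linarith), e5]
  refine ENNReal.ofReal_le_ofReal ?_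
  rw [e4, hconst] at e3
  have hφ0 : 0 ≤ (eLpNorm φ (ENNReal.ofReal p) volume).toReal := ENNReal.toReal_nonneg
  rcases hI.eq_or_lt with h0 | h0
  · rw [← h0, Real.zero_rpow (by positivity)]
    exact mul_nonneg (by linarith) hφ0
  · have e6 := e2.trans (mul_le_mul_of_nonneg_right e3 hφ0)
    have e7 : I = I ^ (1 / q) * I ^ (1 / p) := by
      rw [← Real.rpow_add h0, one_div, one_div, add_comm, hpq.inv_add_inv_eq_one, Real.rpow_one]
    have h1 : 0 < I ^ (1 / q) := by positivity
    refine le_of_mul_le_mul_left ?_ h1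
    calc _ = I := e7.symm
      _ ≤ _ := e6
      _ = _ := by ring

/-- M. Riesz's theorem, with the sharp order of growth of the constant at both ends. -/
theorem exists_isHilbertTransform (hp : 1 < p) {u : ℝ → ℝ} (hu : MemLp u (ENNReal.ofReal p)) :
    ∃ v, MemLp v (ENNReal.ofReal p) ∧ IsHilbertTransform u v ∧
      eLpNorm v (ENNReal.ofReal p) ≤
        ENNReal.ofReal (12 * max p (p / (p - 1))) * eLpNorm u (ENNReal.ofReal p) := by
  have hpq := Real.HolderConjugate.conjExponent hp
  have hδ : 0 < p - 1 := by linarith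
  refine exists_isHilbertTransform_of_bound hpq
    (mul_nonneg (by norm_num) (le_max_of_le_left hpq.nonneg)) (fun φ hφ => ?_) hu
  rcases le_total p 2 with h2 | h2
  · refine (eLpNorm_hilbertTest_le hp h2 hφ.isLipschitzCompact).trans ?_
    gcongr
    refine le_trans ?_ (mul_le_mul_of_nonneg_left (le_max_right _ _) (by norm_num))
    rw [← mul_div_assoc]
    gcongr
    linarith
  · refine (eLpNorm_hilbertTest_le_of_two_le hpq h2 hφ).trans ?_
    gcongr
    refine le_trans ?_ (le_max_left _ _)
    linarith

theorem IsHilbertTransform.add (hpq : p.HolderConjugate q) {u u' v v' : ℝ → ℝ}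
    (hu : MemLp u (ENNReal.ofReal p)) (hu' : MemLp u' (ENNReal.ofReal p))
    (hv : MemLp v (ENNReal.ofReal p)) (hv' : MemLp v' (ENNReal.ofReal p))
    (h : IsHilbertTransform u v) (h' : IsHilbertTransform u' v') :
    IsHilbertTransform (fun x => u x + u' x) (fun x => v x + v' x) := by
  refine ⟨h.1.add h'.1, fun φ hφ => ?_⟩
  have hφq := memLp_of_isLipschitzCompact hφ.isLipschitzCompact (ENNReal.ofReal q)
  have hHq := memLp_hilbertTest hφ.isLipschitzCompact hpq.symm.lt
  simp only [add_mul]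
  rw [integral_add (integrable_mul_of_holderConjugate hpq hv hφq)
    (integrable_mul_of_holderConjugate hpq hv' hφq),
    integral_add (integrable_mul_of_holderConjugate hpq hu hHq)
    (integrable_mul_of_holderConjugate hpq hu' hHq), h.2 φ hφ, h'.2 φ hφ, neg_add]

theorem IsHilbertTransform.const_mul {u v : ℝ → ℝ} (c : ℝ) (h : IsHilbertTransform u v) :
    IsHilbertTransform (fun x => c * u x) (fun x => c * v x) := by
  refine ⟨h.1.smul c, fun φ hφ => ?_⟩
  simp only [mul_assoc]
  rw [integral_const_mul, integral_const_mul, h.2 φ hφ, mul_neg]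

/-- Antisymmetry of the Hilbert transform on `L^p × L^q`. -/
theorem IsHilbertTransform.integral_mul (hpq : p.HolderConjugate q) {u v w z : ℝ → ℝ}
    (hu : MemLp u (ENNReal.ofReal p)) (hv : MemLp v (ENNReal.ofReal p))
    (hw : MemLp w (ENNReal.ofReal q)) (h : IsHilbertTransform u v)
    (h' : IsHilbertTransform w z) : ∫ x, v x * w x = -∫ x, u x * z x := by
  have : Fact (1 ≤ ENNReal.ofReal p) := ⟨by simpa using hpq.lt.le⟩
  have : Fact (1 ≤ ENNReal.ofReal q) := ⟨by simpa using hpq.symm.lt.le⟩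
  set N := 12 * max q (q / (q - 1)) with hN
  have hN0 : 0 ≤ N := mul_nonneg (by norm_num) (le_max_of_le_left hpq.symm.nonneg)
  obtain ⟨z', hz', hwz', -⟩ := exists_isHilbertTransform hpq.symm.lt hw
  have hzz := h'.ae_unique hwz'
  obtain ⟨φ, hφ, ht, hlim⟩ := exists_test_tendsto hpq.symm.lt.le hw
  have hH : ∀ n, MemLp (hilbertTest (φ n)) (ENNReal.ofReal q) := fun n =>
    memLp_hilbertTest (ht n).isLipschitzCompact hpq.symm.lt
  have hHt : ∀ n, IsHilbertTransform (φ n) (hilbertTest (φ n)) := fun n =>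
    ⟨(hH n).locallyIntegrable (by simpa using hpq.symm.lt.le), fun ψ hψ =>
      integral_hilbertTest_mul (ht n).isLipschitzCompact hψ.isLipschitzCompact⟩
  have hHlim : Tendsto (fun n => (hH n).toLp) atTop (𝓝 hz'.toLp) := by
    rw [tendsto_iff_dist_tendsto_zero] at hlim ⊢
    have h1 := hlim.const_mul N
    rw [mul_zero] at h1
    refine squeeze_zero (fun _ => dist_nonneg) (fun n => ?_) h1
    rw [dist_eq_norm, dist_eq_norm, ← MemLp.toLp_sub, ← MemLp.toLp_sub, Lp.norm_toLp, Lp.norm_toLp]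
    -- By uniqueness Hφₙ - z' is the bounded Hilbert transform of φₙ - w, so it is controlled by ‖φₙ
    -- - w‖.
    obtain ⟨y, hy, hyt, hyN⟩ := exists_isHilbertTransform hpq.symm.lt ((hφ n).sub hw)
    have h2 := (hHt n).add hpq.symm (hφ n) (hw.const_mul (-1)) (hH n) (hz'.const_mul (-1))
      (hwz'.const_mul (-1))
    have h3 := (h2.congr (u' := φ n - w) (v' := hilbertTest (φ n) - z')
      (Eventually.of_forall fun x => by simp; ring)
      (Eventually.of_forall fun x => by simp; ring)).ae_unique hyt
    rw [eLpNorm_congr_ae h3]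
    have := ENNReal.toReal_mono
      (ENNReal.mul_ne_top ENNReal.ofReal_ne_top ((hφ n).sub hw).eLpNorm_ne_top) hyN
    rwa [ENNReal.toReal_mul, ENNReal.toReal_ofReal hN0] at this
  have l1 := tendsto_integral_mul hpq (fun _ => hv) hv hφ hw tendsto_const_nhds hlim
  have l2 := (tendsto_integral_mul hpq (fun _ => hu) hu hH hz' tendsto_const_nhds hHlim).neg
  have e : ∫ x, u x * z x = ∫ x, u x * z' x :=
    integral_congr_ae (by filter_upwards [hzz] with x hx; rw [hx])
  rw [e]
  exact tendsto_nhds_unique l1 (l2.congr fun n => (h.2 _ (ht n)).symm)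

end

/-! ### The flow generated by f ↦ H(χf). -/

section Flow

variable {E : Type*} [NormedAddCommGroup E] [NormedSpace ℝ E] [CompleteSpace E]

theorem hasDerivAt_exp_smul_apply (A : E →L[ℝ] E) (x : E) (t : ℝ) :
    HasDerivAt (fun s : ℝ => NormedSpace.exp (s • A) x) (A (NormedSpace.exp (t • A) x)) t :=
  (ContinuousLinearMap.apply ℝ E x).hasFDerivAt.comp_hasDerivAt t (hasDerivAt_exp_smul_const' A t)

theorem eq_exp_smul_apply (A : E →L[ℝ] E) {u : ℝ → E}
    (hu : ∀ t : ℝ, 0 ≤ t → HasDerivWithinAt u (A (u t)) (Ici 0) t) {t : ℝ} (ht : 0 ≤ t) :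
    u t = NormedSpace.exp (t • A) (u 0) := by
  refine ODE_solution_unique (v := fun _ => A) (K := ‖A‖₊) (fun _ => A.lipschitz)
    (fun s hs => ((hu s hs.1).continuousWithinAt).mono Icc_subset_Ici_self)
    (fun s hs => (hu s hs.1).mono (Ici_subset_Ici.2 hs.1))
    (fun s _ => (hasDerivAt_exp_smul_apply A (u 0) s).continuousAt.continuousWithinAt)
    (fun s _ => (hasDerivAt_exp_smul_apply A (u 0) s).hasDerivWithinAt) ?_ (right_mem_Icc.2 ht)
  simp

theorem norm_exp_smul_apply_le (A : E →L[ℝ] E) (x : E) {t : ℝ} (ht : 0 ≤ t) :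
    ‖NormedSpace.exp (t • A) x‖ ≤ Real.exp (‖A‖ * t) * ‖x‖ := by
  have := norm_le_gronwallBound_of_norm_deriv_right_le (δ := ‖x‖) (K := ‖A‖) (ε := 0) (b := t)
    (fun s (_ : s ∈ Icc 0 t) => (hasDerivAt_exp_smul_apply A x s).continuousAt.continuousWithinAt)
    (fun s _ => (hasDerivAt_exp_smul_apply A x s).hasDerivWithinAt) (by simp)
    (fun s _ => by simpa using A.le_opNorm _) t (right_mem_Icc.2 ht)
  rwa [gronwallBound_ε0, sub_zero, mul_comm] at this

end Flow

theorem memLp_chi_mul {P : ENNReal} {f : ℝ → ℝ} (hf : MemLp f P) : MemLp (fun x => chi x * f x) P := by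
  refine (hf.indicator (measurableSet_Icc (a := (0 : ℝ)) (b := 1))).ae_eq
    (Eventually.of_forall fun x => ?_)
  by_cases h : x ∈ Icc (0 : ℝ) 1 <;> simp [chi, h]

theorem eLpNorm_chi_mul_le (P : ENNReal) (f : ℝ → ℝ) :
    eLpNorm (fun x => chi x * f x) P ≤ eLpNorm f P := by
  refine eLpNorm_mono fun x => ?_
  by_cases h : x ∈ Icc (0 : ℝ) 1 <;> simp [chi, h]

/-- `A` is the operator `f ↦ H(χ f)` on `L^p`. -/
def IsGenerator {P : ENNReal} (A : Lp ℝ P (volume : Measure ℝ) → Lp ℝ P (volume : Measure ℝ)) :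
    Prop := ∀ f, IsHilbertTransform (fun x => chi x * f x) (A f)

section

variable {p q : ℝ}

/-- Hilbert transforms are chosen one function at a time; `IsHilbertTransform.ae_unique` makes the
choice linear. Multiplication by χ does not increase the norm. -/
theorem exists_isGenerator [Fact (1 ≤ ENNReal.ofReal p)] (hp : 1 < p) :
    ∃ A : Lp ℝ (ENNReal.ofReal p) (volume : Measure ℝ) →L[ℝ]
      Lp ℝ (ENNReal.ofReal p) (volume : Measure ℝ),
      ‖A‖ ≤ 12 * max p (p / (p - 1)) ∧ IsGenerator A := by
  have hpq := Real.HolderConjugate.conjExponent hp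
  have hN0 : 0 ≤ 12 * max p (p / (p - 1)) :=
    mul_nonneg (by norm_num) (le_max_of_le_left hpq.nonneg)
  have h := fun f : Lp ℝ (ENNReal.ofReal p) (volume : Measure ℝ) =>
    exists_isHilbertTransform hp (memLp_chi_mul (Lp.memLp f))
  choose v hv ht hN using h
  have hχ := fun f : Lp ℝ (ENNReal.ofReal p) (volume : Measure ℝ) => memLp_chi_mul (Lp.memLp f)
  let A : Lp ℝ (ENNReal.ofReal p) (volume : Measure ℝ) →ₗ[ℝ]
      Lp ℝ (ENNReal.ofReal p) (volume : Measure ℝ) :=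
    { toFun := fun f => (hv f).toLp
      map_add' := fun f g => by
        rw [← MemLp.toLp_add, MemLp.toLp_eq_toLp_iff]
        refine (ht (f + g)).ae_unique (((ht f).add hpq (hχ f) (hχ g) (hv f) (hv g) (ht g)).congr
          ?_ (Eventually.of_forall fun x => rfl))
        filter_upwards [Lp.coeFn_add f g] with x hx
        rw [hx, Pi.add_apply, mul_add]
      map_smul' := fun c f => by
        rw [RingHom.id_apply, ← MemLp.toLp_const_smul, MemLp.toLp_eq_toLp_iff]
        refine (ht (c • f)).ae_unique (((ht f).const_mul c).congr
          ?_ (Eventually.of_forall fun x => rfl))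
        filter_upwards [Lp.coeFn_smul c f] with x hx
        rw [hx, Pi.smul_apply, smul_eq_mul]
        ring }
  have hA : ∀ f, ‖A f‖ ≤ 12 * max p (p / (p - 1)) * ‖f‖ := fun f => by
    change ‖(hv f).toLp‖ ≤ _
    rw [Lp.norm_toLp, Lp.norm_def]
    have := ENNReal.toReal_mono (ENNReal.mul_ne_top ENNReal.ofReal_ne_top (Lp.eLpNorm_ne_top f))
      ((hN f).trans (mul_le_mul_right (eLpNorm_chi_mul_le _ f) _))
    rwa [ENNReal.toReal_mul, ENNReal.toReal_ofReal hN0] at this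
  refine ⟨A.mkContinuous _ hA, A.mkContinuous_norm_le hN0 hA, fun f => ?_⟩
  exact (ht f).congr (Eventually.of_forall fun x => rfl) (hv f).coeFn_toLp.symm

theorem IsGenerator.toLp_eq [Fact (1 ≤ ENNReal.ofReal p)]
    {A : Lp ℝ (ENNReal.ofReal p) (volume : Measure ℝ) →L[ℝ]
      Lp ℝ (ENNReal.ofReal p) (volume : Measure ℝ)} (hA : IsGenerator A) {f g : ℝ → ℝ}
    (hf : MemLp f (ENNReal.ofReal p)) (hfg : IsHilbertTransform (fun x => chi x * f x) g) :
    g =ᵐ[volume] A hf.toLp :=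
  (hfg.congr (by filter_upwards [hf.coeFn_toLp] with x hx; rw [hx])
    (ae_eq_refl g)).ae_unique (hA _)

theorem IsSolution.ae_eq_exp [Fact (1 ≤ ENNReal.ofReal p)] {f₀ : ℝ → ℝ} {f : ℝ → ℝ → ℝ}
    (h : IsSolution p f₀ f)
    {A : Lp ℝ (ENNReal.ofReal p) (volume : Measure ℝ) →L[ℝ]
      Lp ℝ (ENNReal.ofReal p) (volume : Measure ℝ)} (hA : IsGenerator A)
    (hf₀ : MemLp f₀ (ENNReal.ofReal p)) {t : ℝ} (ht : 0 ≤ t) :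
    f t =ᵐ[volume] NormedSpace.exp (t • A) hf₀.toLp := by
  obtain ⟨h0, hf, g, hg⟩ := h
  -- The value 0 at negative times is arbitrary: only derivatives within [0,∞) are used.
  let u : ℝ → Lp ℝ (ENNReal.ofReal p) (volume : Measure ℝ) :=
    fun t => if ht : 0 ≤ t then (hf t ht).toLp else 0
  have hu : ∀ t (ht : 0 ≤ t), u t = (hf t ht).toLp := fun t ht => dif_pos ht
  have hcoe : ∀ t, 0 ≤ t → u t =ᵐ[volume] f t := fun t ht => by
    rw [hu t ht]
    exact (hf t ht).coeFn_toLp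
  have hd : ∀ t : ℝ, 0 ≤ t → HasDerivWithinAt u (A (u t)) (Ici 0) t := by
    intro t ht
    obtain ⟨-, g1, g2⟩ := hg t ht
    have hgA := hA.toLp_eq (hf t ht) g1
    rw [hasDerivWithinAt_iff_tendsto_slope, Lp.tendsto_Lp_iff_tendsto_eLpNorm']
    refine g2.congr' ?_
    filter_upwards [self_mem_nhdsWithin] with s hs
    refine eLpNorm_congr_ae ?_
    rw [slope_def_module]
    filter_upwards [hcoe s hs.1, hcoe t ht, hgA, Lp.coeFn_smul (s - t)⁻¹ (u s - u t),
      Lp.coeFn_sub (u s) (u t)] with x h1 h2 h3 h4 h5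
    rw [Pi.sub_apply, h4, Pi.smul_apply, h5, Pi.sub_apply, h1, h2, h3, ← hu t ht, smul_eq_mul]
    ring
  have h1 := eq_exp_smul_apply A hd ht
  have h2 : u 0 = hf₀.toLp := by
    rw [hu 0 le_rfl, MemLp.toLp_eq_toLp_iff]
    exact h0
  rw [← h2, ← h1]
  exact (hcoe t ht).symm

theorem exists_isSolution (hp : 1 < p) {f₀ : ℝ → ℝ} (hf₀ : MemLp f₀ (ENNReal.ofReal p)) :
    ∃ f, IsSolution p f₀ f := by
  have : Fact (1 ≤ ENNReal.ofReal p) := ⟨by simpa using hp.le⟩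
  obtain ⟨A, -, hA⟩ := exists_isGenerator hp
  let u : ℝ → Lp ℝ (ENNReal.ofReal p) (volume : Measure ℝ) :=
    fun t => NormedSpace.exp (t • A) hf₀.toLp
  refine ⟨fun t => u t, ?_, fun t _ => Lp.memLp _, fun t => A (u t),
    fun t ht => ⟨Lp.memLp _, hA _, ?_⟩⟩
  · simpa [u] using hf₀.coeFn_toLp
  · have hd := (hasDerivAt_exp_smul_apply A hf₀.toLp t).hasDerivWithinAt (s := Ici 0)
    rw [hasDerivWithinAt_iff_tendsto_slope, Lp.tendsto_Lp_iff_tendsto_eLpNorm'] at hd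
    refine hd.congr fun s => eLpNorm_congr_ae ?_
    rw [slope_def_module]
    filter_upwards [Lp.coeFn_smul (s - t)⁻¹ (u s - u t), Lp.coeFn_sub (u s) (u t)] with x h4 h5
    change (_ - _ : ℝ) = _
    rw [h4, Pi.smul_apply, h5, Pi.sub_apply, smul_eq_mul]
    ring

theorem IsSolution.memLp_datum {f₀ : ℝ → ℝ} {f : ℝ → ℝ → ℝ} (h : IsSolution p f₀ f) :
    MemLp f₀ (ENNReal.ofReal p) :=
  (h.2.1 0 le_rfl).ae_eq h.1

theorem IsSolution.eLpNorm_le (hp : 1 < p) {f₀ : ℝ → ℝ} {f : ℝ → ℝ → ℝ}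
    (h : IsSolution p f₀ f) {t : ℝ} (ht : 0 ≤ t) :
    eLpNorm (f t) (ENNReal.ofReal p) ≤
      ENNReal.ofReal (Real.exp (12 * max p (p / (p - 1)) * t)) *
        eLpNorm f₀ (ENNReal.ofReal p) := by
  have : Fact (1 ≤ ENNReal.ofReal p) := ⟨by simpa using hp.le⟩
  obtain ⟨A, hN, hA⟩ := exists_isGenerator hp
  have hf₀ := h.memLp_datum
  rw [eLpNorm_congr_ae (h.ae_eq_exp hA hf₀ ht), ← Lp.enorm_def,
    ← eLpNorm_congr_ae hf₀.coeFn_toLp, ← Lp.enorm_def, ← ofReal_norm, ← ofReal_norm,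
    ← ENNReal.ofReal_mul (Real.exp_pos _).le]
  refine ENNReal.ofReal_le_ofReal ((norm_exp_smul_apply_le A _ ht).trans ?_)
  gcongr

/-- `IsHilbertTransform` does not mention an exponent, so by uniqueness the powers of the two
generators agree a.e., and so do the partial sums of the exponential series. Convergence in L^p and
in L^q both imply convergence in measure, whose limit is unique. -/
theorem ae_eq_of_isGenerator [Fact (1 ≤ ENNReal.ofReal p)] [Fact (1 ≤ ENNReal.ofReal q)]
    {A : Lp ℝ (ENNReal.ofReal p) (volume : Measure ℝ) →L[ℝ]
      Lp ℝ (ENNReal.ofReal p) (volume : Measure ℝ)} (hA : IsGenerator A)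
    {B : Lp ℝ (ENNReal.ofReal q) (volume : Measure ℝ) →L[ℝ]
      Lp ℝ (ENNReal.ofReal q) (volume : Measure ℝ)} (hB : IsGenerator B)
    {F : Lp ℝ (ENNReal.ofReal p) (volume : Measure ℝ)}
    {G : Lp ℝ (ENNReal.ofReal q) (volume : Measure ℝ)} (hFG : F =ᵐ[volume] G) (t : ℝ) :
    NormedSpace.exp (t • A) F =ᵐ[volume] NormedSpace.exp (t • B) G := by
  have hpow : ∀ n : ℕ, ((t • A) ^ n) F =ᵐ[volume] ((t • B) ^ n) G := by
    intro n
    induction n with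
    | zero => simpa using hFG
    | succ n ih =>
      rw [pow_succ', pow_succ', mul_apply_eq_comp, mul_apply_eq_comp,
        smul_apply, smul_apply]
      have h1 := ((hA (((t • A) ^ n) F)).congr
        (by filter_upwards [ih] with x hx; rw [hx]) (ae_eq_refl _)).ae_unique (hB (((t • B) ^ n) G))
      filter_upwards [h1, Lp.coeFn_smul t (A (((t • A) ^ n) F)),
        Lp.coeFn_smul t (B (((t • B) ^ n) G))] with x e1 e2 e3
      rw [e2, e3, Pi.smul_apply, Pi.smul_apply, e1]
  have hsum : ∀ n : ℕ, (∑ k ∈ Finset.range n, ((k.factorial : ℝ)⁻¹ • (t • A) ^ k) F : Lp ℝ _ _)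
      =ᵐ[volume] (∑ k ∈ Finset.range n, ((k.factorial : ℝ)⁻¹ • (t • B) ^ k) G : Lp ℝ _ _) := by
    intro n
    induction n with
    | zero =>
      simp only [Finset.range_zero, Finset.sum_empty]
      exact (Lp.coeFn_zero _ _ _).trans (Lp.coeFn_zero _ _ _).symm
    | succ n ih =>
      rw [Finset.sum_range_succ, Finset.sum_range_succ]
      refine (Lp.coeFn_add _ _).trans (EventuallyEq.trans ?_ (Lp.coeFn_add _ _).symm)
      refine ih.add ?_
      refine (Lp.coeFn_smul _ _).trans (EventuallyEq.trans ?_ (Lp.coeFn_smul _ _).symm)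
      exact (hpow n).const_smul _
  have lA := (((NormedSpace.exp_series_hasSum_exp' (𝕂 := ℝ) (t • A)).mapL
    (ContinuousLinearMap.apply ℝ _ F)).tendsto_sum_nat)
  have lB := (((NormedSpace.exp_series_hasSum_exp' (𝕂 := ℝ) (t • B)).mapL
    (ContinuousLinearMap.apply ℝ _ G)).tendsto_sum_nat)
  simp only [ContinuousLinearMap.apply_apply] at lA lB
  have mA := tendstoInMeasure_of_tendsto_Lp lA
  have mB := tendstoInMeasure_of_tendsto_Lp lB
  exact tendstoInMeasure_ae_unique (mA.congr_left hsum) mB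

/-- The solution does not depend on the exponent. -/
theorem IsSolution.ae_eq (hp : 1 < p) (hq : 1 < q) {f₀ : ℝ → ℝ} {f g : ℝ → ℝ → ℝ}
    (hf : IsSolution p f₀ f) (hg : IsSolution q f₀ g) {t : ℝ} (ht : 0 ≤ t) :
    f t =ᵐ[volume] g t := by
  have : Fact (1 ≤ ENNReal.ofReal p) := ⟨by simpa using hp.le⟩
  have : Fact (1 ≤ ENNReal.ofReal q) := ⟨by simpa using hq.le⟩
  obtain ⟨A, -, hA⟩ := exists_isGenerator hp
  obtain ⟨B, -, hB⟩ := exists_isGenerator hq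
  refine (hf.ae_eq_exp hA hf.memLp_datum ht).trans (EventuallyEq.trans ?_
    (hg.ae_eq_exp hB hg.memLp_datum ht).symm)
  exact ae_eq_of_isGenerator hA hB
    (hf.memLp_datum.coeFn_toLp.trans hg.memLp_datum.coeFn_toLp.symm) t

end

/-! ### Eigenfunctions of the finite Hilbert transform. -/

/-- The function `x^{-δ} (1 - x)^{δ - 1}` on `(0,1)`, an eigenfunction of the finite Hilbert
transform. -/
noncomputable def endpointKernel (δ : ℝ) : ℝ → ℝ :=
  (Ioo (0 : ℝ) 1).indicator fun x => x ^ (-δ) * (1 - x) ^ (-(1 - δ))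

/-- The holomorphic function on the upper half-plane whose boundary values have real part
proportional to `endpointKernel δ`. -/
noncomputable def endpointHolomorphic (δ : ℝ) (z : ℂ) : ℂ :=
  (-Complex.I * z) ^ ((-δ : ℝ) : ℂ) * (-Complex.I * (z - 1)) ^ ((-(1 - δ) : ℝ) : ℂ)

section

variable {δ : ℝ}

theorem differentiableOn_endpointHolomorphic :
    DifferentiableOn ℂ (endpointHolomorphic δ) {z | 0 < z.im} := by
  refine DifferentiableOn.mul (DifferentiableOn.cpow_const (by fun_prop) fun z hz => Or.inl ?_)
    (DifferentiableOn.cpow_const (by fun_prop) fun z hz => Or.inl ?_)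
  · simpa using hz
  · simpa using hz

theorem norm_endpointHolomorphic (z : ℂ) :
    ‖endpointHolomorphic δ z‖ = ‖z‖ ^ (-δ) * ‖z - 1‖ ^ (-(1 - δ)) := by
  rw [endpointHolomorphic, norm_mul, Complex.norm_cpow_real, Complex.norm_cpow_real, norm_mul,
    norm_mul, norm_neg, Complex.norm_I, one_mul, one_mul]

/-- The exponents add up to -1, so the decay is exactly the 1/|z| required of F in
`isHilbertTransform_boundary`. -/
theorem norm_endpointHolomorphic_le (h0 : 0 < δ) (h1 : δ < 1) {z : ℂ} (hz : 2 ≤ ‖z‖) :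
    ‖endpointHolomorphic δ z‖ ≤ 2 / ‖z‖ := by
  have hz0 : 0 < ‖z‖ := by linarith
  have h2 : ‖z‖ / 2 ≤ ‖z - 1‖ := by
    have := norm_sub_norm_le z 1
    rw [norm_one] at this
    linarith
  rw [norm_endpointHolomorphic]
  have h3 : ‖z - 1‖ ^ (-(1 - δ)) ≤ (‖z‖ / 2) ^ (-(1 - δ)) :=
    Real.rpow_le_rpow_of_nonpos (by positivity) h2 (by linarith)
  have h4 : (‖z‖ / 2) ^ (-(1 - δ)) ≤ ‖z‖ ^ (-(1 - δ)) * 2 := by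
    rw [Real.div_rpow hz0.le (by norm_num), Real.rpow_neg (by norm_num : (0 : ℝ) ≤ 2), div_inv_eq_mul]
    gcongr
    simpa using Real.rpow_le_rpow_of_exponent_le (show (1 : ℝ) ≤ 2 by norm_num)
      (show 1 - δ ≤ 1 by linarith)
  refine (mul_le_mul_of_nonneg_left (h3.trans h4) (by positivity)).trans_eq ?_
  rw [← mul_assoc, ← Real.rpow_add hz0, show -δ + -(1 - δ) = -1 by ring, Real.rpow_neg_one]
  ring

theorem norm_endpointHolomorphic_horizontal_le (h0 : 0 < δ) (h1 : δ < 1) {x : ℝ} (hx0 : x ≠ 0)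
    (hx1 : x ≠ 1) (t : ℝ) :
    ‖endpointHolomorphic δ (x + t * Complex.I)‖ ≤ |x| ^ (-δ) * |x - 1| ^ (-(1 - δ)) := by
  rw [norm_endpointHolomorphic]
  have a1 : |x| ≤ ‖(x : ℂ) + t * Complex.I‖ := by
    refine le_trans ?_ (Complex.abs_re_le_norm _); simp
  have a2 : |x - 1| ≤ ‖(x : ℂ) + t * Complex.I - 1‖ := by
    refine le_trans ?_ (Complex.abs_re_le_norm _); simp
  exact mul_le_mul
    (Real.rpow_le_rpow_of_nonpos (abs_pos.2 hx0) a1 (by linarith))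
    (Real.rpow_le_rpow_of_nonpos (abs_pos.2 (sub_ne_zero.2 hx1)) a2 (by linarith))
    (by positivity) (by positivity)

theorem tendsto_endpointHolomorphic {x : ℝ} (hx0 : x ≠ 0) (hx1 : x ≠ 1) :
    Tendsto (fun t : ℝ => endpointHolomorphic δ (x + t * Complex.I)) (𝓝[>] 0)
      (𝓝 (endpointHolomorphic δ x)) := by
  have hc : ContinuousAt (endpointHolomorphic δ) x := by
    refine ContinuousAt.mul (ContinuousAt.cpow (by fun_prop) continuousAt_const (Or.inr ?_))
      (ContinuousAt.cpow (by fun_prop) continuousAt_const (Or.inr ?_))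
    · simpa using hx0
    · simpa using sub_ne_zero.2 hx1.symm
  have h1 : Tendsto (fun t : ℝ => (x : ℂ) + t * Complex.I) (𝓝 0) (𝓝 (x : ℂ)) := by
    have : Continuous fun t : ℝ => (x : ℂ) + t * Complex.I := by fun_prop
    simpa using this.tendsto 0
  exact hc.tendsto.comp (h1.mono_left nhdsWithin_le_nhds)

theorem neg_I_mul_ofReal_cpow_of_pos {x : ℝ} (hx : 0 < x) (s : ℝ) :
    (-Complex.I * x) ^ (s : ℂ) = ↑(x ^ s) *
      (Real.cos (-(Real.pi / 2 * s)) + Real.sin (-(Real.pi / 2 * s)) * Complex.I) := by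
  rw [Complex.cpow_ofReal, mul_comm (-Complex.I), Complex.arg_real_mul _ hx, Complex.arg_neg_I,
    norm_mul, norm_neg, Complex.norm_I, mul_one, Complex.norm_real, Real.norm_of_nonneg hx.le,
    neg_mul]

theorem neg_I_mul_ofReal_cpow_of_neg {x : ℝ} (hx : x < 0) (s : ℝ) :
    (-Complex.I * x) ^ (s : ℂ) = ↑((-x) ^ s) *
      (Real.cos (Real.pi / 2 * s) + Real.sin (Real.pi / 2 * s) * Complex.I) := by
  have : -Complex.I * x = ((-x : ℝ) : ℂ) * Complex.I := by push_cast; ring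
  rw [this, Complex.cpow_ofReal, Complex.arg_real_mul _ (neg_pos.2 hx), Complex.arg_I,
    norm_mul, Complex.norm_I, mul_one, Complex.norm_real, Real.norm_of_nonneg (neg_pos.2 hx).le]

theorem polar_mul_polar (r s a b : ℝ) :
    ((r : ℂ) * (Real.cos a + Real.sin a * Complex.I)) *
      ((s : ℂ) * (Real.cos b + Real.sin b * Complex.I)) =
    ((r * s * Real.cos (a + b) : ℝ) : ℂ) + ((r * s * Real.sin (a + b) : ℝ) : ℂ) * Complex.I := by
  rw [Real.cos_add, Real.sin_add]
  push_cast
  linear_combination (r * s * Complex.sin a * Complex.sin b : ℂ) * Complex.I_mul_I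

/-- For 0 < x < 1 the arguments of -ix and -i(x-1) are -π/2 and π/2, so the total phase is πδ - π/2:
constant on the interval. Hence imaginary and real parts have the fixed ratio -cot(πδ). -/
theorem endpointHolomorphic_ofReal_of_mem {x : ℝ} (hx : x ∈ Ioo (0 : ℝ) 1) :
    endpointHolomorphic δ x = ((Real.sin (Real.pi * δ) * endpointKernel δ x : ℝ) : ℂ)
      + ((-Real.cos (Real.pi * δ) * endpointKernel δ x : ℝ) : ℂ) * Complex.I := by
  rw [endpointHolomorphic, ← Complex.ofReal_one, ← Complex.ofReal_sub,
    neg_I_mul_ofReal_cpow_of_pos hx.1, neg_I_mul_ofReal_cpow_of_neg (by linarith [hx.2]),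
    polar_mul_polar, endpointKernel, indicator_of_mem hx, neg_sub,
    show -(Real.pi / 2 * -δ) + Real.pi / 2 * -(1 - δ) = Real.pi * δ - Real.pi / 2 by ring,
    Real.cos_sub_pi_div_two, Real.sin_sub_pi_div_two]
  push_cast
  ring

/-- Outside [0,1] both arguments have the same sign and the phase is ±π/2, so the boundary value is
purely imaginary; this is why the real part is supported in the interval. -/
theorem re_endpointHolomorphic_ofReal {x : ℝ} (hx0 : x ≠ 0) (hx1 : x ≠ 1) :
    (endpointHolomorphic δ x).re = Real.sin (Real.pi * δ) * endpointKernel δ x := by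
  by_cases hx : x ∈ Ioo (0 : ℝ) 1
  · rw [endpointHolomorphic_ofReal_of_mem hx]
    simp only [Complex.add_re, Complex.ofReal_re, Complex.mul_re, Complex.ofReal_im, Complex.I_re,
      Complex.I_im]
    ring
  · rw [endpointKernel, indicator_of_notMem hx, mul_zero, endpointHolomorphic,
      ← Complex.ofReal_one, ← Complex.ofReal_sub]
    rcases lt_or_gt_of_ne hx0 with h | h
    · rw [neg_I_mul_ofReal_cpow_of_neg h, neg_I_mul_ofReal_cpow_of_neg (by linarith),
        polar_mul_polar,
        show Real.pi / 2 * -δ + Real.pi / 2 * -(1 - δ) = -(Real.pi / 2) by ring]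
      simp
    · have h2 : 1 < x := lt_of_le_of_ne (by by_contra h3; exact hx ⟨h, not_le.1 h3⟩) hx1.symm
      rw [neg_I_mul_ofReal_cpow_of_pos h, neg_I_mul_ofReal_cpow_of_pos (by linarith),
        polar_mul_polar,
        show -(Real.pi / 2 * -δ) + -(Real.pi / 2 * -(1 - δ)) = Real.pi / 2 by ring]
      simp

theorem integrable_abs_rpow_div (h0 : 0 < δ) (h1 : δ < 1) :
    Integrable fun x : ℝ => |x| ^ (-δ) / (1 + |x|) := by
  have a1 : IntervalIntegrable (fun x : ℝ => |x| ^ (-δ)) volume 0 1 := by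
    refine (intervalIntegral.intervalIntegrable_rpow' (r := -δ) (by linarith)).congr ?_
    intro x hx
    rw [uIoc_of_le zero_le_one] at hx
    simp only
    rw [abs_of_pos hx.1]
  have a2 : IntervalIntegrable (fun x : ℝ => |x| ^ (-δ)) volume (-1) 0 := by
    have := (IntervalIntegrable.iff_comp_neg (by finiteness)).1 a1
    simp only [abs_neg, neg_zero] at this
    exact this.symm
  have a3 : IntegrableOn (fun x : ℝ => |x| ^ (-δ)) (Ioc (-1) 1) :=
    (intervalIntegrable_iff_integrableOn_Ioc_of_le (by norm_num)).1 (a2.trans a1)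
  have a4 := (integrable_indicator_iff measurableSet_Ioc).2 a3
  have a5 := (integrable_one_add_norm (E := ℝ) (μ := volume) (r := 1 + δ) (by simpa)).const_mul 2
  refine (a4.add a5).mono' (Measurable.aestronglyMeasurable (by fun_prop))
    (Eventually.of_forall fun x => ?_)
  rw [Real.norm_of_nonneg (by positivity), Pi.add_apply]
  have hp : 0 ≤ 2 * (1 + ‖x‖) ^ (-(1 + δ)) := by positivity
  by_cases hx : x ∈ Ioc (-1 : ℝ) 1
  · rw [indicator_of_mem hx]
    have : |x| ^ (-δ) / (1 + |x|) ≤ |x| ^ (-δ) :=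
      div_le_self (by positivity) (by linarith [abs_nonneg x])
    linarith
  · rw [indicator_of_notMem hx, zero_add]
    have hx1 : 1 ≤ |x| := by
      by_contra h
      exact hx ⟨(abs_lt.1 (not_le.1 h)).1, (abs_lt.1 (not_le.1 h)).2.le⟩
    have b1 : |x| ^ (-δ) ≤ ((1 + |x|) / 2) ^ (-δ) :=
      Real.rpow_le_rpow_of_nonpos (by linarith) (by linarith) (by linarith)
    have b2 : ((1 + |x|) / 2) ^ (-δ) ≤ (1 + |x|) ^ (-δ) * 2 := by
      rw [Real.div_rpow (by positivity) (by norm_num), Real.rpow_neg (by norm_num : (0 : ℝ) ≤ 2),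
        div_inv_eq_mul]
      gcongr
      simpa using Real.rpow_le_rpow_of_exponent_le (show (1 : ℝ) ≤ 2 by norm_num) h1.le
    rw [div_le_iff₀ (by positivity), Real.norm_eq_abs, mul_assoc,
      ← Real.rpow_add_one (by positivity), show -(1 + δ) + 1 = -δ by ring]
    linarith

/-- At least one of a, b is at least 1/2, and its power is then at most (1/2)^{-2} = 4. This
separates the two endpoint singularities. -/
theorem rpow_mul_rpow_le {a b r s : ℝ} (hr : 0 ≤ r) (hs : 0 ≤ s) (hr2 : r ≤ 2) (hs2 : s ≤ 2)
    (ha : 0 ≤ a) (hb : 0 ≤ b) (hab : 1 ≤ a + b) :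
    a ^ (-r) * b ^ (-s) ≤ 4 * (a ^ (-r) + b ^ (-s)) := by
  have key : ∀ {c e : ℝ}, 0 ≤ e → e ≤ 2 → 1 / 2 ≤ c → c ^ (-e) ≤ 4 := by
    intro c e he he2 hc
    refine (Real.rpow_le_rpow_of_nonpos (by norm_num) hc (by linarith)).trans ?_
    rw [one_div, Real.inv_rpow (by norm_num), Real.rpow_neg (by norm_num), inv_inv]
    refine (Real.rpow_le_rpow_of_exponent_le (by norm_num) he2).trans ?_
    norm_num
  have ha' : 0 ≤ a ^ (-r) := by positivity
  have hb' : 0 ≤ b ^ (-s) := by positivity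
  rcases le_total (1 / 2) a with h | h
  · nlinarith [key hr hr2 h]
  · nlinarith [key hs hs2 (show 1 / 2 ≤ b by linarith)]

theorem integrable_endpoint_dominant (h0 : 0 < δ) (h1 : δ < 1) :
    Integrable fun x : ℝ => |x| ^ (-δ) * |x - 1| ^ (-(1 - δ)) / (1 + |x|) := by
  have i1 := integrable_abs_rpow_div h0 h1
  have i2 := (integrable_abs_rpow_div (show 0 < 1 - δ by linarith) (by linarith)).comp_sub_right 1
  refine ((i1.const_mul 4).add (i2.const_mul 8)).mono'
    (Measurable.aestronglyMeasurable (by fun_prop)) (Eventually.of_forall fun x => ?_)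
  rw [Real.norm_of_nonneg (by positivity), Pi.add_apply]
  have k1 : 1 ≤ |x| + |x - 1| := by
    have := abs_sub x (x - 1)
    rwa [sub_sub_cancel, abs_one] at this
  have k2 := rpow_mul_rpow_le h0.le (show 0 ≤ 1 - δ by linarith) (by linarith) (by linarith)
    (abs_nonneg x) (abs_nonneg (x - 1)) k1
  have k3 : |x - 1| ^ (-(1 - δ)) / (1 + |x|) ≤ 2 * (|x - 1| ^ (-(1 - δ)) / (1 + |x - 1|)) := by
    rw [← mul_div_assoc, div_le_div_iff₀ (by positivity) (by positivity)]
    have : |x - 1| ≤ |x| + 1 := by simpa using abs_sub x 1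
    have hb' : 0 ≤ |x - 1| ^ (-(1 - δ)) := by positivity
    nlinarith [abs_nonneg x]
  have k4 := div_le_div_of_nonneg_right k2 (show 0 ≤ 1 + |x| by positivity)
  refine k4.trans ?_
  rw [mul_add, add_div, mul_div_assoc, mul_div_assoc]
  linarith

/-- The Hilbert transform of `endpointKernel δ` is `-cot(πδ)` times itself on `(0,1)`. -/
theorem exists_isHilbertTransform_endpointKernel (h0 : 0 < δ) (h1 : δ < 1) :
    ∃ z : ℝ → ℝ, IsHilbertTransform (endpointKernel δ) z ∧
      ∀ x ∈ Ioo (0 : ℝ) 1,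
        z x = -(Real.cos (Real.pi * δ) / Real.sin (Real.pi * δ)) * endpointKernel δ x := by
  have hs : 0 < Real.sin (Real.pi * δ) :=
    Real.sin_pos_of_pos_of_lt_pi (by positivity) (by nlinarith [Real.pi_pos])
  have hne : ∀ᵐ x : ℝ, x ≠ 0 ∧ x ≠ 1 :=
    (Measure.ae_ne volume 0).and (Measure.ae_ne volume 1)
  have key := isHilbertTransform_boundary (differentiableOn_endpointHolomorphic (δ := δ))
    (Fb := fun x => endpointHolomorphic δ x) (D := fun x => |x| ^ (-δ) * |x - 1| ^ (-(1 - δ)))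
    (C := 2) (R := 2) (fun z _ hz => norm_endpointHolomorphic_le h0 h1 hz)
    (by filter_upwards [hne] with x hx using tendsto_endpointHolomorphic hx.1 hx.2)
    (by filter_upwards [hne] with x hx t _
        using norm_endpointHolomorphic_horizontal_le h0 h1 hx.1 hx.2 t)
    (integrable_endpoint_dominant h0 h1)
  have k2 : IsHilbertTransform (fun x => Real.sin (Real.pi * δ) * endpointKernel δ x)
      (fun x : ℝ => (endpointHolomorphic δ x).im) := by
    refine IsHilbertTransform.congr (u := fun x : ℝ => (endpointHolomorphic δ x).re)
      ⟨key.1, fun φ hφ => key.2 φ hφ.isLipschitzCompact⟩ ?_ (ae_eq_refl _)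
    filter_upwards [hne] with x hx using re_endpointHolomorphic_ofReal hx.1 hx.2
  refine ⟨_, (k2.const_mul (Real.sin (Real.pi * δ))⁻¹).congr
    (Eventually.of_forall fun x => ?_) (ae_eq_refl _), fun x hx => ?_⟩
  · simp only
    rw [inv_mul_cancel_left₀ hs.ne']
  · rw [endpointHolomorphic_ofReal_of_mem hx]
    simp only [Complex.add_im, Complex.ofReal_re, Complex.mul_im, Complex.ofReal_im, Complex.I_re,
      Complex.I_im]
    ring

theorem endpointKernel_nonneg (x : ℝ) : 0 ≤ endpointKernel δ x := by
  refine indicator_nonneg (fun y hy => ?_) x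
  have := hy.1
  have : 0 < 1 - y := by linarith [hy.2]
  positivity

theorem measurable_endpointKernel : Measurable (endpointKernel δ) :=
  Measurable.indicator (by fun_prop) measurableSet_Ioo

theorem integrableOn_rpow_Ioo {r : ℝ} (hr : r < 1) :
    IntegrableOn (fun x : ℝ => x ^ (-r)) (Ioo 0 1) ∧
      ∫ x in Ioo (0 : ℝ) 1, x ^ (-r) = 1 / (1 - r) := by
  refine ⟨(intervalIntegral.integrableOn_Ioo_rpow_iff zero_lt_one).2 (by linarith), ?_⟩
  rw [← integral_Ioc_eq_integral_Ioo, ← intervalIntegral.integral_of_le zero_le_one,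
    integral_rpow (Or.inl (by linarith)), Real.one_rpow,
    Real.zero_rpow (by linarith : -r + 1 ≠ 0), sub_zero]
  congr 1
  ring

theorem integrableOn_one_sub_rpow_Ioo {r : ℝ} (hr : r < 1) :
    IntegrableOn (fun x : ℝ => (1 - x) ^ (-r)) (Ioo 0 1) ∧
      ∫ x in Ioo (0 : ℝ) 1, (1 - x) ^ (-r) = 1 / (1 - r) := by
  have h := intervalIntegral.intervalIntegrable_rpow' (a := 0) (b := 1) (r := -r) (by linarith)
  have h2 := (h.comp_sub_left 1).symm
  simp only [sub_zero, sub_self] at h2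
  refine ⟨((intervalIntegrable_iff_integrableOn_Ioo_of_le zero_le_one).1 h2), ?_⟩
  rw [← (integrableOn_rpow_Ioo hr).2, ← integral_Ioc_eq_integral_Ioo,
    ← integral_Ioc_eq_integral_Ioo, ← intervalIntegral.integral_of_le zero_le_one,
    ← intervalIntegral.integral_of_le zero_le_one,
    intervalIntegral.integral_comp_sub_left (fun x : ℝ => x ^ (-r)) 1]
  simp

/-- The beta integral is split between its endpoints. The bound is explicit because its growth in p
matters when δ = l/p. -/
theorem memLp_endpointKernel (h0 : 0 < δ) (h1 : δ < 1) {q : ℝ} (hq : 0 < q) (hδq : δ * q < 1)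
    (hδq' : (1 - δ) * q < 1) : MemLp (endpointKernel δ) (ENNReal.ofReal q) ∧
      ∫ x, ‖endpointKernel δ x‖ ^ q ≤ 4 * (1 / (1 - δ * q) + 1 / (1 - (1 - δ) * q)) := by
  have e : ∀ x, ‖endpointKernel δ x‖ ^ q = (Ioo (0 : ℝ) 1).indicator
      (fun x => x ^ (-(δ * q)) * (1 - x) ^ (-((1 - δ) * q))) x := by
    intro x
    rw [Real.norm_of_nonneg (endpointKernel_nonneg x), endpointKernel]
    by_cases hx : x ∈ Ioo (0 : ℝ) 1
    · have hx1 : 0 ≤ 1 - x := by linarith [hx.2]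
      have hx0 := hx.1.le
      rw [indicator_of_mem hx, indicator_of_mem hx, Real.mul_rpow (by positivity) (by positivity),
        ← Real.rpow_mul hx0, ← Real.rpow_mul hx1, neg_mul, neg_mul]
    · rw [indicator_of_notMem hx, indicator_of_notMem hx, Real.zero_rpow hq.ne']
  have hδq0 : 0 ≤ (1 - δ) * q := mul_nonneg (by linarith) hq.le
  obtain ⟨i1, v1⟩ := integrableOn_rpow_Ioo hδq
  obtain ⟨i2, v2⟩ := integrableOn_one_sub_rpow_Ioo hδq'
  have hle : ∀ x ∈ Ioo (0 : ℝ) 1, x ^ (-(δ * q)) * (1 - x) ^ (-((1 - δ) * q)) ≤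
      4 * (x ^ (-(δ * q)) + (1 - x) ^ (-((1 - δ) * q))) := fun x hx =>
    rpow_mul_rpow_le (by positivity) hδq0 (by linarith) (by linarith) hx.1.le
      (by linarith [hx.2]) (by linarith)
  have i3 : IntegrableOn (fun x : ℝ => 4 * (x ^ (-(δ * q)) + (1 - x) ^ (-((1 - δ) * q))))
      (Ioo 0 1) := (i1.add i2).const_mul 4
  have i4 : IntegrableOn (fun x : ℝ => x ^ (-(δ * q)) * (1 - x) ^ (-((1 - δ) * q))) (Ioo 0 1) := by
    refine i3.mono' (Measurable.aestronglyMeasurable (by fun_prop))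
      (ae_restrict_of_forall_mem measurableSet_Ioo fun x hx => ?_)
    have hx1 : 0 ≤ 1 - x := by linarith [hx.2]
    have hx0 := hx.1.le
    rw [Real.norm_of_nonneg (by positivity)]
    exact hle x hx
  constructor
  · rw [← integrable_norm_rpow_iff measurable_endpointKernel.aestronglyMeasurable
      (by simpa using hq) (by simp), ENNReal.toReal_ofReal hq.le]
    simp_rw [e]
    exact (integrable_indicator_iff measurableSet_Ioo).2 i4
  · simp_rw [e]
    rw [integral_indicator measurableSet_Ioo]
    refine (setIntegral_mono_on i4 i3 measurableSet_Ioo hle).trans_eq ?_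
    rw [integral_const_mul, integral_add i1 i2, v1, v2]

theorem integrable_endpointKernel (h0 : 0 < δ) (h1 : δ < 1) : Integrable (endpointKernel δ) := by
  have := (memLp_endpointKernel h0 h1 one_pos (by linarith) (by linarith)).1
  rwa [ENNReal.ofReal_one, memLp_one_iff_integrable] at this

/-- Drop the factor x^{-δ} ≥ 1 and integrate the singularity at 1. -/
theorem le_integral_endpointKernel (h0 : 0 < δ) (h1 : δ < 1) :
    1 / δ ≤ ∫ x, endpointKernel δ x := by
  obtain ⟨i, v⟩ := integrableOn_one_sub_rpow_Ioo (show 1 - δ < 1 by linarith)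
  rw [sub_sub_cancel] at v
  rw [← v, endpointKernel, integral_indicator measurableSet_Ioo]
  refine setIntegral_mono_on i ?_ measurableSet_Ioo fun x hx => ?_
  · exact (integrable_indicator_iff measurableSet_Ioo).1 (integrable_endpointKernel h0 h1)
  · have hx1 : 0 ≤ 1 - x := by linarith [hx.2]
    exact le_mul_of_one_le_left (by positivity)
      (Real.one_le_rpow_of_pos_of_le_one_of_nonpos hx.1 hx.2.le (by linarith))

/-- Pairing a solution with the eigenfunction. -/
theorem IsSolution.integral_mul_endpointKernel {p : ℝ} (hp : 1 < p) (h0 : 1 / p < δ)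
    (h1 : δ < 1 - 1 / p) {f₀ : ℝ → ℝ} {f : ℝ → ℝ → ℝ} (hf : IsSolution p f₀ f) {t : ℝ}
    (ht : 0 ≤ t) : ∫ x, f t x * endpointKernel δ x =
      Real.exp (Real.cos (Real.pi * δ) / Real.sin (Real.pi * δ) * t) *
        ∫ x, f₀ x * endpointKernel δ x := by
  obtain ⟨q, hpq⟩ : ∃ q, p.HolderConjugate q := ⟨_, Real.HolderConjugate.conjExponent hp⟩
  have hp0 := hpq.pos
  have hq0 := hpq.symm.pos
  have hδ0 : 0 < δ := lt_trans (by positivity) h0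
  have hδ1 : δ < 1 := h1.trans (by linarith [show 0 < 1 / p by positivity])
  have hinv : 1 - 1 / p = 1 / q := by
    have := hpq.inv_add_inv_eq_one
    rw [one_div, one_div]; linarith
  -- For the conjugate exponent q, the conditions 1/p < δ < 1 - 1/p say exactly that (1-δ)q < 1 and
  -- δq < 1.
  have hk := (memLp_endpointKernel hδ0 hδ1 hq0
    (by rw [hinv, lt_div_iff₀ hq0] at h1; exact h1)
    (by rw [← lt_div_iff₀ hq0, ← hinv]; linarith)).1
  have : Fact (1 ≤ ENNReal.ofReal p) := ⟨by simpa using hpq.lt.le⟩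
  have : Fact (1 ≤ ENNReal.ofReal q) := ⟨by simpa using hpq.symm.lt.le⟩
  have := hpq.ennrealOfReal
  obtain ⟨A, -, hA⟩ := exists_isGenerator hp
  obtain ⟨z, hz, hzk⟩ := exists_isHilbertTransform_endpointKernel hδ0 hδ1
  set κ := Real.cos (Real.pi * δ) / Real.sin (Real.pi * δ) with hκ
  have hf₀ := hf.memLp_datum
  let ℓ : Lp ℝ (ENNReal.ofReal p) (volume : Measure ℝ) →L[ℝ] ℝ :=
    ((ContinuousLinearMap.mul ℝ ℝ).lpPairing (volume : Measure ℝ) (ENNReal.ofReal p)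
      (ENNReal.ofReal q)).flip hk.toLp
  have hℓ : ∀ F, ℓ F = ∫ x, F x * endpointKernel δ x := by
    intro F
    change ((ContinuousLinearMap.mul ℝ ℝ).lpPairing (volume : Measure ℝ) (ENNReal.ofReal p)
      (ENNReal.ofReal q)) F hk.toLp = _
    rw [ContinuousLinearMap.lpPairing_eq_integral]
    refine integral_congr_ae ?_
    filter_upwards [hk.coeFn_toLp] with x hx
    rw [hx]
    rfl
  -- Antisymmetry moves H onto the kernel, and χ restricts Hk to the interval, where it equals -κk:
  -- the kernel is an eigenvector of the adjoint of A.
  have hℓA : ∀ F, ℓ (A F) = κ * ℓ F := by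
    intro F
    rw [hℓ, hℓ, (hA F).integral_mul hpq (memLp_chi_mul (Lp.memLp F)) (Lp.memLp _) hk hz,
      ← integral_const_mul, ← integral_neg]
    refine integral_congr_ae ?_
    filter_upwards [Measure.ae_ne volume (0 : ℝ), Measure.ae_ne volume (1 : ℝ)] with x hx0 hx1
    by_cases hx : x ∈ Icc (0 : ℝ) 1
    · rw [hzk x ⟨lt_of_le_of_ne hx.1 hx0.symm, lt_of_le_of_ne hx.2 hx1⟩, chi, indicator_of_mem hx]
      ring
    · rw [chi, indicator_of_notMem hx, endpointKernel,
        indicator_of_notMem fun h => hx (Ioo_subset_Icc_self h)]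
      ring
  -- The pairing divided by its expected growth; its derivative vanishes, so it is constant.
  let m : ℝ → ℝ := fun s => Real.exp (-(κ * s)) * ℓ (NormedSpace.exp (s • A) hf₀.toLp)
  have hm : ∀ s, HasDerivAt m 0 s := by
    intro s
    have d1 : HasDerivAt (fun s : ℝ => Real.exp (-(κ * s))) (Real.exp (-(κ * s)) * -κ) s := by
      simpa using (((hasDerivAt_id s).const_mul κ).neg).exp
    have d2 := ℓ.hasFDerivAt.comp_hasDerivAt s (hasDerivAt_exp_smul_apply A hf₀.toLp s)
    rw [hℓA] at d2
    refine (d1.mul d2).congr_deriv ?_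
    simp only [Function.comp_apply]
    ring
  have hconst := is_const_of_deriv_eq_zero (fun s => (hm s).differentiableAt)
    (fun s => (hm s).deriv) t 0
  simp only [m] at hconst
  rw [mul_zero, neg_zero, Real.exp_zero, one_mul, zero_smul, NormedSpace.exp_zero,
    one_apply_eq_self, hℓ, hℓ, Real.exp_neg, inv_mul_eq_iff_eq_mul₀ (Real.exp_pos _).ne'] at hconst
  rw [integral_congr_ae (g := fun x => (NormedSpace.exp (t • A) hf₀.toLp : Lp ℝ _ _) x *
      endpointKernel δ x)
    (by filter_upwards [hf.ae_eq_exp hA hf₀ ht] with x hx; rw [hx]), hconst]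
  congr 1
  refine integral_congr_ae ?_
  filter_upwards [hf₀.coeFn_toLp] with x hx
  rw [hx]

end

/-! ### Growth of the L^p norms from the datum χ. -/

theorem memLp_chi (P : ENNReal) : MemLp chi P :=
  memLp_indicator_const P measurableSet_Icc 1 (Or.inr (by simp))

theorem eLpNorm_chi {p : ℝ} (hp : 0 < p) : eLpNorm chi (ENNReal.ofReal p) = 1 := by
  rw [chi, eLpNorm_indicator_const measurableSet_Icc (by simpa using hp) (by simp)]
  simp

theorem integral_chi_mul_endpointKernel (δ : ℝ) :
    ∫ x, chi x * endpointKernel δ x = ∫ x, endpointKernel δ x := by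
  congr 1
  funext x
  by_cases hx : x ∈ Icc (0 : ℝ) 1
  · rw [chi, indicator_of_mem hx, one_mul]
  · rw [chi, indicator_of_notMem hx, endpointKernel,
      indicator_of_notMem fun h => hx (Ioo_subset_Icc_self h), zero_mul]

theorem div_le_cos_div_sin {θ θ₀ : ℝ} (h0 : 0 < θ) (h1 : θ ≤ θ₀) (h2 : θ₀ < Real.pi / 2) :
    Real.cos θ₀ / θ ≤ Real.cos θ / Real.sin θ := by
  have hs : 0 < Real.sin θ := Real.sin_pos_of_pos_of_lt_pi h0 (by linarith)
  have hc : 0 ≤ Real.cos θ := Real.cos_nonneg_of_mem_Icc ⟨by linarith, by linarith⟩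
  exact div_le_div₀ hc (Real.cos_le_cos_of_nonneg_of_le_pi h0.le (by linarith) h1) hs
    (Real.sin_le h0.le)

/-- Exponential lower bound for the datum `χ`, for all times. -/
theorem exists_lower_bound {p₀ : ℝ} (hp₀ : 2 < p₀) : ∃ c C : ℝ, 0 < c ∧ 0 < C ∧ ∀ p : ℝ, p₀ ≤ p →
    ∀ f : ℝ → ℝ → ℝ, IsSolution p chi f → ∀ t : ℝ, 0 ≤ t →
      C * Real.exp (c * p * t) ≤ (eLpNorm (f t) (ENNReal.ofReal p) volume).toReal := by
  -- The kernel is used with δ = l/p: l > 1 gives δ > 1/p, and 2l < p₀ keeps πδ ≤ θ₀ < π/2 for all p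
  -- ≥ p₀, so that the cotangent is at least a constant times p.
  obtain ⟨l, hl1, hl2⟩ : ∃ l : ℝ, 1 < l ∧ 2 * l < p₀ :=
    ⟨(1 + p₀ / 2) / 2, by linarith, by linarith⟩
  have hπ := Real.pi_pos
  have hl0 : 0 < l := by linarith
  set θ₀ := Real.pi * l / p₀ with hθ₀
  have hθ₀2 : θ₀ < Real.pi / 2 := by
    rw [hθ₀, div_lt_div_iff₀ (by linarith) two_pos]
    nlinarith
  have hθ₀0 : 0 < θ₀ := by positivity
  have hcos : 0 < Real.cos θ₀ := Real.cos_pos_of_mem_Ioo ⟨by linarith, hθ₀2⟩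
  have hA : 0 < p₀ - 1 - l := by linarith
  have hB : 0 < l - 1 := by linarith
  -- The L^q norm of the kernel is at most Mp. The maximum with 1 makes Mp ≥ 1, so that taking the
  -- root 1/q ≤ 1 does not increase it.
  set M := max (4 * (1 / (p₀ - 1 - l) + 1 / (l - 1))) 1 with hM
  have hM1 : 1 ≤ M := le_max_right _ _
  refine ⟨Real.cos θ₀ / (Real.pi * l), 1 / (l * M), by positivity, by positivity,
    fun p hp f hf t ht => ?_⟩
  have hp1 : 1 < p := by linarith
  have hp0 : 0 < p := by linarith
  have hpm : 0 < p - 1 := by linarith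
  have hpq := Real.HolderConjugate.conjExponent hp1
  set q := p.conjExponent with hq
  have hqdef : q = p / (p - 1) := rfl
  set δ := l / p with hδ
  have hδ0 : 0 < δ := by positivity
  have hδ2 : δ < 1 / 2 := by rw [hδ, div_lt_div_iff₀ hp0 two_pos]; linarith
  have hpinv : 1 / p < 1 / 2 := one_div_lt_one_div_of_lt two_pos (by linarith)
  have h1 := hf.integral_mul_endpointKernel hp1 (δ := δ)
    (div_lt_div_of_pos_right hl1 hp0) (by linarith) ht
  rw [integral_chi_mul_endpointKernel] at h1
  have hcot : Real.cos θ₀ / (Real.pi * l) * p ≤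
      Real.cos (Real.pi * δ) / Real.sin (Real.pi * δ) := by
    refine le_trans (le_of_eq ?_) (div_le_cos_div_sin (θ := Real.pi * δ) (by positivity) ?_ hθ₀2)
    · rw [hδ]; field_simp
    · rw [hδ, hθ₀, mul_div_assoc]; gcongr
  have hI := le_integral_endpointKernel hδ0 (by linarith)
  have e1 : 1 - δ * q = (p - 1 - l) / (p - 1) := by rw [hqdef, hδ]; field_simp
  have e2 : 1 - (1 - δ) * q = (l - 1) / (p - 1) := by rw [hqdef, hδ]; field_simp; ring
  have hA' : 0 < p - 1 - l := by linarith
  obtain ⟨hk, hkI⟩ := memLp_endpointKernel hδ0 (show δ < 1 by linarith) hpq.symm.pos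
    (by have : 0 < 1 - δ * q := by rw [e1]; positivity
        linarith)
    (by have : 0 < 1 - (1 - δ) * q := by rw [e2]; positivity
        linarith)
  have hkM : ∫ x, ‖endpointKernel δ x‖ ^ q ≤ M * p := by
    refine hkI.trans ?_
    rw [e1, e2, one_div_div, one_div_div]
    have b1 : (p - 1) / (p - 1 - l) ≤ p / (p₀ - 1 - l) :=
      div_le_div₀ hp0.le (by linarith) hA (by linarith)
    have b2 : (p - 1) / (l - 1) ≤ p / (l - 1) := div_le_div_of_nonneg_right (by linarith) hB.le
    calc _ ≤ 4 * (p / (p₀ - 1 - l) + p / (l - 1)) := by linarith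
      _ = 4 * (1 / (p₀ - 1 - l) + 1 / (l - 1)) * p := by ring
      _ ≤ M * p := mul_le_mul_of_nonneg_right (le_max_left _ _) hp0.le
  have hkn : (eLpNorm (endpointKernel δ) (ENNReal.ofReal q) volume).toReal ≤ M * p := by
    rw [toReal_eLpNorm_eq hpq.symm.pos hk]
    refine (Real.rpow_le_rpow (integral_nonneg fun x => by positivity) hkM
      (by have := hpq.symm.pos; positivity)).trans ?_
    refine (Real.rpow_le_rpow_of_exponent_le (by nlinarith) (y := 1 / q) (z := 1) ?_).trans_eq
      (Real.rpow_one _)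
    rw [div_le_one hpq.symm.pos]
    exact hpq.symm.lt.le
  have h2 := (le_abs_self _).trans (abs_integral_mul_le hpq (hf.2.1 t ht) hk)
  rw [h1] at h2
  set N := (eLpNorm (f t) (ENNReal.ofReal p) volume).toReal
  have hN0 : 0 ≤ N := ENNReal.toReal_nonneg
  -- The integral of the kernel is at least 1/δ = p/l, so the factor p cancels against its norm and
  -- C does not depend on p.
  have h3 : Real.exp (Real.cos θ₀ / (Real.pi * l) * p * t) * (1 / δ) ≤ N * (M * p) := by
    refine le_trans ?_ (h2.trans (mul_le_mul_of_nonneg_left hkn hN0))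
    gcongr
  rw [hδ, one_div_div] at h3
  rw [one_div_mul_eq_div, div_le_iff₀ (by positivity)]
  have h4 : Real.exp (Real.cos θ₀ / (Real.pi * l) * p * t) * p / l ≤ N * M * p := by
    rw [mul_div_assoc]; linarith
  rw [div_le_iff₀ hl0] at h4
  nlinarith

/-- A lower bound on bounded time intervals which is uniform in the exponent. -/
theorem exists_lower_bound_of_le (T : ℝ) : ∃ m : ℝ, 0 < m ∧ ∀ p : ℝ, 1 < p →
    ∀ f : ℝ → ℝ → ℝ, IsSolution p chi f → ∀ t : ℝ, 0 ≤ t → t ≤ T →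
      m ≤ (eLpNorm (f t) (ENNReal.ofReal p) volume).toReal := by
  have h43 : Real.HolderConjugate 4 (4 / 3) := by
    rw [Real.holderConjugate_iff]; norm_num
  set k := endpointKernel (1 / 2) with hk
  have hk0 : ∀ x, 0 ≤ k x := endpointKernel_nonneg
  have hkm : Measurable k := measurable_endpointKernel
  -- Integrability of k^{16/9} puts k^{4/3} in L^{4/3}, the dual of L^4.
  have hk169 := (memLp_endpointKernel (δ := 1 / 2) (by norm_num) (by norm_num) (q := 16 / 9)
    (by norm_num) (by norm_num) (by norm_num)).1
  have hw : MemLp (fun x => k x ^ (4 / 3 : ℝ)) (ENNReal.ofReal (4 / 3)) := by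
    rw [← integrable_norm_rpow_iff (hkm.pow_const _).aestronglyMeasurable (by simp) (by simp),
      ENNReal.toReal_ofReal (by norm_num)]
    have := hk169.integrable_norm_rpow (by simp) (by simp)
    rw [ENNReal.toReal_ofReal (by norm_num)] at this
    refine this.congr (Eventually.of_forall fun x => ?_)
    simp only
    rw [Real.norm_of_nonneg (hk0 x), Real.norm_of_nonneg (Real.rpow_nonneg (hk0 x) _),
      ← Real.rpow_mul (hk0 x)]
    norm_num
  have hk43 := (memLp_endpointKernel (δ := 1 / 2) (by norm_num) (by norm_num) (q := 4 / 3)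
    (by norm_num) (by norm_num) (by norm_num)).1
  set Q := Real.exp (12 * max 4 (4 / (4 - 1)) * T) *
    (eLpNorm (fun x => k x ^ (4 / 3 : ℝ)) (ENNReal.ofReal (4 / 3)) volume).toReal with hQ
  have hQ0 : 0 ≤ Q := mul_nonneg (Real.exp_pos _).le ENNReal.toReal_nonneg
  -- Truncation level at which the large part of k contributes at most N^{-1/3}Q ≤ 1, half of the
  -- pairing.
  set N := (Q + 1) ^ (3 : ℝ) with hN
  have hN0 : 0 < N := by positivity
  have hNQ : N ^ (-(1 / 3) : ℝ) * Q ≤ 1 := by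
    rw [hN, ← Real.rpow_mul (by positivity)]
    norm_num
    rw [Real.rpow_neg_one, inv_mul_le_iff₀ (by positivity)]
    linarith
  refine ⟨1 / N, by positivity, fun p hp f hf t ht htT => ?_⟩
  -- The solution agrees a.e. with the L^4 solution, whose norm up to time T is bounded
  -- independently of p.
  obtain ⟨u, hu⟩ := exists_isSolution (p := 4) (by norm_num) (memLp_chi _)
  have hut := hu.2.1 t ht
  have hχu := memLp_chi_mul hut
  have hnorm : (eLpNorm (u t) (ENNReal.ofReal 4) volume).toReal ≤
      Real.exp (12 * max 4 (4 / (4 - 1)) * T) := by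
    have h1 := hu.eLpNorm_le (by norm_num) ht
    rw [eLpNorm_chi (by norm_num), mul_one] at h1
    refine (ENNReal.toReal_le_of_le_ofReal (Real.exp_pos _).le h1).trans ?_
    gcongr
  have habs : MemLp (fun x => |chi x * u t x|) (ENNReal.ofReal 4) := hχu.abs
  have i1 := integrable_mul_of_holderConjugate h43 habs hw
  have i2 : Integrable fun x => |chi x * u t x| := by
    have := integrable_mul_of_holderConjugate h43 habs (memLp_chi _)
    refine this.congr (Eventually.of_forall fun x => ?_)
    by_cases hx : x ∈ Icc (0 : ℝ) 1 <;> simp [chi, hx]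
  have i3 := integrable_mul_of_holderConjugate h43 hut hk43
  -- For δ = 1/2 the cotangent vanishes: the pairing is conserved and equals the integral of the
  -- kernel.
  have h2 : 2 ≤ ∫ x, u t x * k x := by
    rw [hu.integral_mul_endpointKernel (by norm_num) (by norm_num) (by norm_num) ht,
      integral_chi_mul_endpointKernel,
      show Real.pi * (1 / 2) = Real.pi / 2 by ring, Real.cos_pi_div_two, zero_div, zero_mul,
      Real.exp_zero, one_mul]
    have := le_integral_endpointKernel (δ := 1 / 2) (by norm_num) (by norm_num)
    norm_num at this ⊢
    exact this
  have h3 : ∫ x, u t x * k x ≤ ∫ x, (N * |chi x * u t x| +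
      N ^ (-(1 / 3) : ℝ) * (|chi x * u t x| * k x ^ (4 / 3 : ℝ))) := by
    refine integral_mono i3 ((i2.const_mul N).add (i1.const_mul _)) fun x => ?_
    have e : u t x * k x = chi x * u t x * k x := by
      by_cases hx : x ∈ Icc (0 : ℝ) 1
      · rw [chi, indicator_of_mem hx, one_mul]
      · rw [hk, endpointKernel, indicator_of_notMem fun h => hx (Ioo_subset_Icc_self h), mul_zero,
          mul_zero]
    have hk' : k x ≤ N + N ^ (-(1 / 3) : ℝ) * k x ^ (4 / 3 : ℝ) := by
      rcases le_or_gt (k x) N with h | h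
      · have : 0 ≤ N ^ (-(1 / 3) : ℝ) * k x ^ (4 / 3 : ℝ) :=
          mul_nonneg (by positivity) (Real.rpow_nonneg (hk0 x) _)
        linarith
      · have hkp : 0 < k x := hN0.trans h
        have : k x ^ (-(1 / 3) : ℝ) ≤ N ^ (-(1 / 3) : ℝ) :=
          Real.rpow_le_rpow_of_nonpos hN0 h.le (by norm_num)
        have h5 : k x ^ (-(1 / 3) : ℝ) * k x ^ (4 / 3 : ℝ) = k x := by
          rw [← Real.rpow_add hkp]; norm_num
        have h6 := mul_le_mul_of_nonneg_right this (Real.rpow_nonneg (hk0 x) (4 / 3))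
        linarith
    simp only
    rw [e]
    calc _ ≤ |chi x * u t x| * k x := mul_le_mul_of_nonneg_right (le_abs_self _) (hk0 x)
      _ ≤ |chi x * u t x| * (N + N ^ (-(1 / 3) : ℝ) * k x ^ (4 / 3 : ℝ)) :=
        mul_le_mul_of_nonneg_left hk' (abs_nonneg _)
      _ = _ := by ring
  rw [integral_add (i2.const_mul N) (i1.const_mul _), integral_const_mul, integral_const_mul] at h3
  have h4 : ∫ x, |chi x * u t x| * k x ^ (4 / 3 : ℝ) ≤ Q := by
    refine (le_abs_self _).trans ((abs_integral_mul_le h43 habs hw).trans ?_)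
    refine mul_le_mul_of_nonneg_right (le_trans ?_ hnorm) ENNReal.toReal_nonneg
    refine ENNReal.toReal_mono hut.eLpNorm_ne_top ?_
    refine le_trans (le_of_eq ?_) (eLpNorm_chi_mul_le _ (u t))
    exact eLpNorm_norm (fun x => chi x * u t x)
  -- Of the pairing, at least 2, the large values of k account for at most 1. The resulting lower
  -- bound for the L^1 norm on [0,1] passes to every L^p by Hölder against χ, which has norm 1.
  have h5 : 1 ≤ N * ∫ x, |chi x * u t x| := by
    have := mul_le_mul_of_nonneg_left h4 (show 0 ≤ N ^ (-(1 / 3) : ℝ) by positivity)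
    linarith
  have h6 : ∫ x, |chi x * u t x| = ∫ x, |f t x| * chi x := by
    refine integral_congr_ae ?_
    filter_upwards [hu.ae_eq (by norm_num) hp hf ht] with x hx
    rw [hx]
    by_cases hx : x ∈ Icc (0 : ℝ) 1 <;> simp [chi, hx]
  have hpq := Real.HolderConjugate.conjExponent hp
  have h7 := (le_abs_self _).trans
    (abs_integral_mul_le hpq (hf.2.1 t ht).abs (memLp_chi (ENNReal.ofReal p.conjExponent)))
  rw [eLpNorm_chi hpq.symm.pos, ENNReal.toReal_one, mul_one] at h7
  have h8 : eLpNorm |f t| (ENNReal.ofReal p) volume = eLpNorm (f t) (ENNReal.ofReal p) volume :=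
    eLpNorm_norm (f t)
  rw [← h8, div_le_iff₀ hN0]
  have h10 : ∫ x, |f t x| * chi x = ∫ x, |f t| x * chi x := rfl
  rw [h6, h10] at h5
  nlinarith

theorem ofReal_le_eLpNorm_of_le_toReal {f : ℝ → ℝ} {P : ENNReal} (hf : MemLp f P) {a : ℝ}
    (h : a ≤ (eLpNorm f P volume).toReal) : ENNReal.ofReal a ≤ eLpNorm f P := by
  rw [← ENNReal.ofReal_toReal hf.eLpNorm_ne_top]
  exact ENNReal.ofReal_le_ofReal h

/-- Halving the rate leaves a spare factor e^{cpt/2}, which absorbs C once pt is large enough; this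
determines K. -/
theorem growth_of_lt (p₀ : ℝ) (hp₀ : 2 < p₀) : ∃ c C K : ℝ, 0 < c ∧ 0 < C ∧ 0 < K ∧ ∀ p : ℝ, p₀ ≤ p →
    ∀ f : ℝ → ℝ → ℝ, IsSolution p chi f → ∀ t : ℝ, 0 ≤ t →
      ENNReal.ofReal (C * Real.exp (c * p * t)) * eLpNorm chi (ENNReal.ofReal p) volume ≤
        eLpNorm (f t) (ENNReal.ofReal p) volume ∧
      (K ≤ p * t →
        ENNReal.ofReal (Real.exp (c * p * t)) * eLpNorm chi (ENNReal.ofReal p) volume ≤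
          eLpNorm (f t) (ENNReal.ofReal p) volume) := by
  obtain ⟨c, C, hc, hC, h⟩ := exists_lower_bound hp₀
  refine ⟨c / 2, C, 2 / c * |Real.log C| + 1, by positivity, hC, by positivity,
    fun p hp f hf t ht => ?_⟩
  have hp0 : 0 < p := by linarith
  have key := h p hp f hf t ht
  rw [eLpNorm_chi hp0, mul_one, mul_one]
  have e : c * p * t = c / 2 * p * t + c / 2 * p * t := by ring
  constructor
  · refine ofReal_le_eLpNorm_of_le_toReal (hf.2.1 t ht) (le_trans ?_ key)
    have : 0 ≤ c / 2 * p * t := by positivity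
    gcongr
    linarith
  · intro hK
    refine ofReal_le_eLpNorm_of_le_toReal (hf.2.1 t ht) (le_trans ?_ key)
    rw [e, Real.exp_add, ← mul_assoc]
    refine le_mul_of_one_le_left (Real.exp_pos _).le ?_
    have h1 : |Real.log C| ≤ c / 2 * p * t := by
      have h2 : 2 / c * |Real.log C| ≤ p * t := by linarith
      rw [div_mul_eq_mul_div, div_le_iff₀ hc] at h2
      linarith
    have h3 : Real.exp (-Real.log C) ≤ Real.exp (c / 2 * p * t) :=
      Real.exp_le_exp.2 ((neg_le_abs _).trans h1)
    rw [Real.exp_neg, Real.exp_log hC] at h3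
    calc 1 = C * C⁻¹ := (mul_inv_cancel₀ hC.ne').symm
      _ ≤ _ := by gcongr

/-- For p ≥ 3 the lower bound for all times applies; for p ≤ 3 and t ≤ T the exponential is at most
e^{3cT} and is absorbed into C. -/
theorem growth_of_time_le (T : ℝ) : ∃ c C : ℝ, 0 < c ∧ 0 < C ∧ ∀ p : ℝ, 1 < p →
    ∀ f : ℝ → ℝ → ℝ, IsSolution p chi f → ∀ t : ℝ, 0 ≤ t → t ≤ T →
      ENNReal.ofReal (C * Real.exp (c * p * t)) * eLpNorm chi (ENNReal.ofReal p) volume ≤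
        eLpNorm (f t) (ENNReal.ofReal p) volume := by
  obtain ⟨c, C, hc, hC, h⟩ := exists_lower_bound (p₀ := 3) (by norm_num)
  obtain ⟨m, hm, h'⟩ := exists_lower_bound_of_le T
  refine ⟨c, min C (m * Real.exp (-(c * 3 * T))), hc, by positivity, fun p hp f hf t ht htT => ?_⟩
  rw [eLpNorm_chi (by linarith), mul_one]
  refine ofReal_le_eLpNorm_of_le_toReal (hf.2.1 t ht) ?_
  rcases le_total 3 p with h3 | h3
  · refine le_trans ?_ (h p h3 f hf t ht)
    gcongr
    exact min_le_left _ _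
  · refine le_trans ?_ (h' p hp f hf t ht htT)
    calc _ ≤ m * Real.exp (-(c * 3 * T)) * Real.exp (c * 3 * T) := by
          gcongr
          exact min_le_right _ _
      _ = m := by rw [mul_assoc, ← Real.exp_add, neg_add_cancel, Real.exp_zero, mul_one]

/-! ### Mellin transforms and averages over all scales. -/

/-- A bounded measurable function supported in `(1/4, 3/4)`. -/
structure IsMidBump (ψ : ℝ → ℝ) (B : ℝ) : Prop where
  measurable : Measurable ψ
  bound : ∀ y, |ψ y| ≤ B
  support : ∀ y, ψ y ≠ 0 → y ∈ Ioo (1 / 4 : ℝ) (3 / 4)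

section

variable {ψ : ℝ → ℝ} {B δ : ℝ}

theorem IsMidBump.integrable_comp_div (h : IsMidBump ψ B) (hδ : δ ≤ 2) {s : ℝ} (hs : 0 < s) :
    IntegrableOn (fun r : ℝ => ψ (s / r) * r ^ (δ - 2)) (Ioi 0) := by
  have hB : 0 ≤ B := (abs_nonneg _).trans (h.bound 0)
  have hm := h.measurable
  have h1 : Integrable ((Ioo s (4 * s)).indicator fun _ => B * s ^ (δ - 2)) :=
    (integrable_indicator_iff measurableSet_Ioo).2 (integrableOn_const (by simp))
  refine h1.integrableOn.mono' (Measurable.aestronglyMeasurable (by fun_prop))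
    (ae_restrict_of_forall_mem measurableSet_Ioi fun r hr => ?_)
  have hr : 0 < r := hr
  by_cases h0 : ψ (s / r) = 0
  · rw [h0, zero_mul, norm_zero]
    exact indicator_nonneg (fun _ _ => by positivity) _
  · have h2 := h.support _ h0
    have h3 : s < r := by
      have := (div_lt_iff₀ hr).1 h2.2
      linarith
    have h4 : r < 4 * s := by
      have := (lt_div_iff₀ hr).1 h2.1
      linarith
    rw [indicator_of_mem (show r ∈ Ioo s (4 * s) from ⟨h3, h4⟩), norm_mul,
      Real.norm_of_nonneg (Real.rpow_nonneg hr.le _)]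
    exact mul_le_mul (h.bound _) (Real.rpow_le_rpow_of_nonpos hs h3.le (by linarith))
      (by positivity) hB

/-- The substitution v = s/r shows that integrating the dilates of ψ over all scales produces the
power s^{δ-1} times a Mellin moment. -/
theorem integral_comp_div_mul_rpow (ψ : ℝ → ℝ) (δ : ℝ) {s : ℝ} (hs : 0 < s) :
    ∫ r in Ioi (0 : ℝ), ψ (s / r) * r ^ (δ - 2) =
      s ^ (δ - 1) * ∫ v in Ioi (0 : ℝ), ψ v * v ^ (-δ) := by
  have h1 := integral_comp_rpow_Ioi (fun y => ψ (s * y) * y ^ (-δ)) (p := -1) (by norm_num)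
  have h2 := integral_comp_mul_left_Ioi (fun v => ψ v * (v / s) ^ (-δ)) 0 hs
  rw [mul_zero, smul_eq_mul] at h2
  have h3 : ∫ r in Ioi (0 : ℝ), ψ (s / r) * r ^ (δ - 2) =
      ∫ x in Ioi (0 : ℝ), (|(-1 : ℝ)| * x ^ (-1 - 1 : ℝ)) •
        (ψ (s * x ^ (-1 : ℝ)) * (x ^ (-1 : ℝ)) ^ (-δ)) := by
    refine setIntegral_congr_fun measurableSet_Ioi fun r hr => ?_
    have hr : 0 < r := hr
    simp only [smul_eq_mul]
    rw [abs_neg, abs_one, one_mul, ← Real.rpow_mul hr.le, Real.rpow_neg_one, ← div_eq_mul_inv,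
      show δ - 2 = (-1 - 1) + (-1 * -δ) by ring, Real.rpow_add hr]
    ring
  have h4 : ∫ x in Ioi (0 : ℝ), ψ (s * x) * x ^ (-δ) =
      ∫ x in Ioi (0 : ℝ), ψ (s * x) * (s * x / s) ^ (-δ) := by
    refine setIntegral_congr_fun measurableSet_Ioi fun r hr => ?_
    rw [mul_div_cancel_left₀ _ hs.ne']
  rw [h3, h1, h4, h2, ← integral_const_mul, ← integral_const_mul]
  refine setIntegral_congr_fun measurableSet_Ioi fun v hv => ?_
  have hv : 0 < v := hv
  rw [Real.div_rpow hv.le hs.le, Real.rpow_neg hs.le, div_inv_eq_mul, Real.rpow_sub_one hs.ne']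
  ring

/-- If the averages of `k` against dilates of `ψ` are bounded, then the Mellin transform of `k` at
`δ` is at most of order `1/δ` relative to that of `ψ`. -/
theorem abs_mellin_mul_le (h : IsMidBump ψ B) (hδ0 : 0 < δ) (hδ : δ ≤ 1 / 2) {k : ℝ → ℝ}
    (hk : Integrable k) (hk0 : ∀ s, k s ≠ 0 → s ∈ Ioo (0 : ℝ) 1)
    (hkδ : Integrable fun s => k s * s ^ (δ - 1)) {M : ℝ}
    (hM : ∀ r ∈ Ioc (0 : ℝ) 1, |∫ y, k (r * y) * ψ y| ≤ M) :
    |∫ s, k s * s ^ (δ - 1)| * |∫ v in Ioi (0 : ℝ), ψ v * v ^ (-δ)| ≤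
      M / δ + 2 * (B * ∫ s, |k s|) := by
  have hB : 0 ≤ B := (abs_nonneg _).trans (h.bound 0)
  have hm := h.measurable
  -- Fubini for G: integrating first in r gives the product of the two Mellin integrals, first in s
  -- the averages of k at scale r weighted by r^{δ-1}.
  set G : ℝ → ℝ → ℝ := fun r s => k s * (ψ (s / r) * r ^ (δ - 2)) with hG
  have hGm : AEStronglyMeasurable (Function.uncurry G)
      ((volume.restrict (Ioi (0 : ℝ))).prod volume) :=
    (hk.1.comp_snd).mul (Measurable.aestronglyMeasurable (by fun_prop))
  have hin : ∀ (χ : ℝ → ℝ) (s : ℝ), k s * ∫ r in Ioi (0 : ℝ), χ (s / r) * r ^ (δ - 2) =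
      k s * s ^ (δ - 1) * ∫ v in Ioi (0 : ℝ), χ v * v ^ (-δ) := by
    intro χ s
    rcases eq_or_ne (k s) 0 with h0 | h0
    · simp [h0]
    · rw [integral_comp_div_mul_rpow χ δ (hk0 s h0).1, mul_assoc]
  have hGi : Integrable (Function.uncurry G) ((volume.restrict (Ioi (0 : ℝ))).prod volume) := by
    rw [integrable_prod_iff' hGm]
    constructor
    · refine Eventually.of_forall fun s => ?_
      simp only [Function.uncurry, hG]
      rcases eq_or_ne (k s) 0 with h0 | h0
      · simp [h0]
      · exact (h.integrable_comp_div (by linarith) (hk0 s h0).1).const_mul (k s)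
    · refine (hkδ.abs.mul_const (∫ v in Ioi (0 : ℝ), |ψ v| * v ^ (-δ))).congr
        (Eventually.of_forall fun s => ?_)
      simp only [Function.uncurry, hG]
      have h1 := congrArg abs (hin (fun y => |ψ y|) s)
      rw [abs_mul, abs_mul, abs_of_nonneg (a := ∫ r in Ioi (0 : ℝ), _)
        (setIntegral_nonneg measurableSet_Ioi fun r hr => mul_nonneg (abs_nonneg _)
          (Real.rpow_nonneg (le_of_lt hr) _)),
        abs_of_nonneg (a := ∫ v in Ioi (0 : ℝ), _)
        (setIntegral_nonneg measurableSet_Ioi fun r hr => mul_nonneg (abs_nonneg _)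
          (Real.rpow_nonneg (le_of_lt hr) _))] at h1
      rw [← h1, ← integral_const_mul]
      refine setIntegral_congr_fun measurableSet_Ioi fun r hr => ?_
      rw [norm_mul, norm_mul, Real.norm_of_nonneg (Real.rpow_nonneg (le_of_lt hr) _)]
      rfl
  have hswap := integral_integral_swap hGi
  have e1 : ∫ s, ∫ r in Ioi (0 : ℝ), G r s =
      (∫ s, k s * s ^ (δ - 1)) * ∫ v in Ioi (0 : ℝ), ψ v * v ^ (-δ) := by
    simp only [hG]
    simp_rw [integral_const_mul, hin ψ]
    rw [integral_mul_const]
  rw [e1] at hswap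
  rw [← abs_mul, ← hswap]
  have hAi : IntegrableOn (fun r => ∫ s, G r s) (Ioi 0) := hGi.integral_prod_left
  have hA : ∀ r, 0 < r → ∫ s, G r s = r ^ (δ - 1) * ∫ y, k (r * y) * ψ y := by
    intro r hr
    have h2 := Measure.integral_comp_mul_left (fun s => k s * ψ (s / r)) r
    rw [abs_of_pos (inv_pos.2 hr), smul_eq_mul] at h2
    simp only [mul_div_cancel_left₀ _ hr.ne'] at h2
    rw [h2, ← mul_assoc, ← div_eq_mul_inv, ← Real.rpow_sub_one hr.ne', ← integral_const_mul]
    congr 1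
    funext s
    simp only [hG]
    rw [show δ - 1 - 1 = δ - 2 by ring]
    ring
  -- Scales r ≤ 1 use the bound M and the integral 1/δ of r^{δ-1}. Scales r > 1 use only the L^1
  -- norm of k and the integral 1/(1-δ) ≤ 2 of r^{δ-2}.
  have hu : Ioi (0 : ℝ) = Ioc 0 1 ∪ Ioi 1 := (Ioc_union_Ioi_eq_Ioi zero_le_one).symm
  rw [hu] at hAi ⊢
  rw [setIntegral_union (Ioc_disjoint_Ioi le_rfl) measurableSet_Ioi hAi.left_of_union
    hAi.right_of_union]
  refine (abs_add_le _ _).trans (add_le_add ?_ ?_)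
  · have i1 : IntegrableOn (fun r : ℝ => r ^ (δ - 1)) (Ioc 0 1) :=
      (intervalIntegrable_iff_integrableOn_Ioc_of_le zero_le_one).1
        (intervalIntegral.intervalIntegrable_rpow' (by linarith))
    rw [← Real.norm_eq_abs]
    refine (norm_integral_le_of_norm_le (i1.mul_const M)
      (ae_restrict_of_forall_mem measurableSet_Ioc fun r hr => ?_)).trans_eq ?_
    · rw [hA r hr.1, norm_mul, Real.norm_of_nonneg (Real.rpow_nonneg hr.1.le _)]
      exact mul_le_mul_of_nonneg_left (hM r hr) (Real.rpow_nonneg hr.1.le _)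
    · rw [integral_mul_const, ← intervalIntegral.integral_of_le zero_le_one,
        integral_rpow (Or.inl (by linarith)), Real.one_rpow, sub_add_cancel,
        Real.zero_rpow hδ0.ne']
      ring
  · have i1 := integrableOn_Ioi_rpow_of_lt (show δ - 2 < -1 by linarith) one_pos
    have hK : 0 ≤ B * ∫ s, |k s| := mul_nonneg hB (integral_nonneg fun s => abs_nonneg _)
    rw [← Real.norm_eq_abs]
    refine (norm_integral_le_of_norm_le (i1.mul_const (B * ∫ s, |k s|))
      (ae_restrict_of_forall_mem measurableSet_Ioi fun r hr => ?_)).trans ?_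
    · have hr0 : 0 < r := one_pos.trans hr
      have hrp : 0 ≤ r ^ (δ - 2) := Real.rpow_nonneg hr0.le _
      rw [← integral_const_mul, ← integral_const_mul]
      refine norm_integral_le_of_norm_le ((hk.abs.const_mul B).const_mul _)
        (Eventually.of_forall fun s => ?_)
      simp only [hG]
      rw [norm_mul, norm_mul, Real.norm_of_nonneg hrp, Real.norm_eq_abs, Real.norm_eq_abs]
      have := mul_le_mul_of_nonneg_right (h.bound (s / r)) (mul_nonneg (abs_nonneg (k s)) hrp)
      linarith
    · rw [integral_mul_const, integral_Ioi_rpow_of_lt (by linarith) one_pos, Real.one_rpow]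
      refine mul_le_mul_of_nonneg_right ?_ hK
      rw [show -1 / (δ - 2 + 1) = 1 / (1 - δ) by rw [← neg_div_neg_eq]; congr 1 <;> ring,
        div_le_iff₀ (by linarith)]
      linarith

end

/-- Take ψ = η - 2η(2·) for a bump η of mass 1. The dilation multiplies the Mellin moment by 2^δ, so
that of ψ is (1 - 2^δ) times that of η: mean zero makes it vanish at δ = 0, but only to first order.
-/
theorem exists_meanZero_bump : ∃ (ψ : ℝ → ℝ) (B : ℝ), IsTest ψ ∧ ∫ y, ψ y = 0 ∧ IsMidBump ψ B ∧
    ∀ δ : ℝ, 0 < δ → δ ≤ 1 / 2 → δ / 2 ≤ |∫ v in Ioi (0 : ℝ), ψ v * v ^ (-δ)| := by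
  let b : ContDiffBump (5 / 8 : ℝ) := ⟨1 / 16, 1 / 8, by norm_num, by norm_num⟩
  set η : ℝ → ℝ := b.normed volume with hη
  have hηt : IsTest η := ⟨b.contDiff_normed, b.hasCompactSupport_normed⟩
  have hηc : Continuous η := b.continuous_normed
  have hη0 : ∀ y, 0 ≤ η y := fun y => b.nonneg_normed y
  have hη1 : ∫ y, η y = 1 := b.integral_normed
  have hηi : Integrable η := b.integrable_normed
  have hηs : ∀ y, η y ≠ 0 → y ∈ Ioo (1 / 2 : ℝ) (3 / 4) := by
    intro y hy
    have h1 : y ∈ Metric.ball (5 / 8 : ℝ) (1 / 8) := by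
      rw [← b.support_normed_eq (μ := volume)]
      exact hy
    rw [Real.ball_eq_Ioo] at h1
    norm_num at h1 ⊢
    exact h1
  have hη2t : IsTest (fun y => 2 * η (2 * y)) :=
    ⟨contDiff_const.mul (hηt.1.comp (contDiff_const.mul contDiff_id)),
      HasCompactSupport.mul_left (hηt.2.comp_homeomorph (Homeomorph.mulLeft₀ (2 : ℝ) two_ne_zero))⟩
  have hψt := hηt.sub hη2t
  obtain ⟨B, hB⟩ := hψt.2.exists_bound_of_continuous hψt.1.continuous
  have hscale : ∀ g : ℝ → ℝ, ∫ y, g (2 * y) = 2⁻¹ * ∫ y, g y := by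
    intro g
    rw [Measure.integral_comp_mul_left, abs_of_pos (by norm_num), smul_eq_mul]
  refine ⟨_, B, hψt, ?_, ⟨hψt.1.continuous.measurable, hB, fun y hy => ?_⟩, fun δ hδ0 hδ => ?_⟩
  · rw [integral_sub hηi ((hηi.comp_mul_left' two_ne_zero).const_mul 2), integral_const_mul,
      hscale, hη1]
    norm_num
  · by_cases h1 : η y = 0
    · have h2 : η (2 * y) ≠ 0 := fun h2 => hy (by simp [h1, h2])
      have := hηs _ h2
      constructor <;> linarith [this.1, this.2]
    · have := hηs _ h1
      constructor <;> linarith [this.1, this.2]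
  · have hle : ∀ y, η y ≤ η y * y ^ (-δ) ∧ η y * y ^ (-δ) ≤ η y * 4 := by
      intro y
      by_cases h1 : η y = 0
      · simp [h1]
      · have h2 := hηs _ h1
        have hy0 : 0 < y := by linarith [h2.1]
        constructor
        · exact le_mul_of_one_le_right (hη0 y)
            (Real.one_le_rpow_of_pos_of_le_one_of_nonpos hy0 (by linarith [h2.2]) (by linarith))
        · refine mul_le_mul_of_nonneg_left ?_ (hη0 y)
          refine (Real.rpow_le_rpow_of_nonpos (show (0 : ℝ) < 1 / 2 by norm_num) h2.1.le
            (by linarith)).trans ?_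
          refine (Real.rpow_le_rpow_of_exponent_ge (by norm_num) (by norm_num)
            (show (-2 : ℝ) ≤ -δ by linarith)).trans ?_
          rw [Real.rpow_neg (by norm_num), Real.rpow_two]
          norm_num
    have hJi : Integrable fun y => η y * y ^ (-δ) := by
      refine (hηi.mul_const 4).mono' (Measurable.aestronglyMeasurable (by
        have := hηc.measurable
        fun_prop)) (Eventually.of_forall fun y => ?_)
      rw [Real.norm_of_nonneg ((hη0 y).trans (hle y).1)]
      exact (hle y).2
    have hJ : 1 ≤ ∫ y, η y * y ^ (-δ) := by
      rw [← hη1]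
      exact integral_mono hηi hJi fun y => (hle y).1
    have e1 : ∀ y : ℝ, 2 * η (2 * y) * y ^ (-δ) = 2 * 2 ^ δ * (η (2 * y) * (2 * y) ^ (-δ)) := by
      intro y
      by_cases h1 : η (2 * y) = 0
      · simp [h1]
      · have hy0 : 0 < y := by linarith [(hηs _ h1).1]
        rw [Real.mul_rpow (by norm_num) hy0.le, Real.rpow_neg (by norm_num : (0 : ℝ) ≤ 2)]
        have : (2 : ℝ) ^ δ ≠ 0 := by positivity
        field_simp
    have e2 : ∫ v in Ioi (0 : ℝ), (η v - 2 * η (2 * v)) * v ^ (-δ) =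
        (1 - 2 ^ δ) * ∫ y, η y * y ^ (-δ) := by
      rw [setIntegral_eq_integral_of_forall_compl_eq_zero]
      · simp_rw [sub_mul, e1]
        rw [integral_sub hJi ((hJi.comp_mul_left' two_ne_zero).const_mul _), integral_const_mul,
          hscale (fun y => η y * y ^ (-δ))]
        ring
      · intro v hv
        have hv : v ≤ 0 := not_lt.1 hv
        have h1 : η v = 0 := by
          by_contra h1
          linarith [(hηs _ h1).1]
        have h2 : η (2 * v) = 0 := by
          by_contra h2
          linarith [(hηs _ h2).1]
        rw [h1, h2]
        ring
    -- From e^x ≥ 1 + x and log 2 > 1/2.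
    have e3 : δ / 2 ≤ 2 ^ δ - 1 := by
      rw [Real.rpow_def_of_pos two_pos]
      have h1 := Real.add_one_le_exp (Real.log 2 * δ)
      have h2 : 1 / 2 * δ ≤ Real.log 2 * δ :=
        mul_le_mul_of_nonneg_right (by linarith [Real.log_two_gt_d9]) hδ0.le
      linarith
    rw [e2, abs_mul, abs_sub_comm, abs_of_nonneg (by linarith), abs_of_nonneg (by linarith)]
    nlinarith

/-! ### Ill-posedness at the scaling of L^∞. -/

theorem memLp_of_memLp_one_top {f : ℝ → ℝ} (h1 : MemLp f 1) (h2 : MemLp f ⊤) {p : ℝ} (hp : 1 ≤ p) :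
    MemLp f (ENNReal.ofReal p) := by
  have hp0 : 0 < p := by linarith
  rw [← integrable_norm_rpow_iff h1.1 (by simpa using hp0) (by simp), ENNReal.toReal_ofReal hp0.le]
  obtain ⟨B, hB⟩ : ∃ B : ℝ, ∀ᵐ x, ‖f x‖ ≤ B := by
    refine ⟨(eLpNorm f ⊤ volume).toReal, ?_⟩
    filter_upwards [ae_le_eLpNormEssSup (f := f) (μ := volume)] with x hx
    rw [eLpNorm_exponent_top, ← toReal_enorm]
    exact ENNReal.toReal_mono (by simpa using h2.eLpNorm_ne_top) hx
  refine ((memLp_one_iff_integrable.1 h1).norm.const_mul (B ^ (p - 1))).mono'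
    (h1.1.norm.aemeasurable.pow_const p).aestronglyMeasurable ?_
  filter_upwards [hB] with x hx
  rw [Real.norm_of_nonneg (by positivity)]
  rcases (norm_nonneg (f x)).eq_or_lt with h0 | h0
  · rw [← h0, Real.zero_rpow hp0.ne', mul_zero]
  · rw [← sub_add_cancel p 1, Real.rpow_add_one h0.ne', add_sub_cancel_right]
    exact mul_le_mul_of_nonneg_right
      (Real.rpow_le_rpow h0.le hx (by linarith)) h0.le

/-- The only use of the structure of X in the contradiction: by the affine invariance of the
seminorm, the pairings of h with mean-zero bumps around the point 1 are bounded uniformly over all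
scales. -/
theorem CriticalSpace.exists_pairing_bound (X : CriticalSpace) {h ψ : ℝ → ℝ} (hh : h ∈ X.carrier)
    (hψ : IsTest ψ) (h0 : ∫ y, ψ y = 0) :
    ∃ M : ℝ, 0 ≤ M ∧ ∀ r : ℝ, 0 < r → |∫ y, h (1 - r * y) * ψ y| ≤ M := by
  obtain ⟨K, hK⟩ := X.affine_le
  -- The dilations have r > 0, so the reflection s ↦ 1 - s is put on the test function.
  have hψn : IsTest (fun y => ψ (-y)) :=
    ⟨hψ.1.comp contDiff_neg, hψ.2.comp_homeomorph (Homeomorph.neg ℝ)⟩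
  obtain ⟨C, hC⟩ := X.pairing_le _ hψn (by rw [integral_neg_eq_self]; exact h0)
  have hs := apply_nonneg X.seminorm ⟨h, hh⟩
  refine ⟨|C| * (|K| * X.seminorm ⟨h, hh⟩), by positivity, fun r hr => ?_⟩
  have h1 := hC ⟨_, X.affine_mem h hh r 1 hr⟩
  have h2 := hK ⟨h, hh⟩ ⟨_, X.affine_mem h hh r 1 hr⟩ r 1 hr fun x => rfl
  have e : ∫ y, h (1 - r * y) * ψ y = ∫ x, h (r * x + 1) * ψ (-x) := by
    rw [← integral_neg_eq_self (fun y => h (1 - r * y) * ψ y)]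
    congr 1
    funext x
    rw [show 1 - r * -x = r * x + 1 by ring]
  rw [e]
  have hg := apply_nonneg X.seminorm ⟨_, X.affine_mem h hh r 1 hr⟩
  refine h1.trans ((mul_le_mul_of_nonneg_right (le_abs_self C) hg).trans ?_)
  refine mul_le_mul_of_nonneg_left (h2.trans ?_) (abs_nonneg C)
  exact mul_le_mul_of_nonneg_right (le_abs_self K) hs

theorem endpointKernel_one_sub {δ s : ℝ} (hs : s ∈ Ioo (0 : ℝ) 1) :
    endpointKernel δ (1 - s) = (1 - s) ^ (-δ) * s ^ (δ - 1) := by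
  rw [endpointKernel, indicator_of_mem (show (1 - s) ∈ Ioo (0 : ℝ) 1 from
    ⟨by linarith [hs.2], by linarith [hs.1]⟩), sub_sub_cancel, neg_sub]

/-- A solution whose datum is `1` on `[0,1]` pairs with the eigenfunctions to exponentially large
values. -/
theorem integral_solution_ge {f₀ : ℝ → ℝ} (h1 : MemLp f₀ 1) (h2 : MemLp f₀ ⊤)
    (hone : ∀ᵐ x ∂volume, x ∈ Icc (0 : ℝ) 1 → f₀ x = 1) {p : ℝ} (hp : 1 < p)
    {f : ℝ → ℝ → ℝ} (hf : IsSolution p f₀ f) {t : ℝ} (ht : 0 ≤ t) {δ : ℝ} (hδ0 : 0 < δ)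
    (hδ : δ ≤ 1 / 4) :
    Integrable (fun x => f t x * endpointKernel δ x) ∧
      Real.exp (Real.cos (Real.pi / 4) / Real.pi * t / δ) ≤ ∫ x, f t x * endpointKernel δ x := by
  have hπ := Real.pi_pos
  -- An exponent with 1/P = δ/2 < δ, for which the kernel is admissible; the solution agrees a.e.
  -- with the L^P solution, whatever p is.
  set P := 2 / δ with hP
  have hP8 : 8 ≤ P := by rw [hP, le_div_iff₀ hδ0]; linarith
  have hPinv : 1 / P = δ / 2 := by rw [hP, one_div_div]
  have hP1 : 1 < P := by linarith
  obtain ⟨u, hu⟩ := exists_isSolution hP1 (memLp_of_memLp_one_top h1 h2 hP1.le)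
  have hfu := hf.ae_eq hp hP1 hu ht
  have e1 := hu.integral_mul_endpointKernel hP1 (δ := δ) (by linarith) (by linarith) ht
  have hpq := Real.HolderConjugate.conjExponent hP1
  have hPm : 0 < P - 1 := by linarith
  have hq : P.conjExponent ≤ 1 + δ := by
    change P / (P - 1) ≤ 1 + δ
    rw [div_le_iff₀ hPm]
    have : δ * P = 2 := by rw [hP]; field_simp
    nlinarith
  have hk := (memLp_endpointKernel hδ0 (by linarith) hpq.symm.pos
    (by nlinarith [hpq.symm.pos]) (by nlinarith [hpq.symm.pos])).1
  have hi := integrable_mul_of_holderConjugate hpq (hu.2.1 t ht) hk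
  have hcongr : (fun x => f t x * endpointKernel δ x) =ᵐ[volume]
      fun x => u t x * endpointKernel δ x := by
    filter_upwards [hfu] with x hx
    rw [hx]
  refine ⟨hi.congr hcongr.symm, ?_⟩
  have e2 : ∫ x, f₀ x * endpointKernel δ x = ∫ x, endpointKernel δ x := by
    refine integral_congr_ae ?_
    filter_upwards [hone] with x hx
    by_cases h : x ∈ Icc (0 : ℝ) 1
    · rw [hx h, one_mul]
    · rw [endpointKernel, indicator_of_notMem fun h' => h (Ioo_subset_Icc_self h'), mul_zero]
  rw [integral_congr_ae hcongr, e1, e2]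
  have hI := le_integral_endpointKernel hδ0 (show δ < 1 by linarith)
  have hI1 : 1 ≤ 1 / δ := by rw [le_div_iff₀ hδ0]; linarith
  refine le_trans ?_ (le_mul_of_one_le_right (Real.exp_pos _).le (hI1.trans hI))
  refine Real.exp_le_exp.2 ?_
  have hcot := div_le_cos_div_sin (θ := Real.pi * δ) (θ₀ := Real.pi / 4) (by positivity)
    (by nlinarith) (by linarith)
  refine le_trans (le_of_eq ?_) (mul_le_mul_of_nonneg_right hcot ht)
  field_simp

/-- The pairing with the kernel is at least e^{a/δ} by the eigenfunction identity, and would be at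
most C/δ² if a representative were in X. -/
theorem leavesAtOnce (X : CriticalSpace) {f₀ : ℝ → ℝ} (h1 : MemLp f₀ 1) (h2 : MemLp f₀ ⊤)
    (hone : ∀ᵐ x ∂volume, x ∈ Icc (0 : ℝ) 1 → f₀ x = 1) : LeavesAtOnce X f₀ := by
  intro p hp f hf t ht h hft hX
  have hπ := Real.pi_pos
  obtain ⟨ψ, B, hψt, hψ0, hψ, hψδ⟩ := exists_meanZero_bump
  obtain ⟨M, hM0, hM⟩ := X.exists_pairing_bound hX hψt hψ0
  have hB : 0 ≤ B := (abs_nonneg _).trans (hψ.bound 0)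
  have key : ∀ δ : ℝ, 0 < δ → δ ≤ 1 / 4 → Integrable (fun x => h x * endpointKernel δ x) ∧
      Real.exp (Real.cos (Real.pi / 4) / Real.pi * t / δ) ≤ ∫ x, h x * endpointKernel δ x := by
    intro δ hδ0 hδ
    obtain ⟨k1, k2⟩ := integral_solution_ge h1 h2 hone hp hf ht.le hδ0 hδ
    have hc : (fun x => f t x * endpointKernel δ x) =ᵐ[volume]
        fun x => h x * endpointKernel δ x := by
      filter_upwards [hft] with x hx
      rw [hx]
    exact ⟨k1.congr hc, by rwa [← integral_congr_ae hc]⟩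
  -- Reflection moves the strong singularity of the kernel, at x = 1, to the origin, the centre of
  -- the dilations.
  let k : ℝ → ℝ := (Ioo (0 : ℝ) 1).indicator fun s => h (1 - s)
  have hk0 : ∀ s, k s ≠ 0 → s ∈ Ioo (0 : ℝ) 1 := fun s hs => by
    by_contra hn
    exact hs (indicator_of_notMem hn _)
  have hkm : AEStronglyMeasurable k := by
    have hm : AEStronglyMeasurable h volume := (hf.2.1 t ht.le).1.congr hft.symm
    exact (hm.comp_quasiMeasurePreserving
      (Measure.measurePreserving_sub_left volume (1 : ℝ)).quasiMeasurePreserving).indicator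
      measurableSet_Ioo
  have hkK : ∀ δ s, h (1 - s) * endpointKernel δ (1 - s) =
      k s * ((1 - s) ^ (-δ) * s ^ (δ - 1)) := by
    intro δ s
    by_cases hs : s ∈ Ioo (0 : ℝ) 1
    · rw [endpointKernel_one_sub hs]
      simp only [k]
      rw [indicator_of_mem hs]
    · have : (1 - s) ∉ Ioo (0 : ℝ) 1 := fun h' => hs ⟨by linarith [h'.2], by linarith [h'.1]⟩
      simp only [k]
      rw [endpointKernel, indicator_of_notMem this, indicator_of_notMem hs, mul_zero, zero_mul]
  have hW : ∀ δ : ℝ, 0 < δ → δ ≤ 1 / 4 →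
      Integrable (fun s => k s * ((1 - s) ^ (-δ) * s ^ (δ - 1))) := fun δ hδ0 hδ =>
    ((key δ hδ0 hδ).1.comp_sub_left 1).congr (Eventually.of_forall fun s => hkK δ s)
  have hWint : ∀ δ : ℝ, ∫ x, h x * endpointKernel δ x =
      ∫ s, k s * ((1 - s) ^ (-δ) * s ^ (δ - 1)) := fun δ => by
    rw [← integral_sub_left_eq_self (fun x => h x * endpointKernel δ x) volume 1]
    exact integral_congr_ae (Eventually.of_forall fun s => hkK δ s)
  have hdom : ∀ (δ : ℝ) (w : ℝ → ℝ), 0 < δ → δ ≤ 1 / 4 → Measurable w →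
      (∀ s ∈ Ioo (0 : ℝ) 1, |w s| ≤ (1 - s) ^ (-δ) * s ^ (δ - 1)) →
      Integrable fun s => k s * w s := by
    intro δ w hδ0 hδ hw hle
    refine (hW δ hδ0 hδ).mono (hkm.mul hw.aestronglyMeasurable) (Eventually.of_forall fun s => ?_)
    rw [norm_mul, norm_mul]
    rcases eq_or_ne (k s) 0 with h0 | h0
    · simp [h0]
    · exact mul_le_mul_of_nonneg_left ((hle s (hk0 s h0)).trans (le_abs_self _)) (norm_nonneg _)
  have one_le_left : ∀ (s a : ℝ), s ∈ Ioo (0 : ℝ) 1 → 0 ≤ a → 1 ≤ (1 - s) ^ (-a) :=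
    fun s a hs ha => Real.one_le_rpow_of_pos_of_le_one_of_nonpos (by linarith [hs.2])
      (by linarith [hs.1]) (by linarith)
  have one_le_right : ∀ (s a : ℝ), s ∈ Ioo (0 : ℝ) 1 → a ≤ 0 → 1 ≤ s ^ a :=
    fun s a hs ha => Real.one_le_rpow_of_pos_of_le_one_of_nonpos hs.1 hs.2.le ha
  have hki : Integrable k := by
    have := hdom (1 / 4) (fun _ => 1) (by norm_num) le_rfl measurable_const fun s hs => by
      rw [abs_one]
      exact one_le_mul_of_one_le_of_one_le (one_le_left s _ hs (by norm_num))
        (one_le_right s _ hs (by norm_num))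
    simpa using this
  have hk4 : Integrable fun s => k s * (1 - s) ^ (-(1 / 4) : ℝ) :=
    hdom (1 / 4) (fun s => (1 - s) ^ (-(1 / 4) : ℝ)) (by norm_num) le_rfl (by fun_prop)
      fun s hs => by
        rw [abs_of_nonneg (Real.rpow_nonneg (by linarith [hs.2]) _)]
        exact le_mul_of_one_le_right (Real.rpow_nonneg (by linarith [hs.2]) _)
          (one_le_right s _ hs (by norm_num))
  have hkδ : ∀ δ : ℝ, 0 < δ → δ ≤ 1 / 4 → Integrable fun s => k s * s ^ (δ - 1) :=
    fun δ hδ0 hδ => hdom δ (fun s => s ^ (δ - 1)) hδ0 hδ (by fun_prop) fun s hs => by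
      rw [abs_of_nonneg (Real.rpow_nonneg hs.1.le _)]
      exact le_mul_of_one_le_left (Real.rpow_nonneg hs.1.le _) (one_le_left s _ hs hδ0.le)
  set C₁ := ∫ s, |k s| with hC₁
  set C₂ := ∫ s, |k s * (1 - s) ^ (-(1 / 4) : ℝ)| with hC₂
  have hC₁0 : 0 ≤ C₁ := integral_nonneg fun s => abs_nonneg _
  have hC₂0 : 0 ≤ C₂ := integral_nonneg fun s => abs_nonneg _
  have hAM : ∀ r ∈ Ioc (0 : ℝ) 1, |∫ y, k (r * y) * ψ y| ≤ M := by
    intro r hr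
    have e : ∫ y, k (r * y) * ψ y = ∫ y, h (1 - r * y) * ψ y := by
      congr 1
      funext y
      rcases eq_or_ne (ψ y) 0 with h0 | h0
      · simp [h0]
      · have hy := hψ.support y h0
        have : r * y ∈ Ioo (0 : ℝ) 1 :=
          ⟨mul_pos hr.1 (by linarith [hy.1]), by nlinarith [hr.1, hr.2, hy.1, hy.2]⟩
        simp only [k]
        rw [indicator_of_mem this]
    rw [e]
    exact hM r hr.1
  set C := 2 * M + 4 * (B * C₁) + C₂ with hC
  have hC0 : 0 ≤ C := by positivity
  have bound : ∀ δ : ℝ, 0 < δ → δ ≤ 1 / 4 → ∫ x, h x * endpointKernel δ x ≤ C / δ ^ 2 := by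
    intro δ hδ0 hδ
    have b1 := abs_mellin_mul_le hψ hδ0 (by linarith) hki hk0 (hkδ δ hδ0 hδ) hAM
    have b2 := hψδ δ hδ0 (by linarith)
    set I := ∫ s, k s * s ^ (δ - 1) with hI
    have b3 : |I| * (δ / 2) ≤ M / δ + 2 * (B * C₁) :=
      (mul_le_mul_of_nonneg_left b2 (abs_nonneg _)).trans b1
    have b4 : |I| * δ ^ 2 ≤ 2 * M + 4 * (B * C₁) := by
      have h3 := mul_le_mul_of_nonneg_right b3 (show 0 ≤ 2 * δ by positivity)
      have h4 : (M / δ + 2 * (B * C₁)) * (2 * δ) = 2 * M + 4 * (B * C₁) * δ := by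
        field_simp
        ring
      have h5 : 4 * (B * C₁) * δ ≤ 4 * (B * C₁) :=
        mul_le_of_le_one_right (by positivity) (by linarith)
      nlinarith
    -- Replacing the kernel by the pure power s^{δ-1} costs O(1) as δ → 0: (1-s)^{-δ} - 1 is at most
    -- s(1-s)^{-δ}, and the factor s cancels the singularity at 0.
    have b5 : |(∫ s, k s * ((1 - s) ^ (-δ) * s ^ (δ - 1))) - I| ≤ C₂ := by
      rw [hI, ← integral_sub (hW δ hδ0 hδ) (hkδ δ hδ0 hδ), ← Real.norm_eq_abs]
      refine norm_integral_le_of_norm_le hk4.abs (Eventually.of_forall fun s => ?_)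
      rcases eq_or_ne (k s) 0 with h0 | h0
      · simp [h0]
      · have hs := hk0 s h0
        have hs1 : 0 < 1 - s := by linarith [hs.2]
        have hs0 := hs.1
        rw [← mul_sub, norm_mul, abs_mul, Real.norm_eq_abs]
        refine mul_le_mul_of_nonneg_left ?_ (abs_nonneg _)
        rw [← sub_one_mul, norm_mul, Real.norm_of_nonneg (by linarith [one_le_left s δ hs hδ0.le]),
          Real.norm_of_nonneg (by positivity), abs_of_nonneg (by positivity)]
        have c1 : (1 - s) ^ (-δ) - 1 ≤ s * (1 - s) ^ (-δ) := by
          have c2 : (1 - s) * (1 - s) ^ (-δ) ≤ 1 := by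
            rw [mul_comm, ← Real.rpow_add_one hs1.ne']
            exact Real.rpow_le_one hs1.le (by linarith) (by linarith)
          linarith
        have c3 : (1 - s) ^ (-δ) ≤ (1 - s) ^ (-(1 / 4) : ℝ) :=
          Real.rpow_le_rpow_of_exponent_ge hs1 (by linarith) (by linarith)
        calc ((1 - s) ^ (-δ) - 1) * s ^ (δ - 1) ≤ s * (1 - s) ^ (-δ) * s ^ (δ - 1) := by gcongr
          _ = s ^ δ * (1 - s) ^ (-δ) := by
            rw [Real.rpow_sub_one hs0.ne']
            field_simp
          _ ≤ 1 * (1 - s) ^ (-(1 / 4) : ℝ) := by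
            gcongr
            exact Real.rpow_le_one hs0.le hs.2.le hδ0.le
          _ = _ := one_mul _
    rw [hWint, le_div_iff₀ (by positivity)]
    have b6 := (abs_le.1 b5).2
    have b7 : C₂ * δ ^ 2 ≤ C₂ := mul_le_of_le_one_right hC₂0 (by nlinarith)
    have b8 := mul_le_mul_of_nonneg_right
      (show (∫ s, k s * ((1 - s) ^ (-δ) * s ^ (δ - 1))) ≤ |I| + C₂ by
        linarith [le_abs_self I]) (sq_nonneg δ)
    linarith
  set a := Real.cos (Real.pi / 4) / Real.pi * t with ha
  have ha0 : 0 < a := by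
    have : 0 < Real.cos (Real.pi / 4) := Real.cos_pos_of_mem_Ioo ⟨by linarith, by linarith⟩
    positivity
  -- Since e^x ≥ x³/6, the two bounds give a³ ≤ 6Cδ, which this δ violates.
  set δ := min (1 / 4) (a ^ 3 / (6 * (C + 1) * 2)) with hδdef
  have hδ0 : 0 < δ := by positivity
  have hδ4 : δ ≤ 1 / 4 := min_le_left _ _
  have f1 := (key δ hδ0 hδ4).2.trans (bound δ hδ0 hδ4)
  have f2 := (Real.pow_div_factorial_le_exp (a / δ) (by positivity) 3).trans f1
  have f3 : a ^ 3 ≤ 6 * C * δ := by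
    have e : (a / δ) ^ 3 / (Nat.factorial 3 : ℝ) = a ^ 3 / (6 * δ ^ 3) := by
      rw [div_pow, div_div, show Nat.factorial 3 = 6 from rfl]
      push_cast
      ring
    rw [e, div_le_div_iff₀ (by positivity) (by positivity)] at f2
    have : a ^ 3 * δ ^ 2 ≤ 6 * C * δ * δ ^ 2 := by linarith
    exact le_of_mul_le_mul_right this (by positivity)
  have f4 : δ * (6 * (C + 1) * 2) ≤ a ^ 3 := by
    rw [← le_div_iff₀ (by positivity)]
    exact min_le_right _ _
  nlinarith

/-- A test function equal to 1 on [-1,1] lies in every such X, hence is an admissible datum. -/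
theorem illPosedIn (X : CriticalSpace) : IllPosedIn X := by
  let b : ContDiffBump (0 : ℝ) := ⟨1, 2, by norm_num, by norm_num⟩
  have hb : IsTest b := ⟨b.contDiff, b.hasCompactSupport⟩
  have hm := fun P => memLp_of_isLipschitzCompact hb.isLipschitzCompact P
  refine ⟨b, X.test_mem _ hb, hm 1, hm ⊤, leavesAtOnce X (hm 1) (hm ⊤) ?_⟩
  refine Eventually.of_forall fun x hx => b.one_of_mem_closedBall ?_
  rw [Real.closedBall_eq_Icc]
  exact ⟨by linarith [hx.1], by simpa using hx.2⟩

theorem memBMO_chi : MemBMO chi := by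
  refine memBMO_of_bounded (B := 1) (fun a b => ?_) fun x => ?_
  · exact (memLp_one_iff_integrable.1 (memLp_chi 1)).intervalIntegrable
  · by_cases hx : x ∈ Icc (0 : ℝ) 1 <;> simp [chi, hx]

theorem theorem1p1 :
    -- well-posedness in `L^p`, with the exponential bound
    (∃ c : ℝ, 0 < c ∧ ∀ p : ℝ, 1 < p → ∀ f₀ : ℝ → ℝ, MemLp f₀ (ENNReal.ofReal p) volume →
      (∃ f : ℝ → ℝ → ℝ, IsSolution p f₀ f) ∧
      ∀ f : ℝ → ℝ → ℝ, IsSolution p f₀ f → ∀ t : ℝ, 0 ≤ t →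
        eLpNorm (f t) (ENNReal.ofReal p) volume ≤
          ENNReal.ofReal (Real.exp (c * max p (p / (p - 1)) * t)) *
            eLpNorm f₀ (ENNReal.ofReal p) volume) ∧
    -- the solution is unique, and it does not depend on the exponent
    (∀ p q : ℝ, 1 < p → 1 < q → ∀ (f₀ : ℝ → ℝ) (f g : ℝ → ℝ → ℝ),
      IsSolution p f₀ f → IsSolution q f₀ g → ∀ t : ℝ, 0 ≤ t → f t =ᵐ[volume] g t) ∧
    -- sharpness for the bounded integrable datum `χ_{[0,1]}`: for all times and large `p`
    (MemLp chi 1 volume ∧ MemLp chi ⊤ volume) ∧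
    (∀ p₀ : ℝ, 2 < p₀ → ∃ c C K : ℝ, 0 < c ∧ 0 < C ∧ 0 < K ∧ ∀ p : ℝ, p₀ ≤ p →
      ∀ f : ℝ → ℝ → ℝ, IsSolution p chi f → ∀ t : ℝ, 0 ≤ t →
        ENNReal.ofReal (C * Real.exp (c * p * t)) * eLpNorm chi (ENNReal.ofReal p) volume ≤
          eLpNorm (f t) (ENNReal.ofReal p) volume ∧
        (K ≤ p * t →
          ENNReal.ofReal (Real.exp (c * p * t)) * eLpNorm chi (ENNReal.ofReal p) volume ≤
            eLpNorm (f t) (ENNReal.ofReal p) volume)) ∧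
    -- and for all `p` on bounded time intervals
    (∀ T : ℝ, 0 < T → ∃ c C : ℝ, 0 < c ∧ 0 < C ∧ ∀ p : ℝ, 1 < p →
      ∀ f : ℝ → ℝ → ℝ, IsSolution p chi f → ∀ t : ℝ, 0 ≤ t → t ≤ T →
        ENNReal.ofReal (C * Real.exp (c * p * t)) * eLpNorm chi (ENNReal.ofReal p) volume ≤
          eLpNorm (f t) (ENNReal.ofReal p) volume) ∧
    -- ill-posedness in the spaces at the scaling of `L^∞`
    (∀ X : CriticalSpace, IllPosedIn X ∧
      ∀ f₀ ∈ X.carrier, MemLp f₀ 1 volume → MemLp f₀ ⊤ volume →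
        (∀ᵐ x ∂volume, x ∈ Set.Icc (0 : ℝ) 1 → f₀ x = 1) → LeavesAtOnce X f₀) ∧
    -- including `BMO`, where the datum `χ_{[0,1]}` itself loses its regularity
    (IllPosedIn bmo ∧ MemBMO chi ∧ LeavesAtOnce bmo chi) := by
  refine ⟨⟨12, by norm_num, fun p hp f₀ hf₀ => ⟨exists_isSolution hp hf₀, fun f hf t ht =>
    hf.eLpNorm_le hp ht⟩⟩, fun p q hp hq f₀ f g hf hg t ht => hf.ae_eq hp hq hg ht,
    ⟨memLp_chi 1, memLp_chi ⊤⟩, growth_of_lt, fun T _ => growth_of_time_le T,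
    fun X => ⟨illPosedIn X, fun f₀ _ h1 h2 hone => leavesAtOnce X h1 h2 hone⟩,
    illPosedIn bmo, memBMO_chi, leavesAtOnce bmo (memLp_chi 1) (memLp_chi ⊤) ?_⟩
  exact Eventually.of_forall fun x hx => indicator_of_mem hx _
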